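/- **Definitions.** Write $\mathbb{Z}_2$ for the group of order two. For a free $\mathbb{Z}_2$-space $X$ having the $\mathbb{Z}_2$-homotopy type of a $\mathbb{Z}_2$-complex, there is a $\mathbb{Z}_2$-map $X\to S^\infty$ (antipodal action on $S^\infty$), unique up to $\mathbb{Z}_2$-homotopy. Let $\rho\colon X/\mathbb{Z}_2\to S^\infty/\mathbb{Z}_2=\mathbb{R}P^\infty$ be the map that it covers. The Stiefel-Whitney class of $X$ is $\varpi_1(X)=\rho^*(a)\in H^1(X/\mathbb{Z}_2;\mathbb{Z}_2)$, where $a$ is the generator of $H^1(\mathbb{R}P^\infty;\mathbb{Z}_2)\cong\mathbb{Z}_2$, and the Stiefel-Whitney height of $X$ is $$\mathtt{h}(X)=\max\{n\ge 0\mid \varpi_1(X)^n\ne 0\in H^n(X/\mathbb{Z}_2;\mathbb{Z}_2)\},$$ where $\mathtt{h}(X)=\infty$ if all powers are non-zero, and $\mathtt{h}(\emptyset)=-\infty$. Here $H^*$ is singular cohomology and powers are cup powers. For a simplicial complex $K$ (possibly infinite, its realization carrying the weak topology), the simplicial deleted product $\widehat{K}^\star$ is the subcomplex of the CW complex $K\times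 K$ consisting of the closed cells $\sigma\times\tau$ where $\sigma,\tau$ are disjoint simplices of $K$. It is a free $\mathbb{Z}_2$-space by the involution $(x,y)\mapsto(y,x)$. **Proposition 3.2.** Let $K$ be a simplicial complex and let $d\ge 0$ be an integer. If $\mathtt{h}(\widehat{K}^\star)\ge d$, then for any continuous map $f\colon K\to\mathbb{R}^d$ there are disjoint simplices $\sigma,\tau$ of $K$ with $\dim\sigma+\dim\tau\le d$ such that $f(\sigma)$ and $f(\tau)$ have a point in common. -/

import Mathlib

open scoped Topology

/-! ### Singular cohomology with coefficients in `ZMod 2`, and its cup product -/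

/-- Singular `n`-simplices of a space. -/
abbrev SingularSimplex (Y : Type*) [TopologicalSpace Y] (n : ℕ) : Type _ :=
  C(stdSimplex ℝ (Fin (n + 1)), Y)

/-- The singular simplex obtained from `s` by precomposing with the affine map
`Δ^m → Δ^n` that sends the `j`-th vertex to the `θ j`-th vertex. -/
noncomputable def SingularSimplex.restrict {Y : Type*} [TopologicalSpace Y] {m n : ℕ}
    (s : SingularSimplex Y n) (θ : Fin (m + 1) → Fin (n + 1)) : SingularSimplex Y m :=
  s.comp ⟨stdSimplex.map θ, stdSimplex.continuous_map θ⟩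

theorem SingularSimplex.restrict_restrict {Y : Type*} [TopologicalSpace Y] {k m n : ℕ}
    (s : SingularSimplex Y n) (θ : Fin (m + 1) → Fin (n + 1)) (η : Fin (k + 1) → Fin (m + 1)) :
    (s.restrict θ).restrict η = s.restrict (θ ∘ η) := by
  ext x
  simp [SingularSimplex.restrict, stdSimplex.map_comp_apply]

/-- Singular `n`-cochains with coefficients in `ZMod 2`. -/
abbrev SingularCochain (Y : Type*) [TopologicalSpace Y] (n : ℕ) : Type _ :=
  SingularSimplex Y n → ZMod 2

/-- The singular coboundary operator (no signs are needed modulo 2):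
`(δ c)(s) = ∑ i, c (i-th face of s)`. -/
noncomputable def coboundary (Y : Type*) [TopologicalSpace Y] (n : ℕ) :
    SingularCochain Y n →ₗ[ZMod 2] SingularCochain Y (n + 1) where
  toFun c s := ∑ i : Fin (n + 2), c (s.restrict i.succAbove)
  map_add' c c' := by
    funext s
    simp [Finset.sum_add_distrib]
  map_smul' r c := by
    funext s
    simp [Finset.mul_sum]

/-- Singular cocycles. -/
noncomputable def cocycles (Y : Type*) [TopologicalSpace Y] (n : ℕ) :
    Submodule (ZMod 2) (SingularCochain Y n) :=
  LinearMap.ker (coboundary Y n)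

/-- Singular coboundaries. -/
noncomputable def coboundaries (Y : Type*) [TopologicalSpace Y] :
    (n : ℕ) → Submodule (ZMod 2) (SingularCochain Y n)
  | 0 => ⊥
  | n + 1 => LinearMap.range (coboundary Y n)

/-- Every coboundary is a cocycle. -/
theorem coboundary_coboundary (Y : Type*) [TopologicalSpace Y] (n : ℕ)
    (c : SingularCochain Y n) : coboundary Y (n + 1) (coboundary Y n c) = 0 := by
  funext s
  change ∑ i : Fin (n + 3), ∑ j : Fin (n + 2),
    c ((s.restrict i.succAbove).restrict j.succAbove) = 0
  simp only [SingularSimplex.restrict_restrict]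
  rw [← Finset.sum_product']
  have key : ∀ (i : Fin (n + 3)) (j : Fin (n + 2)), 
      (i.succAbove j).succAbove ∘ (j.predAbove i).succAbove = i.succAbove ∘ j.succAbove := by
    intro i j
    funext k
    exact Fin.succAbove_succAbove_succAbove_predAbove i j k
  refine Finset.sum_involution (fun p _ => (p.1.succAbove p.2, p.2.predAbove p.1)) ?_ ?_ ?_ ?_
  · rintro ⟨i, j⟩ -
    simp only [key]
    exact CharTwo.add_self_eq_zero _
  · rintro ⟨i, j⟩ - - h
    exact Fin.succAbove_ne i j (congrArg Prod.fst h)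
  · simp
  · rintro ⟨i, j⟩ -
    exact Prod.ext (Fin.succAbove_succAbove_predAbove i j) (Fin.predAbove_predAbove_succAbove i j)

/-- The singular cohomology group `H^n(Y; ZMod 2)`: cocycles modulo coboundaries. -/
abbrev SingularCohomology (Y : Type*) [TopologicalSpace Y] (n : ℕ) : Type _ :=
  cocycles Y n ⧸ (coboundaries Y n).comap (cocycles Y n).subtype

/-- The pullback of cochains along a continuous map. -/
noncomputable def cochainPullback {X Y : Type*} [TopologicalSpace X] [TopologicalSpace Y]
    (f : C(X, Y)) (n : ℕ) : SingularCochain Y n →ₗ[ZMod 2] SingularCochain X n where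
  toFun c s := c (f.comp s)
  map_add' _ _ := rfl
  map_smul' _ _ := rfl

theorem cochainPullback_coboundary {X Y : Type*} [TopologicalSpace X] [TopologicalSpace Y]
    (f : C(X, Y)) (n : ℕ) (c : SingularCochain Y n) :
    cochainPullback f (n + 1) (coboundary Y n c) = coboundary X n (cochainPullback f n c) :=
  rfl

theorem cochainPullback_mem_cocycles {X Y : Type*} [TopologicalSpace X] [TopologicalSpace Y]
    (f : C(X, Y)) (n : ℕ) (c : SingularCochain Y n) (hc : c ∈ cocycles Y n) :
    cochainPullback f n c ∈ cocycles X n := by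
  rw [cocycles, LinearMap.mem_ker] at *
  rw [← cochainPullback_coboundary, hc, map_zero]

theorem cochainPullback_mem_coboundaries {X Y : Type*} [TopologicalSpace X] [TopologicalSpace Y]
    (f : C(X, Y)) (n : ℕ) (c : SingularCochain Y n) (hc : c ∈ coboundaries Y n) :
    cochainPullback f n c ∈ coboundaries X n := by
  cases n with
  | zero =>
    have h0 : c = 0 := hc
    rw [h0, map_zero]
    exact Submodule.zero_mem _
  | succ n =>
    obtain ⟨b, rfl⟩ := hc
    exact ⟨cochainPullback f n b, (cochainPullback_coboundary f n b).symm⟩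

/-- The homomorphism `f^* : H^n(Y; ZMod 2) → H^n(X; ZMod 2)` induced by a continuous map. -/
noncomputable def SingularCohomology.pullback {X Y : Type*} [TopologicalSpace X]
    [TopologicalSpace Y] (f : C(X, Y)) (n : ℕ) :
    SingularCohomology Y n →ₗ[ZMod 2] SingularCohomology X n :=
  Submodule.mapQ _ _
    ((cochainPullback f n).restrict fun c hc => cochainPullback_mem_cocycles f n c hc)
    fun c hc => cochainPullback_mem_coboundaries f n c.1 hc

/-- The inclusion of the front `p`-face of `Δ^n`. -/
def frontFace {p n : ℕ} (h : p ≤ n) (i : Fin (p + 1)) : Fin (n + 1) :=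
  ⟨i, by omega⟩

/-- The inclusion of the back `q`-face of `Δ^n`, where `n = p + q`. -/
def backFace {p q n : ℕ} (h : p + q = n) (i : Fin (q + 1)) : Fin (n + 1) :=
  ⟨p + i, by omega⟩

/-- The cup product of cochains:
`(a ⌣ b)(s) = a (front p-face of s) * b (back q-face of s)`. -/
noncomputable def cochainCup {Y : Type*} [TopologicalSpace Y] {p q n : ℕ} (h : p + q = n)
    (a : SingularCochain Y p) (b : SingularCochain Y q) : SingularCochain Y n :=
  fun s => a (s.restrict (frontFace (by omega : p ≤ n))) * b (s.restrict (backFace h))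

/-- The Leibniz rule modulo 2. -/
theorem coboundary_cochainCup {Y : Type*} [TopologicalSpace Y] {p q n : ℕ} (h : p + q = n)
    (a : SingularCochain Y p) (b : SingularCochain Y q) :
    coboundary Y n (cochainCup h a b) =
      cochainCup (by omega : (p + 1) + q = n + 1) (coboundary Y p a) b +
        cochainCup (by omega : p + (q + 1) = n + 1) a (coboundary Y q b) := by
  subst h
  funext s
  change ∑ i : Fin (p + q + 2),
      a ((s.restrict i.succAbove).restrict _) * b ((s.restrict i.succAbove).restrict _) =
    (∑ i : Fin (p + 2), a ((s.restrict _).restrict i.succAbove)) * b (s.restrict _) +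
      a (s.restrict _) * ∑ i : Fin (q + 2), b ((s.restrict _).restrict i.succAbove)
  simp only [SingularSimplex.restrict_restrict]
  rw [Finset.sum_mul, Finset.mul_sum, Fin.sum_univ_castSucc (n := p + 1),
    Fin.sum_univ_succ (n := q + 1)]
  have e : p + q + 2 = (p + 1) + (q + 1) := by omega
  rw [← Equiv.sum_comp (finCongr e.symm), Fin.sum_univ_add]
  have hmid : a (s.restrict (frontFace (by omega : p + 1 ≤ p + q + 1) ∘
        (Fin.last (p + 1)).succAbove)) * b (s.restrict (backFace (by omega :
          (p + 1) + q = p + q + 1))) =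
      a (s.restrict (frontFace (by omega : p ≤ p + q + 1))) *
        b (s.restrict (backFace (by omega : p + (q + 1) = p + q + 1) ∘
          (0 : Fin (q + 2)).succAbove)) := by
    congr 3
    all_goals
      funext k
      apply Fin.ext
      simp [frontFace, backFace]
      try omega
  have hcancel : ∀ x y z : ZMod 2, (x + y) + (y + z) = x + z := by decide
  rw [hmid, hcancel]
  congr 1
  all_goals
    refine Finset.sum_congr rfl fun i _ => ?_
    congr 3
    all_goals
      funext k
      apply Fin.ext
      simp only [Function.comp, frontFace, backFace, Fin.succAbove, Fin.lt_def, finCongr_apply,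
        Fin.val_cast, Fin.val_castAdd, Fin.val_natAdd, Fin.val_castSucc, Fin.val_succ]
      have hi := i.2
      have hk := k.2
      split_ifs <;> simp <;> omega

theorem cochainCup_mem_cocycles {Y : Type*} [TopologicalSpace Y] {p q n : ℕ} (h : p + q = n)
    (a : SingularCochain Y p) (b : SingularCochain Y q) (ha : a ∈ cocycles Y p)
    (hb : b ∈ cocycles Y q) : cochainCup h a b ∈ cocycles Y n := by
  rw [cocycles, LinearMap.mem_ker] at *
  rw [coboundary_cochainCup, ha, hb]
  funext s
  simp [cochainCup]

theorem cochainCup_mem_coboundaries_left {Y : Type*} [TopologicalSpace Y] {p q n : ℕ}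
    (h : p + q = n) (a : SingularCochain Y p) (b : SingularCochain Y q)
    (ha : a ∈ coboundaries Y p) (hb : b ∈ cocycles Y q) :
    cochainCup h a b ∈ coboundaries Y n := by
  cases p with
  | zero =>
    have h0 : a = 0 := ha
    have h1 : cochainCup h a b = 0 := by
      funext s
      simp [cochainCup, h0]
    rw [h1]
    exact Submodule.zero_mem _
  | succ p =>
    obtain ⟨c, rfl⟩ := ha
    obtain ⟨n, rfl⟩ : ∃ m, n = m + 1 := ⟨p + q, by omega⟩
    refine ⟨cochainCup (by omega : p + q = n) c b, ?_⟩
    rw [cocycles, LinearMap.mem_ker] at hb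
    rw [coboundary_cochainCup, hb]
    funext s
    simp [cochainCup]

theorem cochainCup_mem_coboundaries_right {Y : Type*} [TopologicalSpace Y] {p q n : ℕ}
    (h : p + q = n) (a : SingularCochain Y p) (b : SingularCochain Y q)
    (ha : a ∈ cocycles Y p) (hb : b ∈ coboundaries Y q) :
    cochainCup h a b ∈ coboundaries Y n := by
  cases q with
  | zero =>
    have h0 : b = 0 := hb
    have h1 : cochainCup h a b = 0 := by
      funext s
      simp [cochainCup, h0]
    rw [h1]
    exact Submodule.zero_mem _
  | succ q =>
    obtain ⟨c, rfl⟩ := hb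
    obtain ⟨n, rfl⟩ : ∃ m, n = m + 1 := ⟨p + q, by omega⟩
    refine ⟨cochainCup (by omega : p + q = n) a c, ?_⟩
    rw [cocycles, LinearMap.mem_ker] at ha
    rw [coboundary_cochainCup, ha]
    funext s
    simp [cochainCup]

/-- The cup product `H^p(Y; ZMod 2) × H^q(Y; ZMod 2) → H^n(Y; ZMod 2)`, where `n = p + q`,
induced by the cup product of cocycles. -/
noncomputable def SingularCohomology.cup {Y : Type*} [TopologicalSpace Y] {p q n : ℕ}
    (h : p + q = n) (x : SingularCohomology Y p) (y : SingularCohomology Y q) :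
    SingularCohomology Y n :=
  Quotient.liftOn₂' x y
    (fun a b => Submodule.Quotient.mk
      ⟨cochainCup h a.1 b.1, cochainCup_mem_cocycles h a.1 b.1 a.2 b.2⟩)
    (by
      intro a b a' b' haa hbb
      rw [Submodule.quotientRel_def] at haa hbb
      rw [Submodule.Quotient.eq]
      have h1 := cochainCup_mem_coboundaries_left h _ _ haa b.2
      have h2 := cochainCup_mem_coboundaries_right h _ _ a'.2 hbb
      have h3 := Submodule.add_mem _ h1 h2
      refine (congrArg (· ∈ coboundaries Y n) ?_).mp h3
      funext s
      simp [cochainCup]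
      ring)

/-- The unit of the cohomology ring: the class of the `0`-cocycle with constant value `1`. -/
noncomputable def SingularCohomology.one (Y : Type*) [TopologicalSpace Y] :
    SingularCohomology Y 0 :=
  Submodule.Quotient.mk ⟨fun _ => 1, by
    rw [cocycles, LinearMap.mem_ker]
    funext s
    change ∑ _i : Fin 2, (1 : ZMod 2) = 0
    decide⟩

/-- The `n`-th cup power `x^n ∈ H^n(Y; ZMod 2)` of a class `x` of degree one. -/
noncomputable def SingularCohomology.cupPow {Y : Type*} [TopologicalSpace Y]
    (x : SingularCohomology Y 1) : (n : ℕ) → SingularCohomology Y n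
  | 0 => SingularCohomology.one Y
  | n + 1 => SingularCohomology.cup rfl (SingularCohomology.cupPow x n) x

/-! ### Spaces with an action of the group of order two -/

/-- The group of order two, written multiplicatively. -/
abbrev Z2 : Type := Multiplicative (ZMod 2)

/-- The action of the group of order two given by an involution. -/
@[reducible]
def involutionAction {X : Type*} (τ : X → X) (hτ : ∀ x, τ (τ x) = x) : MulAction Z2 X where
  smul g x := if g = 1 then x else τ x
  one_smul x := if_pos rfl
  mul_smul g h x := by
    change (if g * h = 1 then x else τ x) =
      if g = 1 then (if h = 1 then x else τ x) else τ (if h = 1 then x else τ x)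
    have key : ∀ g h : Z2, g * h = 1 ↔ (g = 1 ↔ h = 1) := by decide
    have := key g h
    by_cases hg : g = 1 <;> by_cases hh : h = 1 <;> simp [hg, hh, hτ] at this ⊢
    simp [this]

/-- The orbit space `X / Z2`, with the quotient topology. -/
abbrev OrbitSpace (X : Type*) [MulAction Z2 X] : Type _ :=
  MulAction.orbitRel.Quotient Z2 X

/-- The action given by a continuous involution is continuous. -/
theorem continuousConstSMul_involutionAction {X : Type*} [TopologicalSpace X] (τ : X → X)
    (hτ : ∀ x, τ (τ x) = x) (hc : Continuous τ) :
    @ContinuousConstSMul Z2 X _ (involutionAction τ hτ).toSMul := by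
  let _ := involutionAction τ hτ
  refine ⟨fun g => ?_⟩
  change Continuous fun x => if g = 1 then x else τ x
  split_ifs
  · exact continuous_id
  · exact hc

/-- The action given by an involution without fixed points is free. -/
theorem isCancelSMul_involutionAction {X : Type*} (τ : X → X) (hτ : ∀ x, τ (τ x) = x)
    (hf : ∀ x, τ x ≠ x) : @IsCancelSMul Z2 X (involutionAction τ hτ).toSMul := by
  let _ := involutionAction τ hτ
  have hsmul : ∀ (g : Z2) (x : X), g • x = if g = 1 then x else τ x := fun _ _ => rfl
  have hne : ∀ g h : Z2, g ≠ 1 → h ≠ 1 → g = h := by decide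
  refine { left_cancel' := fun g x y h => smul_left_cancel g h, right_cancel' := ?_ }
  intro g h x hx
  rw [hsmul, hsmul] at hx
  by_cases hg : g = 1 <;> by_cases hh : h = 1
  · rw [hg, hh]
  · rw [if_pos hg, if_neg hh] at hx
    exact absurd hx.symm (hf x)
  · rw [if_neg hg, if_pos hh] at hx
    exact absurd hx (hf x)
  · exact hne g h hg hh

/-- The map of orbit spaces covered by a continuous equivariant map. -/
def OrbitSpace.map {X Y : Type*} [TopologicalSpace X] [TopologicalSpace Y] [MulAction Z2 X]
    [MulAction Z2 Y] (φ : X →[Z2] Y) (hφ : Continuous φ) : C(OrbitSpace X, OrbitSpace Y) where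
  toFun := Quotient.map φ (by
    rintro x y ⟨g, rfl⟩
    exact ⟨g, (map_smul φ g y).symm⟩)
  continuous_toFun := Continuous.quotient_map' hφ _

/-! ### The weak topology -/

/-- The weak topology on a set `X` determined by subsets `A i`, each with its subspace topology
from an auxiliary topology `t` on `X`: a subset of `X` is open (closed) if and only if its
intersection with every `A i` is open (closed) in `A i`. -/
@[reducible]
def weakTopology {X ι : Type*} (t : TopologicalSpace X) (A : ι → Set X) : TopologicalSpace X :=
  ⨆ i, TopologicalSpace.coinduced ((↑) : A i → X) (TopologicalSpace.induced (↑) t)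

theorem isOpen_weakTopology {X ι : Type*} (t : TopologicalSpace X) (A : ι → Set X) (U : Set X) :
    IsOpen[weakTopology t A] U ↔
      ∀ i, IsOpen[TopologicalSpace.induced ((↑) : A i → X) t] ((↑) ⁻¹' U : Set (A i)) := by
  simp only [isOpen_iSup_iff, isOpen_coinduced]

/-- A map that sends every set `A i` into some `A j` and is continuous for `t` is continuous for the weak
topology. -/
theorem continuous_weakTopology {X ι : Type*} (t : TopologicalSpace X) (A : ι → Set X)
    (f : X → X) (hf : Continuous[t, t] f) (e : ι → ι) (he : ∀ i, ∀ x ∈ A i, f x ∈ A (e i)) :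
    Continuous[weakTopology t A, weakTopology t A] f := by
  refine (@continuous_def X X (weakTopology t A) (weakTopology t A) f).2 fun U hU => ?_
  rw [isOpen_weakTopology] at hU ⊢
  intro i
  have hc : Continuous[TopologicalSpace.induced ((↑) : A i → X) t,
      TopologicalSpace.induced ((↑) : A (e i) → X) t]
      (fun x : A i => (⟨f x, he i x x.2⟩ : A (e i))) := by
    refine continuous_induced_rng.2 ?_
    exact @Continuous.comp _ _ _ (TopologicalSpace.induced ((↑) : A i → X) t) t t _ _
      hf continuous_induced_dom
  exact @IsOpen.preimage _ _ (TopologicalSpace.induced ((↑) : A i → X) t)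
    (TopologicalSpace.induced ((↑) : A (e i) → X) t) _ hc _ (hU (e i))

/-! ### The infinite sphere and infinite real projective space -/

/-- The infinite sphere: finitely supported real sequences with `∑ x_i ^ 2 = 1`. -/
def InfiniteSphere : Type :=
  {x : ℕ →₀ ℝ // x.sum (fun _ t => t ^ 2) = 1}

/-- The sphere `S^(n-1)` inside the infinite sphere. -/
def InfiniteSphere.finiteSphere (n : ℕ) : Set InfiniteSphere :=
  {x | ∀ i, n ≤ i → x.1 i = 0}

/-- The infinite sphere is topologized as the union (colimit) of the finite-dimensional
spheres, each of which has its Euclidean topology. -/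
instance : TopologicalSpace InfiniteSphere :=
  weakTopology (TopologicalSpace.induced (fun x : InfiniteSphere => (x.1 : ℕ → ℝ)) inferInstance)
    InfiniteSphere.finiteSphere

/-- The antipodal involution. -/
noncomputable def InfiniteSphere.neg (x : InfiniteSphere) : InfiniteSphere :=
  ⟨-x.1, by
    have h := x.2
    rw [Finsupp.sum_neg_index (by simp)]
    simpa using h⟩

theorem InfiniteSphere.neg_neg (x : InfiniteSphere) : x.neg.neg = x :=
  Subtype.ext (_root_.neg_neg x.1)

/-- The antipodal action on the infinite sphere. -/
noncomputable instance : MulAction Z2 InfiniteSphere :=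
  involutionAction InfiniteSphere.neg InfiniteSphere.neg_neg

theorem InfiniteSphere.continuous_neg : Continuous InfiniteSphere.neg := by
  refine continuous_weakTopology _ _ _ ?_ id ?_
  · rw [continuous_induced_rng]
    have h : Continuous[TopologicalSpace.induced (fun x : InfiniteSphere => (x.1 : ℕ → ℝ))
        inferInstance, inferInstance] (fun x : InfiniteSphere => (x.1 : ℕ → ℝ)) :=
      continuous_induced_dom
    have hn : Continuous fun y : ℕ → ℝ => -y := by fun_prop
    exact @Continuous.comp _ _ _ (TopologicalSpace.induced
      (fun x : InfiniteSphere => (x.1 : ℕ → ℝ)) inferInstance) _ _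
      (fun x : InfiniteSphere => (x.1 : ℕ → ℝ)) (fun y : ℕ → ℝ => -y) hn h
  · intro n x hx i hi
    change -x.1 i = 0
    rw [hx i hi, neg_zero]

theorem InfiniteSphere.neg_ne (x : InfiniteSphere) : x.neg ≠ x := by
  intro h
  have h0 : x.1 = 0 := by
    ext i
    have hi : -x.1 i = x.1 i := DFunLike.congr_fun (congrArg Subtype.val h) i
    change x.1 i = 0
    linarith
  have h1 := x.2
  rw [h0] at h1
  simp at h1

instance : ContinuousConstSMul Z2 InfiniteSphere :=
  continuousConstSMul_involutionAction _ InfiniteSphere.neg_neg InfiniteSphere.continuous_neg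

instance : IsCancelSMul Z2 InfiniteSphere :=
  isCancelSMul_involutionAction _ InfiniteSphere.neg_neg InfiniteSphere.neg_ne

/-- Infinite-dimensional real projective space. -/
abbrev InfiniteProjectiveSpace : Type :=
  OrbitSpace InfiniteSphere

/-! ### The Stiefel-Whitney class and the Stiefel-Whitney height -/

/-- `w` is the Stiefel-Whitney class of the free `Z2`-space `X`, `ϖ₁(X) = ρ^*(a) ∈ H^1(X / Z2; ZMod 2)`: here
`ρ : X / Z2 → ℝP^∞` is the classifying map, covered by an equivariant map `X → S^∞`, and `a` is
the generator of `H^1(ℝP^∞; ZMod 2) ≅ ZMod 2`, that is, its nonzero element. For a free `Z2`-complex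
the equivariant map exists and is unique up to equivariant homotopy, so there is exactly one such
class `w`. -/
def IsStiefelWhitneyClass (X : Type*) [TopologicalSpace X] [MulAction Z2 X]
    [ContinuousConstSMul Z2 X] [IsCancelSMul Z2 X] (w : SingularCohomology (OrbitSpace X) 1) : Prop :=
  ∃ (φ : X →[Z2] InfiniteSphere) (hφ : Continuous φ)
    (a : SingularCohomology InfiniteProjectiveSpace 1),
    a ≠ 0 ∧ w = SingularCohomology.pullback (OrbitSpace.map φ hφ) 1 a

/-- The Stiefel-Whitney height of a free `Z2`-space, `h(X) = max {n ≥ 0 | ϖ₁(X)^n ≠ 0}`. It is `⊤` when all powers are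
nonzero, and `⊥` when there is no such `n` (which for a free `Z2`-complex means that `X` is
empty). -/
noncomputable def stiefelWhitneyHeight (X : Type*) [TopologicalSpace X] [MulAction Z2 X]
    [ContinuousConstSMul Z2 X] [IsCancelSMul Z2 X] :
    WithBot ℕ∞ :=
  sSup {h | ∃ (n : ℕ) (w : SingularCohomology (OrbitSpace X) 1),
    IsStiefelWhitneyClass X w ∧ w.cupPow n ≠ 0 ∧ h = n}

/-! ### Simplicial complexes and the simplicial deleted product -/

/-- The geometric realization of a simplicial complex, in barycentric coordinates. -/
def GeometricRealization {V : Type*} (K : PreAbstractSimplicialComplex V) : Type _ :=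
  {x : V →₀ ℝ // x.support ∈ K.faces ∧ (∀ v, 0 ≤ x v) ∧ x.sum (fun _ t => t) = 1}

/-- The closed simplex of the realization spanned by a set `σ` of vertices. -/
def closedSimplex {V : Type*} (K : PreAbstractSimplicialComplex V) (σ : Finset V) :
    Set (GeometricRealization K) :=
  {x | x.1.support ⊆ σ}

/-- The realization has the weak topology determined by its closed simplices, each of which has its
Euclidean topology. -/
instance {V : Type*} (K : PreAbstractSimplicialComplex V) :
    TopologicalSpace (GeometricRealization K) :=
  weakTopology
    (TopologicalSpace.induced (fun x : GeometricRealization K => (x.1 : V → ℝ)) inferInstance)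
    (fun σ : K.faces => closedSimplex K σ)

/-- The pairs of disjoint simplices of `K`. -/
abbrev DisjointFaces {V : Type*} (K : PreAbstractSimplicialComplex V) : Type _ :=
  {c : Finset V × Finset V // c.1 ∈ K.faces ∧ c.2 ∈ K.faces ∧ Disjoint c.1 c.2}

/-- The underlying set of the simplicial deleted product: the union in `K × K` of the closed
cells `σ × τ` with `σ` and `τ` disjoint simplices of `K`. -/
def DeletedProduct {V : Type*} (K : PreAbstractSimplicialComplex V) : Type _ :=
  {p : GeometricRealization K × GeometricRealization K //
    ∃ c : DisjointFaces K, p.1 ∈ closedSimplex K c.1.1 ∧ p.2 ∈ closedSimplex K c.1.2}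

/-- The closed cell `σ × τ` of the simplicial deleted product. -/
def DeletedProduct.closedCell {V : Type*} {K : PreAbstractSimplicialComplex V}
    (c : DisjointFaces K) : Set (DeletedProduct K) :=
  {p | p.1.1 ∈ closedSimplex K c.1.1 ∧ p.1.2 ∈ closedSimplex K c.1.2}

/-- The topology of the simplicial deleted product as a CW complex: the weak topology determined by
its closed cells `σ × τ`, each of which has the product topology. -/
instance {V : Type*} (K : PreAbstractSimplicialComplex V) :
    TopologicalSpace (DeletedProduct K) :=
  weakTopology (TopologicalSpace.induced (fun p : DeletedProduct K => p.1) inferInstance)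
    DeletedProduct.closedCell

/-- The involution `(x, y) ↦ (y, x)`. -/
def DeletedProduct.swap {V : Type*} {K : PreAbstractSimplicialComplex V}
    (p : DeletedProduct K) : DeletedProduct K :=
  ⟨(p.1.2, p.1.1), by
    obtain ⟨⟨c, h1, h2, h3⟩, hx, hy⟩ := p.2
    exact ⟨⟨(c.2, c.1), h2, h1, h3.symm⟩, hy, hx⟩⟩

/-- The action of the group of order two on the simplicial deleted product that switches the
factors. -/
instance {V : Type*} (K : PreAbstractSimplicialComplex V) : MulAction Z2 (DeletedProduct K) :=
  involutionAction DeletedProduct.swap fun _ => rfl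

theorem DeletedProduct.continuous_swap {V : Type*} {K : PreAbstractSimplicialComplex V} :
    Continuous (DeletedProduct.swap (K := K)) := by
  refine continuous_weakTopology _ _ _ ?_
    (fun c => ⟨(c.1.2, c.1.1), c.2.2.1, c.2.1, c.2.2.2.symm⟩) fun c x hx => ⟨hx.2, hx.1⟩
  rw [continuous_induced_rng]
  have h : Continuous[TopologicalSpace.induced (fun p : DeletedProduct K => p.1) inferInstance,
      inferInstance] (fun p : DeletedProduct K => p.1) := continuous_induced_dom
  exact @Continuous.comp _ _ _
    (TopologicalSpace.induced (fun p : DeletedProduct K => p.1) inferInstance) _ _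
    (fun p : DeletedProduct K => p.1) Prod.swap
    (_root_.continuous_swap (X := GeometricRealization K) (Y := GeometricRealization K)) h

theorem DeletedProduct.swap_ne {V : Type*} {K : PreAbstractSimplicialComplex V}
    (p : DeletedProduct K) : p.swap ≠ p := by
  intro h
  obtain ⟨c, hx, hy⟩ := p.2
  have hxy : p.1.2 = p.1.1 := congrArg (fun q : DeletedProduct K => q.1.1) h
  rw [hxy] at hy
  obtain ⟨v, hv⟩ := (K.isRelLowerSet_faces p.1.1.2.1).1
  exact Finset.disjoint_left.1 c.2.2.2 (hx hv) (hy hv)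

instance {V : Type*} (K : PreAbstractSimplicialComplex V) :
    ContinuousConstSMul Z2 (DeletedProduct K) :=
  continuousConstSMul_involutionAction _ (fun _ => rfl) DeletedProduct.continuous_swap

instance {V : Type*} (K : PreAbstractSimplicialComplex V) : IsCancelSMul Z2 (DeletedProduct K) :=
  isCancelSMul_involutionAction _ (fun _ => rfl) DeletedProduct.swap_ne

/-- The dimension of a simplex, given by its (nonempty) set of vertices. -/
def simplexDim {V : Type*} (σ : Finset V) : ℕ :=
  σ.card - 1

/-! Suppose that disjoint simplices of total dimension at most d always have disjoint images. Then
F(x, y) = f x - f y has no zero on the d-skeleton of the deleted product, so it maps that skeleton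
equivariantly to ℝ^d minus the origin, that is, to S^(d-1) up to equivariant homotopy. The d-th
power of the class dies on ℝP^(d-1), and a degree d class that dies on the d-skeleton is zero. For d
= 0 only nonemptiness is at stake.

The argument is carried out with explicit cochains. Let τ be the involution. On the double cover the
class becomes δg with g odd, meaning that τ adds 1 to it
(`IsStiefelWhitneyClass.exists_representative`, which rests on the vanishing of H^1 of the infinite
sphere). A cochain of the orbit space is a coboundary as soon as its lift is the coboundary of an
invariant cochain (`OrbitSpace.mem_coboundaries`). So the goal is (δg)^d = δb with b invariant.

Such a b exists if there are cochains with h_0 + τh_0 = 1, h_(k+1) + τh_(k+1) = δh_k and δh_(d-1) =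
0 (`exists_invariant_coboundary_eq_cochainPow`). The last two relations are needed only on simplices
subordinate to an invariant open cover, because barycentric subdivision absorbs the difference
equivariantly (`exists_coboundary_eq_of_eq_zero_on_small`).

The h_k come from the coordinates of F. Let g_j be the sign of the j-th coordinate, with ties broken
so that g_j is odd. On tuples of points, T_k = δg_0 ⋯ δg_(k-1) g_k satisfies the same relations
formally, and δT_(d-1) = δg_0 ⋯ δg_(d-1) vanishes on a tuple along which some g_j with j < d is
constant. A singular simplex is turned into a chain of such tuples in three equivariant moves: take
the vertices of K that dominate at its corners, map the resulting tuple in V × V to a chain of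
products of simplices (`ListPairChain.ofTuples`), and map that to tuples of points
(`ListPairChain.carrierMap`). The last map exists up to dimension d by acyclic carriers
(`DeletedProduct.isAcyclicCarrier`): a cell is convex, F has no zero on it, and a cone over a small
cycle becomes small after enough subdivision. -/

/-! ### Ordered tuple chains modulo 2 -/

/-- Formal sums modulo 2 of `n`-tuples of points. -/
abbrev TupleChain (P : Type*) (n : ℕ) : Type _ := (Fin n → P) →₀ ZMod 2

/-- The chains that are sums of elements of `A`. -/
abbrev chainsOn {α : Type*} (A : Set α) : Submodule (ZMod 2) (α →₀ ZMod 2) :=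
  Finsupp.supported (ZMod 2) (ZMod 2) A

theorem single_mem_chainsOn {α : Type*} {A : Set α} {a : α} (h : a ∈ A) :
    Finsupp.single a (1 : ZMod 2) ∈ chainsOn A :=
  Finsupp.single_mem_supported _ _ h

theorem map_mem_of_chainsOn {α M : Type*} [AddCommGroup M] [Module (ZMod 2) M] {A : Set α}
    {N : Submodule (ZMod 2) M} (f : (α →₀ ZMod 2) →ₗ[ZMod 2] M)
    (h : ∀ a ∈ A, f (Finsupp.single a 1) ∈ N) {z : α →₀ ZMod 2} (hz : z ∈ chainsOn A) :
    f z ∈ N := by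
  rw [chainsOn, Finsupp.supported_eq_span_single] at hz
  have : Submodule.span (ZMod 2) ((fun a => Finsupp.single a (1 : ZMod 2)) '' A) ≤ N.comap f := by
    rw [Submodule.span_le]
    rintro _ ⟨a, ha, rfl⟩
    exact h a ha
  exact this hz

theorem map_eq_of_chainsOn {α M : Type*} [AddCommGroup M] [Module (ZMod 2) M] {A : Set α}
    (f g : (α →₀ ZMod 2) →ₗ[ZMod 2] M)
    (h : ∀ a ∈ A, f (Finsupp.single a 1) = g (Finsupp.single a 1)) {z : α →₀ ZMod 2}
    (hz : z ∈ chainsOn A) : f z = g z := by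
  have := map_mem_of_chainsOn (N := ⊥) (f - g) (fun a ha => by simp [h a ha]) hz
  simpa [sub_eq_zero] using this

theorem chain_add_self {M : Type*} [AddCommGroup M] [Module (ZMod 2) M] (x : M) : x + x = 0 := by
  have h : (2 : ZMod 2) • x = 0 := by rw [show (2 : ZMod 2) = 0 from rfl, zero_smul]
  rwa [two_smul] at h

theorem chain_eq_of_add_eq_zero {M : Type*} [AddCommGroup M] [Module (ZMod 2) M] {x y : M}
    (h : x + y = 0) : x = y := by
  have h2 : x + y + y = y := by rw [h, zero_add]
  rwa [add_assoc, chain_add_self, add_zero] at h2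

theorem chain_add_add_cancel {M : Type*} [AddCommGroup M] [Module (ZMod 2) M] (x y : M) :
    x + (x + y) = y := by
  rw [← add_assoc, chain_add_self, zero_add]

theorem chain_add_add_cancel_comm {M : Type*} [AddCommGroup M] [Module (ZMod 2) M] (x y : M) :
    x + y + x = y := by
  rw [add_comm x y, add_assoc, chain_add_self, add_zero]

namespace TupleChain

variable {P P' : Type*}

/-- The boundary of the augmented ordered chain complex. -/
noncomputable def bd (P : Type*) (n : ℕ) : TupleChain P (n + 1) →ₗ[ZMod 2] TupleChain P n :=
  Finsupp.linearCombination (ZMod 2) fun v => ∑ i : Fin (n + 1), Finsupp.single (v ∘ i.succAbove) 1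

/-- The cone with apex `p`. -/
noncomputable def cone (p : P) (n : ℕ) : TupleChain P n →ₗ[ZMod 2] TupleChain P (n + 1) :=
  Finsupp.lmapDomain (ZMod 2) (ZMod 2) (fun v : Fin n → P => (Fin.cons p v : Fin (n + 1) → P))

/-- The chain map induced by a map of points. -/
noncomputable def map (φ : P → P') (n : ℕ) : TupleChain P n →ₗ[ZMod 2] TupleChain P' n :=
  Finsupp.lmapDomain (ZMod 2) (ZMod 2) (fun v : Fin n → P => φ ∘ v)

@[simp]
theorem bd_single {n : ℕ} (v : Fin (n + 1) → P) :
    bd P n (Finsupp.single v 1) = ∑ i : Fin (n + 1), Finsupp.single (v ∘ i.succAbove) 1 := by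
  simp [bd]

@[simp]
theorem cone_single {n : ℕ} (p : P) (v : Fin n → P) :
    cone p n (Finsupp.single v 1) = Finsupp.single (Fin.cons p v : Fin (n + 1) → P) 1 := by
  simp [cone]

@[simp]
theorem map_single {n : ℕ} (φ : P → P') (v : Fin n → P) :
    map φ n (Finsupp.single v 1) = Finsupp.single (φ ∘ v) 1 := by
  simp [map]

theorem cons_comp_succAbove_succ {n : ℕ} (p : P) (v : Fin (n + 1) → P) (i : Fin (n + 1)) :
    (Fin.cons p v : Fin (n + 2) → P) ∘ i.succ.succAbove = Fin.cons p (v ∘ i.succAbove) := by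
  funext k
  refine Fin.cases ?_ (fun k => ?_) k <;> simp

theorem cons_comp_succAbove_zero {n : ℕ} (p : P) (v : Fin n → P) :
    (Fin.cons p v : Fin (n + 1) → P) ∘ (0 : Fin (n + 1)).succAbove = v := by
  funext k
  simp

/-- Deleting the apex returns the tuple itself, and deleting any other entry commutes with adding
the apex. This identity replaces all index combinatorics below. -/
theorem bd_cone {n : ℕ} (p : P) (z : TupleChain P (n + 1)) :
    bd P (n + 1) (cone p (n + 1) z) = z + cone p n (bd P n z) := by
  refine DFunLike.congr_fun (f := (bd P (n + 1)) ∘ₗ (cone p (n + 1)))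
    (g := LinearMap.id + (cone p n) ∘ₗ (bd P n)) ?_ z
  refine Finsupp.lhom_ext' fun v => LinearMap.ext_ring ?_
  simp only [LinearMap.comp_apply, Finsupp.lsingle_apply, cone_single, bd_single,
    LinearMap.add_apply, LinearMap.id_apply, map_sum]
  rw [Fin.sum_univ_succ]
  simp only [cons_comp_succAbove_succ, cons_comp_succAbove_zero]

/-- The bottom case of the cone formula. The complex is augmented by the empty tuple, so no
correction term appears. -/
theorem bd_cone_zero (p : P) (z : TupleChain P 0) : bd P 0 (cone p 0 z) = z := by
  refine DFunLike.congr_fun (f := (bd P 0) ∘ₗ (cone p 0)) (g := LinearMap.id) ?_ z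
  refine Finsupp.lhom_ext' fun v => LinearMap.ext_ring ?_
  simp only [LinearMap.comp_apply, Finsupp.lsingle_apply, cone_single, bd_single,
    LinearMap.id_apply]
  rw [Fin.sum_univ_succ]
  simp only [cons_comp_succAbove_zero]
  simp

/-- Every tuple is the cone over its tail. -/
theorem exists_cone_eq {n : ℕ} (v : Fin (n + 1) → P) :
    Finsupp.single v (1 : ZMod 2) = cone (v 0) n (Finsupp.single (Fin.tail v) 1) := by
  rw [cone_single, Fin.cons_self_tail]

/-- Every tuple is a cone, so by induction the cone formula leaves two equal terms, which cancel
modulo 2. -/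
theorem bd_bd : ∀ (n : ℕ) (z : TupleChain P (n + 2)), bd P n (bd P (n + 1) z) = 0 := by
  intro n
  induction n with
  | zero =>
    intro z
    refine DFunLike.congr_fun (f := (bd P 0) ∘ₗ (bd P 1)) (g := 0) ?_ z
    refine Finsupp.lhom_ext' fun v => LinearMap.ext_ring ?_
    simp only [LinearMap.comp_apply, Finsupp.lsingle_apply, LinearMap.zero_apply]
    rw [exists_cone_eq, bd_cone, map_add, bd_cone_zero, chain_add_self]
  | succ n ih =>
    intro z
    refine DFunLike.congr_fun (f := (bd P (n + 1)) ∘ₗ (bd P (n + 2))) (g := 0) ?_ z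
    refine Finsupp.lhom_ext' fun v => LinearMap.ext_ring ?_
    simp only [LinearMap.comp_apply, Finsupp.lsingle_apply, LinearMap.zero_apply]
    rw [exists_cone_eq, bd_cone, map_add, bd_cone, ih, map_zero, add_zero, chain_add_self]

theorem map_bd {n : ℕ} (φ : P → P') (z : TupleChain P (n + 1)) :
    map φ n (bd P n z) = bd P' n (map φ (n + 1) z) := by
  refine DFunLike.congr_fun (f := (map φ n) ∘ₗ (bd P n)) (g := (bd P' n) ∘ₗ (map φ (n + 1))) ?_ z
  refine Finsupp.lhom_ext' fun v => LinearMap.ext_ring ?_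
  simp only [LinearMap.comp_apply, Finsupp.lsingle_apply, map_single, bd_single, map_sum]
  rfl

theorem map_cone {n : ℕ} (φ : P → P') (p : P) (z : TupleChain P n) :
    map φ (n + 1) (cone p n z) = cone (φ p) n (map φ n z) := by
  refine DFunLike.congr_fun (f := (map φ (n + 1)) ∘ₗ (cone p n))
    (g := (cone (φ p) n) ∘ₗ (map φ n)) ?_ z
  refine Finsupp.lhom_ext' fun v => LinearMap.ext_ring ?_
  simp only [LinearMap.comp_apply, Finsupp.lsingle_apply, map_single, cone_single]
  congr 1
  funext k
  refine Fin.cases ?_ (fun k => ?_) k <;> simp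

/-- The tuples with entries in a set. -/
def tuplesIn (Q : Set P) (n : ℕ) : Set (Fin n → P) := {v | ∀ i, v i ∈ Q}

/-- The tuples with all entries in a common member of a family of sets. -/
def tuplesSmall (F : Set (Set P)) (n : ℕ) : Set (Fin n → P) := {v | ∃ Q ∈ F, v ∈ tuplesIn Q n}

theorem tuplesIn_subset_tuplesSmall {F : Set (Set P)} {Q : Set P} (hQ : Q ∈ F) (n : ℕ) :
    tuplesIn Q n ⊆ tuplesSmall F n := fun _ hw => ⟨Q, hQ, hw⟩

theorem bd_mem {n : ℕ} {A : Set (Fin (n + 1) → P)} {B : Set (Fin n → P)}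
    (h : ∀ v ∈ A, ∀ i : Fin (n + 1), v ∘ i.succAbove ∈ B) {z : TupleChain P (n + 1)}
    (hz : z ∈ chainsOn A) : bd P n z ∈ chainsOn B := by
  refine map_mem_of_chainsOn _ (fun v hv => ?_) hz
  rw [bd_single]
  exact Submodule.sum_mem _ fun i _ => single_mem_chainsOn (h v hv i)

theorem bd_mem_tuplesIn {n : ℕ} {Q : Set P} {z : TupleChain P (n + 1)}
    (hz : z ∈ chainsOn (tuplesIn Q (n + 1))) : bd P n z ∈ chainsOn (tuplesIn Q n) :=
  bd_mem (A := tuplesIn Q (n + 1)) (B := tuplesIn Q n) (fun _ hv i j => hv (i.succAbove j)) hz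

theorem cone_mem {n : ℕ} {p : P} {A : Set (Fin n → P)} {B : Set (Fin (n + 1) → P)}
    (h : ∀ v ∈ A, (Fin.cons p v : Fin (n + 1) → P) ∈ B) {z : TupleChain P n}
    (hz : z ∈ chainsOn A) : cone p n z ∈ chainsOn B := by
  refine map_mem_of_chainsOn _ (fun v hv => ?_) hz
  rw [cone_single]
  exact single_mem_chainsOn (h v hv)

theorem map_mem {n : ℕ} {φ : P → P'} {A : Set (Fin n → P)} {B : Set (Fin n → P')}
    (h : ∀ v ∈ A, φ ∘ v ∈ B) {z : TupleChain P n}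
    (hz : z ∈ chainsOn A) : map φ n z ∈ chainsOn B := by
  refine map_mem_of_chainsOn _ (fun v hv => ?_) hz
  rw [map_single]
  exact single_mem_chainsOn (h v hv)

theorem cons_mem_tuplesIn {n : ℕ} {p : P} {Q : Set P} {v : Fin n → P} (hp : p ∈ Q)
    (hv : v ∈ tuplesIn Q n) : (Fin.cons p v : Fin (n + 1) → P) ∈ tuplesIn Q (n + 1) := by
  intro i
  refine Fin.cases ?_ (fun i => ?_) i
  · simpa using hp
  · simpa using hv i

end TupleChain

/-- A set with an operation that assigns a barycenter to every nonempty tuple of points. -/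
class HasBarycenter (P : Type*) where
  /-- The barycenter of a nonempty tuple. -/
  bary : {n : ℕ} → (Fin (n + 1) → P) → P

open HasBarycenter (bary)

/-! ### Barycentric subdivision of tuples and filling of small cycles. -/

namespace TupleChain

variable {P P' : Type*} [HasBarycenter P] [HasBarycenter P']

/-- Barycentric subdivision. -/
noncomputable def sd (P : Type*) [HasBarycenter P] :
    (n : ℕ) → TupleChain P n →ₗ[ZMod 2] TupleChain P n
  | 0 => LinearMap.id
  | n + 1 => Finsupp.linearCombination (ZMod 2) fun v =>
      cone (bary v) n (sd P n (bd P n (Finsupp.single v 1)))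

/-- The chain homotopy between the identity and barycentric subdivision. -/
noncomputable def sdHomotopy (P : Type*) [HasBarycenter P] :
    (n : ℕ) → TupleChain P n →ₗ[ZMod 2] TupleChain P (n + 1)
  | 0 => 0
  | n + 1 => Finsupp.linearCombination (ZMod 2) fun v =>
      cone (bary v) (n + 1) (Finsupp.single v 1 + sdHomotopy P n (bd P n (Finsupp.single v 1)))

theorem sd_zero (z : TupleChain P 0) : sd P 0 z = z := rfl

theorem sdHomotopy_zero (z : TupleChain P 0) : sdHomotopy P 0 z = 0 := rfl

theorem sd_single {n : ℕ} (v : Fin (n + 1) → P) :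
    sd P (n + 1) (Finsupp.single v 1) =
      cone (bary v) n (sd P n (bd P n (Finsupp.single v 1))) := by
  rw [sd, Finsupp.linearCombination_single, one_smul]

theorem sdHomotopy_single {n : ℕ} (v : Fin (n + 1) → P) :
    sdHomotopy P (n + 1) (Finsupp.single v 1) =
      cone (bary v) (n + 1)
        (Finsupp.single v 1 + sdHomotopy P n (bd P n (Finsupp.single v 1))) := by
  rw [sdHomotopy, Finsupp.linearCombination_single, one_smul]

theorem bd_sd : ∀ (n : ℕ) (z : TupleChain P (n + 1)),
    bd P n (sd P (n + 1) z) = sd P n (bd P n z) := by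
  intro n
  induction n with
  | zero =>
    intro z
    refine DFunLike.congr_fun (f := (bd P 0) ∘ₗ (sd P 1)) (g := (sd P 0) ∘ₗ (bd P 0)) ?_ z
    refine Finsupp.lhom_ext' fun v => LinearMap.ext_ring ?_
    simp only [LinearMap.comp_apply, Finsupp.lsingle_apply]
    rw [sd_single, bd_cone_zero]
  | succ n ih =>
    intro z
    refine DFunLike.congr_fun (f := (bd P (n + 1)) ∘ₗ (sd P (n + 2)))
      (g := (sd P (n + 1)) ∘ₗ (bd P (n + 1))) ?_ z
    refine Finsupp.lhom_ext' fun v => LinearMap.ext_ring ?_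
    simp only [LinearMap.comp_apply, Finsupp.lsingle_apply]
    rw [sd_single, bd_cone, ih, bd_bd, map_zero, map_zero, add_zero]

/-- The homotopy cones v + H(∂v) from the barycenter. The boundary of that chain is sd(∂v) by
induction, and coning this off gives exactly sd v. -/
theorem bd_sdHomotopy : ∀ (n : ℕ) (z : TupleChain P (n + 1)),
    bd P (n + 1) (sdHomotopy P (n + 1) z) =
      z + sd P (n + 1) z + sdHomotopy P n (bd P n z) := by
  intro n
  induction n with
  | zero =>
    intro z
    refine DFunLike.congr_fun (f := (bd P 1) ∘ₗ (sdHomotopy P 1))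
      (g := LinearMap.id + (sd P 1) + (sdHomotopy P 0) ∘ₗ (bd P 0)) ?_ z
    refine Finsupp.lhom_ext' fun v => LinearMap.ext_ring ?_
    simp only [LinearMap.comp_apply, Finsupp.lsingle_apply, LinearMap.add_apply,
      LinearMap.id_apply, sdHomotopy_zero]
    rw [sdHomotopy_single, sd_single, bd_cone, sdHomotopy_zero, add_zero, add_zero, sd_zero]
  | succ n ih =>
    intro z
    refine DFunLike.congr_fun (f := (bd P (n + 2)) ∘ₗ (sdHomotopy P (n + 2)))
      (g := LinearMap.id + (sd P (n + 2)) + (sdHomotopy P (n + 1)) ∘ₗ (bd P (n + 1))) ?_ z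
    refine Finsupp.lhom_ext' fun v => LinearMap.ext_ring ?_
    simp only [LinearMap.comp_apply, Finsupp.lsingle_apply, LinearMap.add_apply,
      LinearMap.id_apply]
    rw [sdHomotopy_single, bd_cone, sd_single, map_add, ih, bd_bd, map_zero, add_zero,
      chain_add_add_cancel]
    abel

/-- Subdivision uses nothing but barycenters, so it is natural for maps preserving them. This
carries subdivision of the standard simplex over to arbitrary affine simplices. -/
theorem map_sd {φ : P → P'} (hφ : ∀ (n : ℕ) (v : Fin (n + 1) → P), φ (bary v) = bary (φ ∘ v)) :
    ∀ (n : ℕ) (z : TupleChain P n), map φ n (sd P n z) = sd P' n (map φ n z) := by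
  intro n
  induction n with
  | zero => intro z; rfl
  | succ n ih =>
    intro z
    refine DFunLike.congr_fun (f := (map φ (n + 1)) ∘ₗ (sd P (n + 1)))
      (g := (sd P' (n + 1)) ∘ₗ (map φ (n + 1))) ?_ z
    refine Finsupp.lhom_ext' fun v => LinearMap.ext_ring ?_
    simp only [LinearMap.comp_apply, Finsupp.lsingle_apply]
    rw [sd_single, map_cone, ih, map_bd, map_single, sd_single, hφ]

theorem map_sdHomotopy {φ : P → P'}
    (hφ : ∀ (n : ℕ) (v : Fin (n + 1) → P), φ (bary v) = bary (φ ∘ v)) :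
    ∀ (n : ℕ) (z : TupleChain P n),
      map φ (n + 1) (sdHomotopy P n z) = sdHomotopy P' n (map φ n z) := by
  intro n
  induction n with
  | zero => intro z; rw [sdHomotopy_zero, sdHomotopy_zero, map_zero]
  | succ n ih =>
    intro z
    refine DFunLike.congr_fun (f := (map φ (n + 2)) ∘ₗ (sdHomotopy P (n + 1)))
      (g := (sdHomotopy P' (n + 1)) ∘ₗ (map φ (n + 1))) ?_ z
    refine Finsupp.lhom_ext' fun v => LinearMap.ext_ring ?_
    simp only [LinearMap.comp_apply, Finsupp.lsingle_apply]
    rw [sdHomotopy_single, map_cone, map_add, ih, map_bd, map_single, sdHomotopy_single, hφ]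

/-- A set of points that contains the barycenters of its tuples. -/
def BaryClosed (Q : Set P) : Prop := ∀ (n : ℕ) (v : Fin (n + 1) → P), (∀ i, v i ∈ Q) → bary v ∈ Q

theorem sd_mem_tuplesIn {Q : Set P} (hQ : BaryClosed Q) : ∀ (n : ℕ) (z : TupleChain P n),
    z ∈ chainsOn (tuplesIn Q n) → sd P n z ∈ chainsOn (tuplesIn Q n) := by
  intro n
  induction n with
  | zero => exact fun z hz => hz
  | succ n ih =>
    intro z hz
    refine map_mem_of_chainsOn _ (fun v hv => ?_) hz
    rw [sd_single]
    refine cone_mem (fun w hw => cons_mem_tuplesIn (hQ n v hv) hw)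
      (ih _ (bd_mem (A := {v}) (by rintro _ rfl i j; exact hv _) (single_mem_chainsOn rfl)))

theorem sdHomotopy_mem_tuplesIn {Q : Set P} (hQ : BaryClosed Q) : ∀ (n : ℕ) (z : TupleChain P n),
    z ∈ chainsOn (tuplesIn Q n) → sdHomotopy P n z ∈ chainsOn (tuplesIn Q (n + 1)) := by
  intro n
  induction n with
  | zero => intro z _; rw [sdHomotopy_zero]; exact Submodule.zero_mem _
  | succ n ih =>
    intro z hz
    refine map_mem_of_chainsOn _ (fun v hv => ?_) hz
    rw [sdHomotopy_single]
    refine cone_mem (fun w hw => cons_mem_tuplesIn (hQ n v hv) hw)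
      (Submodule.add_mem _ (single_mem_chainsOn hv)
      (ih _ (bd_mem (A := {v}) (by rintro _ rfl i j; exact hv _) (single_mem_chainsOn rfl))))

theorem sd_mem_tuplesSmall {F : Set (Set P)} (hF : ∀ Q ∈ F, BaryClosed Q) {n : ℕ}
    {z : TupleChain P n} (hz : z ∈ chainsOn (tuplesSmall F n)) :
    sd P n z ∈ chainsOn (tuplesSmall F n) := by
  refine map_mem_of_chainsOn _ ?_ hz
  rintro v ⟨Q, hQ, hv⟩
  refine Finsupp.supported_mono (tuplesIn_subset_tuplesSmall hQ _)
    (sd_mem_tuplesIn (hF Q hQ) n _ (single_mem_chainsOn hv))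

theorem sdHomotopy_mem_tuplesSmall {F : Set (Set P)} (hF : ∀ Q ∈ F, BaryClosed Q) {n : ℕ}
    {z : TupleChain P n} (hz : z ∈ chainsOn (tuplesSmall F n)) :
    sdHomotopy P n z ∈ chainsOn (tuplesSmall F (n + 1)) := by
  refine map_mem_of_chainsOn _ ?_ hz
  rintro v ⟨Q, hQ, hv⟩
  refine Finsupp.supported_mono (tuplesIn_subset_tuplesSmall hQ _)
    (sdHomotopy_mem_tuplesIn (hF Q hQ) n _ (single_mem_chainsOn hv))

/-- Iterated barycentric subdivision. -/
noncomputable def sdIter (P : Type*) [HasBarycenter P] (n : ℕ) :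
    ℕ → TupleChain P n →ₗ[ZMod 2] TupleChain P n
  | 0 => LinearMap.id
  | m + 1 => sd P n ∘ₗ sdIter P n m

theorem sdIter_zero {n : ℕ} (z : TupleChain P n) : sdIter P n 0 z = z := rfl

theorem sdIter_succ {n : ℕ} (m : ℕ) (z : TupleChain P n) :
    sdIter P n (m + 1) z = sd P n (sdIter P n m z) := rfl

theorem sdIter_mem {A : (n : ℕ) → Set (Fin n → P)} {n : ℕ}
    (h : ∀ z : TupleChain P n, z ∈ chainsOn (A n) → sd P n z ∈ chainsOn (A n)) (m : ℕ)
    {z : TupleChain P n} (hz : z ∈ chainsOn (A n)) : sdIter P n m z ∈ chainsOn (A n) := by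
  induction m with
  | zero => exact hz
  | succ m ih => exact h _ ih

theorem bd_sdIter {n : ℕ} (m : ℕ) (z : TupleChain P (n + 1)) :
    bd P n (sdIter P (n + 1) m z) = sdIter P n m (bd P n z) := by
  induction m with
  | zero => rfl
  | succ m ih => rw [sdIter_succ, bd_sd, ih, sdIter_succ]

theorem map_sdIter {φ : P → P'} (hφ : ∀ (n : ℕ) (v : Fin (n + 1) → P), φ (bary v) = bary (φ ∘ v))
    (n m : ℕ) (z : TupleChain P n) : map φ n (sdIter P n m z) = sdIter P' n m (map φ n z) := by
  induction m with
  | zero => rfl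
  | succ m ih => rw [sdIter_succ, map_sd hφ, ih, sdIter_succ]

/-- The chain homotopy between the identity and iterated barycentric subdivision. -/
noncomputable def sdIterHomotopy (P : Type*) [HasBarycenter P] (n m : ℕ) (z : TupleChain P n) :
    TupleChain P (n + 1) := ∑ j ∈ Finset.range m, sdHomotopy P n (sdIter P n j z)

/-- The one-step homotopies telescope. -/
theorem bd_sdIterHomotopy {n : ℕ} (m : ℕ) (z : TupleChain P (n + 1)) :
    bd P (n + 1) (sdIterHomotopy P (n + 1) m z) =
      z + sdIter P (n + 1) m z + sdIterHomotopy P n m (bd P n z) := by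
  induction m with
  | zero => simp [sdIterHomotopy, sdIter_zero, chain_add_self]
  | succ m ih =>
    rw [sdIterHomotopy, Finset.sum_range_succ, ← sdIterHomotopy, map_add, ih, bd_sdHomotopy,
      sdIterHomotopy, sdIterHomotopy, Finset.sum_range_succ, bd_sdIter, sdIter_succ]
    generalize sdIter P (n + 1) m z = x
    generalize (∑ x ∈ Finset.range m, _ : TupleChain P (n + 1)) = y
    calc _ = z + sd P (n + 1) x + (y + sdHomotopy P n (sdIter P n m (bd P n z))) + (x + x) := by
          abel
      _ = _ := by rw [chain_add_self, add_zero]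

/-- A small cycle in a bary-closed set bounds a small chain if subdivision makes every tuple
small. -/
theorem exists_small_filling {F : Set (Set P)} (hF : ∀ Q ∈ F, BaryClosed Q) {C : Set P} {p : P}
    (hp : p ∈ C) (hFC : ∀ Q ∈ F, Q ⊆ C) {n : ℕ}
    (hsub : ∀ v ∈ tuplesIn C (n + 2), ∃ m₀, ∀ m ≥ m₀,
      sdIter P (n + 2) m (Finsupp.single v 1) ∈ chainsOn (tuplesSmall F (n + 2)))
    {z : TupleChain P (n + 1)} (hz : z ∈ chainsOn (tuplesSmall F (n + 1))) (hz0 : bd P n z = 0) :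
    ∃ y ∈ chainsOn (tuplesSmall F (n + 2)), bd P (n + 1) y = z := by
  have hy0 : cone p (n + 1) z ∈ chainsOn (tuplesIn C (n + 2)) := by
    refine cone_mem ?_ hz
    rintro v ⟨Q, hQ, hv⟩
    exact cons_mem_tuplesIn hp fun i => hFC Q hQ (hv i)
  obtain ⟨m, hm⟩ : ∃ m₀, ∀ m ≥ m₀,
      sdIter P (n + 2) m (cone p (n + 1) z) ∈ chainsOn (tuplesSmall F (n + 2)) := by
    generalize cone p (n + 1) z = y at hy0
    rw [chainsOn, Finsupp.supported_eq_span_single] at hy0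
    induction hy0 using Submodule.span_induction with
    | mem x hx =>
      obtain ⟨v, hv, rfl⟩ := hx
      exact hsub v hv
    | zero => exact ⟨0, fun m _ => by rw [map_zero]; exact Submodule.zero_mem _⟩
    | add x y _ _ hx hy =>
      obtain ⟨a, ha⟩ := hx
      obtain ⟨b, hb⟩ := hy
      refine ⟨max a b, fun m hm => ?_⟩
      rw [map_add]
      exact Submodule.add_mem _ (ha m (le_trans (le_max_left _ _) hm))
        (hb m (le_trans (le_max_right _ _) hm))
    | smul c x _ hx =>
      obtain ⟨a, ha⟩ := hx
      refine ⟨a, fun m hm => ?_⟩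
      rcases (by revert c; decide : ∀ c : ZMod 2, c = 0 ∨ c = 1) c with rfl | rfl
      · rw [zero_smul, map_zero]; exact Submodule.zero_mem _
      · rw [one_smul]; exact ha m hm
  -- The subdivided cone is small but bounds the subdivided cycle. The homotopy term corrects the
  -- boundary back to z, and it is small because z already is.
  refine ⟨sdIter P (n + 2) m (cone p (n + 1) z) + sdIterHomotopy P (n + 1) m z,
    Submodule.add_mem _ (hm m le_rfl) (Submodule.sum_mem _ fun j _ =>
      sdHomotopy_mem_tuplesSmall hF (sdIter_mem (A := tuplesSmall F)
        (fun z hz => sd_mem_tuplesSmall hF hz) j hz)), ?_⟩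
  rw [map_add, bd_sdIter, bd_cone, hz0, map_zero, add_zero, bd_sdIterHomotopy, hz0]
  have : sdIterHomotopy P n m 0 = 0 := by
    simp [sdIterHomotopy]
  rw [this, add_zero, add_comm z, chain_add_add_cancel]

end TupleChain

/-! ### Subdivision of the standard simplex -/

/-- The affine map `Δ^m → Δ^n` that sends the `i`-th vertex to `v i`. -/
noncomputable def stdSimplex.comb {m n : ℕ} (v : Fin (m + 1) → stdSimplex ℝ (Fin (n + 1))) :
    C(stdSimplex ℝ (Fin (m + 1)), stdSimplex ℝ (Fin (n + 1))) where
  toFun t := ⟨∑ i, t i • (v i).1,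
    (convex_stdSimplex ℝ (Fin (n + 1))).sum_mem (fun i _ => t.2.1 i) t.2.2 fun i _ => (v i).2⟩
  continuous_toFun := by
    refine Continuous.subtype_mk (continuous_finsetSum _ fun i _ => ?_) _
    exact ((continuous_apply i).comp continuous_subtype_val).smul continuous_const

theorem stdSimplex.comb_coe {m n : ℕ} (v : Fin (m + 1) → stdSimplex ℝ (Fin (n + 1)))
    (t : stdSimplex ℝ (Fin (m + 1))) :
    (stdSimplex.comb v t).1 = ∑ i, t i • (v i).1 := rfl

theorem stdSimplex.comb_comb {k m n : ℕ} (v : Fin (m + 1) → stdSimplex ℝ (Fin (n + 1)))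
    (w : Fin (k + 1) → stdSimplex ℝ (Fin (m + 1))) (t : stdSimplex ℝ (Fin (k + 1))) :
    stdSimplex.comb v (stdSimplex.comb w t) = stdSimplex.comb (fun i => stdSimplex.comb v (w i)) t := by
  apply Subtype.ext
  rw [stdSimplex.comb_coe, stdSimplex.comb_coe]
  have : ∀ i, (stdSimplex.comb w t) i = ∑ j, t j * w j i := fun i => by
    change (stdSimplex.comb w t).1 i = _
    rw [stdSimplex.comb_coe, Finset.sum_apply]; rfl
  simp only [this, stdSimplex.comb_coe, Finset.sum_smul, Finset.smul_sum, smul_smul]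
  exact Finset.sum_comm

theorem stdSimplex.map_eq_comb {m n : ℕ} (θ : Fin (m + 1) → Fin (n + 1))
    (t : stdSimplex ℝ (Fin (m + 1))) :
    stdSimplex.map θ t = stdSimplex.comb (fun i => stdSimplex.vertex (θ i)) t := by
  apply Subtype.ext
  rw [stdSimplex.comb_coe]
  funext j
  change stdSimplex.map θ t j = _
  rw [stdSimplex.map_coe, FunOnFinite.linearMap_apply_apply, Finset.sum_apply, Finset.sum_filter]
  refine Finset.sum_congr rfl fun i _ => ?_
  simp [Pi.single_apply, eq_comm]

theorem stdSimplex.comb_vertex {m n : ℕ} (v : Fin (m + 1) → stdSimplex ℝ (Fin (n + 1)))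
    (i : Fin (m + 1)) : stdSimplex.comb v (stdSimplex.vertex i) = v i := by
  apply Subtype.ext
  rw [stdSimplex.comb_coe]
  simp [Pi.single_apply]

theorem stdSimplex.comb_vertices {n : ℕ} (t : stdSimplex ℝ (Fin (n + 1))) :
    stdSimplex.comb (fun i => stdSimplex.vertex i) t = t := by
  exact (stdSimplex.map_eq_comb id t).symm.trans (stdSimplex.map_id_apply t)

noncomputable instance stdSimplex.hasBarycenter (n : ℕ) :
    HasBarycenter (stdSimplex ℝ (Fin (n + 1))) where
  bary v := stdSimplex.comb v stdSimplex.barycenter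

theorem stdSimplex.bary_coe {m n : ℕ} (v : Fin (m + 1) → stdSimplex ℝ (Fin (n + 1))) :
    (bary v : stdSimplex ℝ (Fin (n + 1))).1 = (m + 1 : ℝ)⁻¹ • ∑ i, (v i).1 := by
  change (stdSimplex.comb v stdSimplex.barycenter).1 = _
  rw [stdSimplex.comb_coe, Finset.smul_sum]
  refine Finset.sum_congr rfl fun i _ => ?_
  congr 1
  refine (stdSimplex.barycenter_apply (𝕜 := ℝ) i).trans ?_
  simp

theorem stdSimplex.comb_bary {m n k : ℕ} (v : Fin (m + 1) → stdSimplex ℝ (Fin (n + 1)))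
    (w : Fin (k + 1) → stdSimplex ℝ (Fin (m + 1))) :
    stdSimplex.comb v (bary w) = bary (stdSimplex.comb v ∘ w) :=
  stdSimplex.comb_comb v w _

/-- A set that contains the affine simplices spanned by its points. -/
def stdSimplex.CombClosed {n : ℕ} (Q : Set (stdSimplex ℝ (Fin (n + 1)))) : Prop :=
  ∀ (m : ℕ) (v : Fin (m + 1) → stdSimplex ℝ (Fin (n + 1))) (t : stdSimplex ℝ (Fin (m + 1))),
    (∀ i, v i ∈ Q) → stdSimplex.comb v t ∈ Q

theorem stdSimplex.CombClosed.baryClosed {n : ℕ} {Q : Set (stdSimplex ℝ (Fin (n + 1)))}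
    (h : stdSimplex.CombClosed Q) : TupleChain.BaryClosed Q :=
  fun m v hv => h m v _ hv

theorem stdSimplex.combClosed_preimage {n : ℕ} {C : Set (Fin (n + 1) → ℝ)} (hC : Convex ℝ C) :
    stdSimplex.CombClosed (Subtype.val ⁻¹' C : Set (stdSimplex ℝ (Fin (n + 1)))) := by
  intro m v t hv
  exact hC.sum_mem (fun i _ => t.2.1 i) t.2.2 fun i _ => hv i

theorem stdSimplex.combClosed_ball {n : ℕ} (x : stdSimplex ℝ (Fin (n + 1))) (r : ℝ) :
    stdSimplex.CombClosed (Metric.ball x r) :=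
  stdSimplex.combClosed_preimage (convex_ball x.1 r)

theorem stdSimplex.combClosed_closedBall {n : ℕ} (x : stdSimplex ℝ (Fin (n + 1))) (r : ℝ) :
    stdSimplex.CombClosed (Metric.closedBall x r) :=
  stdSimplex.combClosed_preimage (convex_closedBall x.1 r)

/-- Of the m + 1 differences averaged here, the one at j is zero and the other m have norm at most
D. -/
theorem stdSimplex.dist_bary_le {m n : ℕ} (v : Fin (m + 1) → stdSimplex ℝ (Fin (n + 1))) {D : ℝ}
    (h : ∀ i j, dist (v i) (v j) ≤ D) (j : Fin (m + 1)) :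
    dist (v j) (bary v) ≤ m / (m + 1) * D := by
  rw [dist_comm, Subtype.dist_eq, dist_eq_norm, stdSimplex.bary_coe]
  have hm : (m + 1 : ℝ) ≠ 0 := by positivity
  have e : (m + 1 : ℝ)⁻¹ • ∑ i, (v i).1 - (v j).1 =
      (m + 1 : ℝ)⁻¹ • ∑ i, ((v i).1 - (v j).1) := by
    rw [Finset.sum_sub_distrib, smul_sub]
    congr 1
    simp only [Finset.sum_const, Finset.card_univ, Fintype.card_fin]
    rw [← Nat.cast_smul_eq_nsmul ℝ, smul_smul]
    push_cast
    rw [inv_mul_cancel₀ hm, one_smul]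
  rw [e, norm_smul, norm_inv, Real.norm_of_nonneg (by positivity), div_eq_inv_mul, mul_assoc]
  refine mul_le_mul_of_nonneg_left ?_ (by positivity)
  rw [Fin.sum_univ_succAbove _ j, sub_self, zero_add]
  refine (norm_sum_le _ _).trans ?_
  refine (Finset.sum_le_card_nsmul _ _ D fun i _ => ?_).trans (by simp)
  rw [← dist_eq_norm, ← Subtype.dist_eq]
  exact h _ _

/-! ### Mesh of iterated subdivisions. -/

namespace TupleChain

/-- Tuples of diameter at most `D`. -/
def tuplesMesh (P : Type*) [PseudoMetricSpace P] (D : ℝ) (n : ℕ) : Set (Fin n → P) :=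
  {v | ∀ i j, dist (v i) (v j) ≤ D}

theorem sd_mem_tuplesMesh {n : ℕ} {D : ℝ} (hD : 0 ≤ D) : ∀ (m : ℕ)
    (z : TupleChain (stdSimplex ℝ (Fin (n + 1))) (m + 1)),
    z ∈ chainsOn (tuplesMesh _ D (m + 1)) →
      sd _ (m + 1) z ∈ chainsOn (tuplesMesh _ (m / (m + 1) * D) (m + 1)) := by
  intro m
  induction m with
  | zero =>
    intro z hz
    refine map_mem_of_chainsOn _ (fun v hv => ?_) hz
    refine Finsupp.supported_mono (s := Set.univ) ?_ (by simp)
    intro w _ i j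
    rw [Subsingleton.elim (α := Fin 1) i j, dist_self]; simp
  | succ m ih =>
    intro z hz
    refine map_mem_of_chainsOn _ (fun v hv => ?_) hz
    rw [sd_single]
    -- The contraction factor increases with the dimension, so the inductive bound for the
    -- subdivided faces is more than enough.
    have hle : (m / (m + 1) * D : ℝ) ≤ (m + 1 : ℕ) / ((m + 1 : ℕ) + 1) * D := by
      refine mul_le_mul_of_nonneg_right ?_ hD
      push_cast
      rw [div_le_div_iff₀ (by positivity) (by positivity)]
      nlinarith
    have h1 := ih _ (bd_mem (A := {v}) (B := tuplesMesh _ D (m + 1))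
      (by rintro _ rfl i j k; exact hv _ _) (single_mem_chainsOn rfl))
    -- Balls are convex, so the new points stay in the ball about the barycenter that contains the
    -- old vertices. This bounds the edges from the apex.
    have h2 := sd_mem_tuplesIn (stdSimplex.combClosed_closedBall (bary v)
      ((m + 1 : ℕ) / ((m + 1 : ℕ) + 1) * D)).baryClosed (m + 1) _ (bd_mem (A := {v})
      (by rintro w hw i j; rw [Set.mem_singleton_iff.1 hw]; exact stdSimplex.dist_bary_le v hv _) (single_mem_chainsOn rfl))
    have h3 := Submodule.mem_inf.2 ⟨h1, h2⟩
    rw [← Finsupp.supported_inter] at h3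
    refine cone_mem ?_ h3
    rintro w ⟨hw1, hw2⟩ i j
    refine Fin.cases ?_ (fun i => ?_) i <;> refine Fin.cases ?_ (fun j => ?_) j
    · simp only [Fin.cons_zero, dist_self]; positivity
    · simp only [Fin.cons_zero, Fin.cons_succ]; rw [dist_comm]; exact hw2 j
    · simp only [Fin.cons_zero, Fin.cons_succ]; exact hw2 i
    · simp only [Fin.cons_succ]; exact (hw1 i j).trans hle

theorem sdIter_mem_tuplesMesh {n : ℕ} {D : ℝ} (hD : 0 ≤ D) (m k : ℕ)
    (z : TupleChain (stdSimplex ℝ (Fin (n + 1))) (m + 1))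
    (hz : z ∈ chainsOn (tuplesMesh _ D (m + 1))) :
    sdIter _ (m + 1) k z ∈ chainsOn (tuplesMesh _ ((m / (m + 1)) ^ k * D) (m + 1)) := by
  induction k with
  | zero => simpa [sdIter_zero] using hz
  | succ k ih =>
    rw [sdIter_succ, pow_succ', mul_assoc]
    exact sd_mem_tuplesMesh (by positivity) m _ ih

/-- The tuple of vertices of the standard simplex, as a chain. -/
noncomputable def vertices (n : ℕ) : TupleChain (stdSimplex ℝ (Fin (n + 1))) (n + 1) :=
  Finsupp.single (fun i => stdSimplex.vertex i) 1

/-- The sets closed under affine combinations that are contained in a member of a family. -/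
def combSmall {ι : Type*} {n : ℕ} (U : ι → Set (stdSimplex ℝ (Fin (n + 1)))) :
    Set (Set (stdSimplex ℝ (Fin (n + 1)))) :=
  {Q | stdSimplex.CombClosed Q ∧ ∃ i, Q ⊆ U i}

theorem combSmall_baryClosed {ι : Type*} {n : ℕ} (U : ι → Set (stdSimplex ℝ (Fin (n + 1)))) :
    ∀ Q ∈ combSmall U, BaryClosed Q := fun _ hQ => hQ.1.baryClosed

/-- Iterated subdivisions of the standard simplex are subordinate to any open cover. -/
theorem exists_sdIter_vertices_small {ι : Type*} {n : ℕ}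
    (U : ι → Set (stdSimplex ℝ (Fin (n + 1)))) (hU : ∀ i, IsOpen (U i))
    (hcov : ∀ x, ∃ i, x ∈ U i) :
    ∃ m₀, ∀ m ≥ m₀, sdIter _ (n + 1) m (vertices n) ∈ chainsOn (tuplesSmall (combSmall U) (n + 1)) := by
  obtain ⟨δ, hδ, hball⟩ := lebesgue_number_lemma_of_metric (isCompact_univ) hU
    (fun x _ => Set.mem_iUnion.2 (hcov x))
  obtain ⟨D, hD0, hD⟩ : ∃ D : ℝ, 0 ≤ D ∧ ∀ x y : stdSimplex ℝ (Fin (n + 1)), dist x y ≤ D := by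
    refine ⟨Metric.diam (Set.univ : Set (stdSimplex ℝ (Fin (n + 1)))), Metric.diam_nonneg,
      fun x y => Metric.dist_le_diam_of_mem isCompact_univ.isBounded trivial trivial⟩
  have hlim : Filter.Tendsto (fun k : ℕ => ((n : ℝ) / (n + 1)) ^ k * D) Filter.atTop (𝓝 0) := by
    have := (tendsto_pow_atTop_nhds_zero_of_lt_one (r := (n : ℝ) / (n + 1)) (by positivity)
      (by rw [div_lt_one (by positivity)]; linarith)).mul_const D
    simpa using this
  obtain ⟨m₀, hm₀⟩ := Filter.eventually_atTop.1 (hlim.eventually (gt_mem_nhds hδ))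
  refine ⟨m₀, fun m hm => ?_⟩
  have h := sdIter_mem_tuplesMesh hD0 n m (vertices n) (single_mem_chainsOn fun i j => hD _ _)
  refine Finsupp.supported_mono ?_ h
  intro v hv
  obtain ⟨i, hi⟩ := hball (v 0) trivial
  exact ⟨Metric.ball (v 0) δ, ⟨stdSimplex.combClosed_ball _ _, i, hi⟩,
    fun j => (hv j 0).trans_lt (hm₀ m hm)⟩

end TupleChain

/-! ### Small singular simplices -/

namespace SingularSimplex

open TupleChain

variable {X : Type*} [TopologicalSpace X]

/-- The value of a cochain on the affine chains of a singular simplex. -/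
noncomputable def eval {n m : ℕ} (s : SingularSimplex X n) (c : SingularCochain X m) :
    TupleChain (stdSimplex ℝ (Fin (n + 1))) (m + 1) →ₗ[ZMod 2] ZMod 2 :=
  Finsupp.linearCombination (ZMod 2) fun v => c (s.comp (stdSimplex.comb v))

theorem eval_single {n m : ℕ} (s : SingularSimplex X n) (c : SingularCochain X m)
    (v : Fin (m + 1) → stdSimplex ℝ (Fin (n + 1))) :
    s.eval c (Finsupp.single v 1) = c (s.comp (stdSimplex.comb v)) := by
  rw [eval, Finsupp.linearCombination_single, one_smul]

theorem comp_comb_restrict {n m k : ℕ} (s : SingularSimplex X n)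
    (v : Fin (m + 1) → stdSimplex ℝ (Fin (n + 1))) (θ : Fin (k + 1) → Fin (m + 1)) :
    SingularSimplex.restrict (s.comp (stdSimplex.comb v)) θ = s.comp (stdSimplex.comb (v ∘ θ)) := by
  ext t
  change s (stdSimplex.comb v (stdSimplex.map θ t)) = s (stdSimplex.comb (v ∘ θ) t)
  rw [stdSimplex.map_eq_comb, stdSimplex.comb_comb]
  simp only [stdSimplex.comb_vertex]
  rfl

theorem restrict_comp_comb {n m k : ℕ} (s : SingularSimplex X n) (θ : Fin (m + 1) → Fin (n + 1))
    (v : Fin (k + 1) → stdSimplex ℝ (Fin (m + 1))) :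
    (s.restrict θ).comp (stdSimplex.comb v) = s.comp (stdSimplex.comb (stdSimplex.map θ ∘ v)) := by
  ext t
  change s (stdSimplex.map θ (stdSimplex.comb v t)) = s (stdSimplex.comb (stdSimplex.map θ ∘ v) t)
  rw [stdSimplex.map_eq_comb, stdSimplex.comb_comb]
  simp only [← stdSimplex.map_eq_comb]
  rfl

theorem eval_coboundary {n m : ℕ} (s : SingularSimplex X n) (c : SingularCochain X m)
    (z : TupleChain (stdSimplex ℝ (Fin (n + 1))) (m + 2)) :
    s.eval (coboundary X m c) z = s.eval c (bd _ (m + 1) z) := by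
  refine DFunLike.congr_fun (f := s.eval (coboundary X m c))
    (g := (s.eval c) ∘ₗ (bd _ (m + 1))) ?_ z
  refine Finsupp.lhom_ext' fun v => LinearMap.ext_ring ?_
  simp only [LinearMap.comp_apply, Finsupp.lsingle_apply, bd_single, map_sum, eval_single]
  change ∑ i : Fin (m + 2), c (SingularSimplex.restrict _ i.succAbove) = _
  exact Finset.sum_congr rfl fun i _ => by rw [comp_comb_restrict]

theorem eval_restrict {n m k : ℕ} (s : SingularSimplex X n) (θ : Fin (m + 1) → Fin (n + 1))
    (c : SingularCochain X k) (z : TupleChain (stdSimplex ℝ (Fin (m + 1))) (k + 1)) :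
    (s.restrict θ).eval c z = s.eval c (map (stdSimplex.map θ) (k + 1) z) := by
  refine DFunLike.congr_fun (f := (s.restrict θ).eval c)
    (g := (s.eval c) ∘ₗ (map (stdSimplex.map θ) (k + 1))) ?_ z
  refine Finsupp.lhom_ext' fun v => LinearMap.ext_ring ?_
  simp only [LinearMap.comp_apply, Finsupp.lsingle_apply, map_single, eval_single]
  rw [restrict_comp_comb]

theorem eval_vertices {n : ℕ} (s : SingularSimplex X n) (c : SingularCochain X n) :
    s.eval c (vertices n) = c s := by
  rw [vertices, eval_single]
  congr 1
  ext t
  exact congrArg s (stdSimplex.comb_vertices t)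

/-- A singular simplex contained in a member of a family of sets. -/
def IsSmall {ι : Type*} (U : ι → Set X) {n : ℕ} (s : SingularSimplex X n) : Prop :=
  ∃ i, ∀ t, s t ∈ U i

theorem IsSmall.restrict {ι : Type*} {U : ι → Set X} {n m : ℕ} {s : SingularSimplex X n}
    (h : s.IsSmall U) (θ : Fin (m + 1) → Fin (n + 1)) : (s.restrict θ).IsSmall U :=
  ⟨h.choose, fun _ => h.choose_spec _⟩

/-- A tuple with entries in a set closed under affine combinations spans an affine simplex inside
that set, so its image under s is small. -/
theorem eval_eq_zero {ι : Type*} {U : ι → Set X} {n m : ℕ} (s : SingularSimplex X n)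
    (c : SingularCochain X m) (hc : ∀ s : SingularSimplex X m, s.IsSmall U → c s = 0)
    {z : TupleChain (stdSimplex ℝ (Fin (n + 1))) (m + 1)}
    (hz : z ∈ chainsOn (tuplesSmall (combSmall fun i => s ⁻¹' U i) (m + 1))) : s.eval c z = 0 := by
  refine map_mem_of_chainsOn (N := ⊥) (s.eval c) ?_ hz
  rintro v ⟨Q, ⟨hQ, i, hi⟩, hv⟩
  rw [eval_single, Submodule.mem_bot]
  exact hc _ ⟨i, fun t => hi (hQ _ v t hv)⟩

end SingularSimplex

namespace TupleChain

theorem bd_vertices (n : ℕ) : bd _ (n + 1) (vertices (n + 1)) =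
    ∑ i : Fin (n + 2), map (stdSimplex.map i.succAbove) (n + 1) (vertices n) := by
  rw [vertices, bd_single]
  refine Finset.sum_congr rfl fun i _ => ?_
  rw [vertices, map_single]
  congr 1
  funext j
  exact (stdSimplex.map_vertex _ _).symm

theorem map_bary_stdSimplex {m n : ℕ} (θ : Fin (m + 1) → Fin (n + 1)) (k : ℕ)
    (v : Fin (k + 1) → stdSimplex ℝ (Fin (m + 1))) :
    stdSimplex.map (S := ℝ) θ (bary v) = bary (stdSimplex.map θ ∘ v) := by
  have h : (stdSimplex.map (S := ℝ) θ : _ → stdSimplex ℝ (Fin (n + 1))) =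
      stdSimplex.comb fun i => stdSimplex.vertex (θ i) := by
    funext t
    exact stdSimplex.map_eq_comb θ t
  rw [h]
  exact stdSimplex.comb_bary _ _

theorem map_sdIterHomotopy {P P' : Type*} [HasBarycenter P] [HasBarycenter P'] {φ : P → P'}
    (hφ : ∀ (n : ℕ) (v : Fin (n + 1) → P), φ (bary v) = bary (φ ∘ v)) (n m : ℕ)
    (z : TupleChain P n) :
    map φ (n + 1) (sdIterHomotopy P n m z) = sdIterHomotopy P' n m (map φ n z) := by
  simp only [sdIterHomotopy, map_sum, map_sdHomotopy hφ, map_sdIter hφ]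

theorem sdIterHomotopy_sum {P ι : Type*} [HasBarycenter P] (s : Finset ι) (n m : ℕ)
    (z : ι → TupleChain P n) :
    sdIterHomotopy P n m (∑ i ∈ s, z i) = ∑ i ∈ s, sdIterHomotopy P n m (z i) := by
  simp only [sdIterHomotopy, map_sum]
  exact Finset.sum_comm

end TupleChain

open TupleChain in
/-- A singular cocycle that vanishes on the simplices subordinate to an open cover is a
coboundary; the cobounding cochain inherits the symmetry under an involution. -/
theorem exists_coboundary_eq_of_eq_zero_on_small {X ι : Type*} [TopologicalSpace X]
    (U : ι → Set X) (hU : ∀ i, IsOpen (U i)) (hcov : ∀ x, ∃ i, x ∈ U i) (τ : C(X, X))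
    (e : ι ≃ ι) (he : ∀ i, τ ⁻¹' U i = U (e i)) {d : ℕ} (c : SingularCochain X (d + 1))
    (hc : coboundary X (d + 1) c = 0)
    (hsmall : ∀ s : SingularSimplex X (d + 1), s.IsSmall U → c s = 0)
    (hinv : ∀ s : SingularSimplex X (d + 1), c (τ.comp s) = c s) :
    ∃ b : SingularCochain X d, coboundary X d b = c ∧ ∀ s : SingularSimplex X d, b (τ.comp s) = b s := by
  -- The least element of S n s is the number of subdivisions that the simplex s needs. It varies
  -- from simplex to simplex.
  set S : (n : ℕ) → SingularSimplex X n → Set ℕ := fun n s => {m₀ | ∀ m ≥ m₀,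
    sdIter _ (n + 1) m (vertices n) ∈
      chainsOn (tuplesSmall (combSmall fun i => s ⁻¹' U i) (n + 1))} with hS
  have hne : ∀ n (s : SingularSimplex X n), (S n s).Nonempty := fun n s =>
    exists_sdIter_vertices_small _ (fun i => (hU i).preimage s.continuous) fun t => hcov (s t)
  have hmem : ∀ n (s : SingularSimplex X n), sInf (S n s) ∈ S n s := fun n s => Nat.sInf_mem (hne n s)
  -- Beyond the needed number of subdivisions the homotopy only gains small simplices, on which c
  -- vanishes. Hence one M can serve a simplex and all its faces.
  have hstab : ∀ (s : SingularSimplex X d) (M : ℕ), sInf (S d s) ≤ M →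
      s.eval c (sdIterHomotopy _ (d + 1) M (vertices d)) =
        s.eval c (sdIterHomotopy _ (d + 1) (sInf (S d s)) (vertices d)) := by
    intro s M hM
    induction M, hM using Nat.le_induction with
    | base => rfl
    | succ M hM ih =>
      rw [sdIterHomotopy, Finset.sum_range_succ, ← sdIterHomotopy, map_add, ih,
        s.eval_eq_zero c hsmall (sdHomotopy_mem_tuplesSmall (combSmall_baryClosed _)
          (hmem d s M hM)), add_zero]
  refine ⟨fun s => s.eval c (sdIterHomotopy _ (d + 1) (sInf (S d s)) (vertices d)), ?_, ?_⟩
  · funext s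
    obtain ⟨M, hM, hMi⟩ : ∃ M, sInf (S (d + 1) s) ≤ M ∧
        ∀ i : Fin (d + 2), sInf (S d (s.restrict i.succAbove)) ≤ M := by
      refine ⟨max (sInf (S (d + 1) s))
        (Finset.univ.sup fun i : Fin (d + 2) => sInf (S d (s.restrict i.succAbove))),
        le_max_left _ _, fun i => le_max_of_le_right ?_⟩
      exact Finset.le_sup (f := fun i : Fin (d + 2) => sInf (S d (s.restrict i.succAbove)))
        (Finset.mem_univ i)
    change ∑ i : Fin (d + 2), _ = _
    calc _ = ∑ i : Fin (d + 2), s.eval c (sdIterHomotopy _ (d + 1) M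
            (map (stdSimplex.map i.succAbove) (d + 1) (vertices d))) := by
          refine Finset.sum_congr rfl fun i _ => ?_
          beta_reduce
          rw [← hstab _ M (hMi i), SingularSimplex.eval_restrict,
            map_sdIterHomotopy (map_bary_stdSimplex _)]
      _ = s.eval c (sdIterHomotopy _ (d + 1) M (bd _ (d + 1) (vertices (d + 1)))) := by
          rw [bd_vertices, sdIterHomotopy_sum, map_sum]
      -- By the homotopy formula H(∂s) = ∂H(s) + s + sd^M(s). Of these, c kills the boundary as a
      -- cocycle and the subdivision as a small chain, which leaves c(s).
      _ = s.eval c (bd _ (d + 2) (sdIterHomotopy _ (d + 2) M (vertices (d + 1))) +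
            (vertices (d + 1) + sdIter _ (d + 2) M (vertices (d + 1)))) := by
          rw [bd_sdIterHomotopy]
          exact congrArg (s.eval c) (chain_add_add_cancel_comm _ _).symm
      _ = c s := by
          rw [map_add, map_add, ← SingularSimplex.eval_coboundary, hc,
            SingularSimplex.eval_vertices, s.eval_eq_zero c hsmall (hmem _ s M hM), add_zero]
          have : s.eval (0 : SingularCochain X (d + 2)) = 0 := by
            refine Finsupp.lhom_ext' fun v => LinearMap.ext_ring ?_
            simp [SingularSimplex.eval_single]
          rw [this, LinearMap.zero_apply, zero_add]
  -- The involution permutes the cover, so s and its image need the same number of subdivisions and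
  -- c takes the same values on them.
  · intro s
    have h1 : S d (τ.comp s) = S d s := by
      have : combSmall (fun i => (τ.comp s) ⁻¹' U i) = combSmall (fun i => s ⁻¹' U i) := by
        have h2 : ∀ i, (τ.comp s) ⁻¹' U i = s ⁻¹' U (e i) := fun i => by
          rw [← he i]; rfl
        ext Q
        simp only [combSmall, h2, Set.mem_ofPred_eq]
        exact and_congr_right fun _ => e.exists_congr_left.trans (by simp)
      simp only [hS, this]
    have h3 : SingularSimplex.eval (τ.comp s) c = SingularSimplex.eval s c := by
      refine Finsupp.lhom_ext' fun v => LinearMap.ext_ring ?_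
      simp only [LinearMap.comp_apply, Finsupp.lsingle_apply, SingularSimplex.eval_single]
      exact hinv (s.comp (stdSimplex.comb v))
    simp only [h1, h3]

/-! ### Powers of the class of a double cover -/

namespace SingularSimplex

variable {X : Type*} [TopologicalSpace X]

theorem restrict_id {n : ℕ} (s : SingularSimplex X n) : s.restrict id = s := by
  ext t
  exact congrArg s (stdSimplex.map_id_apply t)

theorem restrict_frontFace_self {n : ℕ} (h : n ≤ n) (s : SingularSimplex X n) :
    s.restrict (frontFace h) = s := s.restrict_id

theorem restrict_backFace_self {n : ℕ} (h : 0 + n = n) (s : SingularSimplex X n) :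
    s.restrict (backFace h) = s := by
  have : backFace h = id := by
    funext i
    exact Fin.ext (Nat.zero_add _)
  rw [this, restrict_id]

end SingularSimplex

/-- The cup powers of a cochain of degree one. -/
noncomputable def cochainPow {X : Type*} [TopologicalSpace X] (c : SingularCochain X 1) :
    (n : ℕ) → SingularCochain X n
  | 0 => fun _ => 1
  | n + 1 => cochainCup rfl (cochainPow c n) c

section

variable {X : Type*} [TopologicalSpace X]

theorem coboundary_apply (n : ℕ) (c : SingularCochain X n) (s : SingularSimplex X (n + 1)) :
    coboundary X n c s = ∑ i : Fin (n + 2), c (s.restrict i.succAbove) := rfl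

theorem cochainPow_one (c : SingularCochain X 1) : cochainPow c 1 = c := by
  funext s
  change 1 * c _ = _
  rw [one_mul, SingularSimplex.restrict_backFace_self]

theorem coboundary_cochainPow (g : SingularCochain X 0) : ∀ n,
    coboundary X n (cochainPow (coboundary X 0 g) n) = 0 := by
  intro n
  induction n with
  | zero =>
    funext s
    change ∑ _i : Fin 2, (1 : ZMod 2) = 0
    decide
  | succ n ih =>
    funext s
    rw [cochainPow, coboundary_cochainCup, ih, coboundary_coboundary]
    simp [cochainCup]

/-- Let `g` be a function on `X` that changes under the involution `τ`. If on the small simplices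
there are cochains `h k` that satisfy the transfer relations and end in a cocycle, then the power
of the class of `δ g` vanishes invariantly. -/
theorem exists_invariant_coboundary_eq_cochainPow {ι : Type*}
    (U : ι → Set X) (hU : ∀ i, IsOpen (U i)) (hcov : ∀ x, ∃ i, x ∈ U i) (τ : C(X, X))
    (hτ : ∀ x, τ (τ x) = x) (e : ι ≃ ι) (he : ∀ i, τ ⁻¹' U i = U (e i)) (d : ℕ)
    (g : SingularCochain X 0) (hg : ∀ s : SingularSimplex X 0, g (τ.comp s) = g s + 1)
    (h : (k : ℕ) → SingularCochain X k) (h0 : ∀ s : SingularSimplex X 0, h 0 s + h 0 (τ.comp s) = 1)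
    (hstep : ∀ k < d, ∀ s : SingularSimplex X (k + 1), s.IsSmall U →
      h (k + 1) s + h (k + 1) (τ.comp s) = coboundary X k (h k) s)
    (hlast : ∀ s : SingularSimplex X (d + 1), s.IsSmall U → coboundary X d (h d) s = 0) :
    ∃ b : SingularCochain X d, coboundary X d b = cochainPow (coboundary X 0 g) (d + 1) ∧
      ∀ s : SingularSimplex X d, b (τ.comp s) = b s := by
  classical
  have hττ : ∀ {n} (s : SingularSimplex X n), τ.comp (τ.comp s) = s := fun s => by
    ext t; exact hτ _
  have hsm : ∀ {n} (s : SingularSimplex X n), s.IsSmall U → SingularSimplex.IsSmall U (τ.comp s) := by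
    rintro n s ⟨i, hi⟩
    refine ⟨e.symm i, fun t => ?_⟩
    have := he (e.symm i)
    rw [Equiv.apply_symm_apply] at this
    change τ (s t) ∈ U (e.symm i)
    rw [← Set.mem_preimage, this]
    exact hi t
  set c := coboundary X 0 g with hc
  have hcinv : ∀ s : SingularSimplex X 1, c (τ.comp s) = c s := by
    intro s
    change ∑ i : Fin 2, g (τ.comp (s.restrict i.succAbove)) = ∑ i : Fin 2, g (s.restrict i.succAbove)
    simp only [hg, Finset.sum_add_distrib]
    have : ∑ _i : Fin 2, (1 : ZMod 2) = 0 := by decide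
    rw [this, add_zero]
  have hpinv : ∀ n, ∀ s : SingularSimplex X n, cochainPow c n (τ.comp s) = cochainPow c n s := by
    intro n
    induction n with
    | zero => intro s; rfl
    | succ n ih =>
      intro s
      change cochainPow c n (τ.comp (s.restrict _)) * c (τ.comp (s.restrict _)) =
        cochainPow c n (s.restrict _) * c (s.restrict _)
      rw [ih, hcinv]
  have claim : ∀ k ≤ d, ∃ β : SingularCochain X k, (∀ s : SingularSimplex X k, s.IsSmall U → β (τ.comp s) = β s) ∧
      ∀ s : SingularSimplex X (k + 1), s.IsSmall U → cochainPow c (k + 1) s = coboundary X k (h k) s + coboundary X k β s := by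
    intro k
    induction k with
    | zero =>
      intro _
      -- Both functions change by 1 under τ, so their sum is invariant.
      refine ⟨g + h 0, fun s _ => ?_, fun s _ => ?_⟩
      · have := h0 s
        simp only [Pi.add_apply, hg]
        generalize h 0 s = a at *
        generalize h 0 (τ.comp s) = b at *
        generalize g s = x
        revert a b x
        decide
      · rw [cochainPow_one, map_add, Pi.add_apply, add_comm (coboundary X 0 g s),
          chain_add_add_cancel]
    | succ k ih =>
      intro hk
      obtain ⟨β, hβ, hβ2⟩ := ih (by omega)
      set u := coboundary X k (h k) with hu
      have huinv : ∀ s : SingularSimplex X (k + 1), s.IsSmall U → u (τ.comp s) = u s := by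
        intro s hs
        rw [hu, ← hstep k (by omega) s hs, ← hstep k (by omega) _ (hsm s hs), hττ, add_comm]
      -- Multiply c^(k+1) = u + δβ by c = δg. Since u is a cocycle, u ⌣ δg = δ(u ⌣ g). Under τ both
      -- u ⌣ g and h (k + 1) change by u on small simplices, so adding h (k + 1) restores invariance
      -- at the price of the error δ(h (k + 1)).
      refine ⟨cochainCup (by omega : (k + 1) + 0 = k + 1) u g + h (k + 1) +
        cochainCup rfl β c, fun s hs => ?_, fun s hs => ?_⟩
      · have h1 := hstep k (by omega) s hs
        rw [← hu] at h1
        have h2 : cochainCup rfl β c (τ.comp s) = cochainCup rfl β c s := by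
          change β (τ.comp (s.restrict _)) * c (τ.comp (s.restrict _)) = _
          rw [hβ _ (hs.restrict _), hcinv]
          rfl
        have h3 : cochainCup (by omega : (k + 1) + 0 = k + 1) u g (τ.comp s) =
            cochainCup (by omega : (k + 1) + 0 = k + 1) u g s + u s := by
          change u (τ.comp (s.restrict _)) * g (τ.comp (s.restrict _)) =
            u (s.restrict _) * g (s.restrict _) + u s
          rw [SingularSimplex.restrict_frontFace_self, huinv s hs, hg]
          ring
        simp only [Pi.add_apply, h2, h3, ← h1]
        generalize h (k + 1) s = a
        generalize h (k + 1) (τ.comp s) = b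
        generalize cochainCup _ u g s = x
        generalize cochainCup _ β c s = y
        revert a b x y
        decide
      · rw [map_add, map_add, coboundary_cochainCup, coboundary_cochainCup, hu,
          coboundary_coboundary, ← hu, ← hc, hc, coboundary_coboundary, ← hc]
        change cochainPow c (k + 1) (s.restrict _) * c (s.restrict _) = _ + (0 * _ +
          u (s.restrict _) * c (s.restrict _) + coboundary X (k + 1) (h (k + 1)) s +
          (coboundary X k β (s.restrict _) * c (s.restrict _) + _ * 0))
        rw [hβ2 _ (hs.restrict _)]
        generalize coboundary X (k + 1) (h (k + 1)) s = a
        rw [zero_mul, mul_zero]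
        generalize c (s.restrict _) = x
        generalize u (s.restrict _) = y
        generalize coboundary X k β (s.restrict _) = z
        revert a x y z
        decide
  obtain ⟨β, hβ, hβ2⟩ := claim d le_rfl
  -- Extension by zero makes β invariant everywhere, since τ preserves smallness. Its coboundary is
  -- unchanged on small simplices because their faces are small.
  set β₀ : SingularCochain X d := fun s => if s.IsSmall U then β s else 0 with hβ₀
  have hβ₀inv : ∀ s : SingularSimplex X d, β₀ (τ.comp s) = β₀ s := by
    intro s
    by_cases hs : s.IsSmall U
    · simp only [hβ₀, if_pos hs, if_pos (hsm s hs), hβ s hs]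
    · have : ¬ SingularSimplex.IsSmall U (τ.comp s) := fun h' => hs (by
        have := hsm _ h'
        rwa [hττ] at this)
      simp only [hβ₀, if_neg hs, if_neg this]
  obtain ⟨b, hb, hbinv⟩ := exists_coboundary_eq_of_eq_zero_on_small U hU hcov τ e he
    (cochainPow c (d + 1) + coboundary X d β₀)
    (by rw [map_add, coboundary_cochainPow, coboundary_coboundary, add_zero])
    (by
      intro s hs
      have h1 : coboundary X d β₀ s = coboundary X d β s := by
        rw [coboundary_apply, coboundary_apply]
        exact Finset.sum_congr rfl fun i _ => if_pos (hs.restrict _)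
      rw [Pi.add_apply, h1, hβ2 s hs, hlast s hs, zero_add, chain_add_self])
    (by
      intro s
      rw [Pi.add_apply, Pi.add_apply, hpinv]
      congr 1
      change ∑ i : Fin (d + 2), β₀ (τ.comp (SingularSimplex.restrict s i.succAbove)) =
        ∑ i : Fin (d + 2), β₀ (SingularSimplex.restrict s i.succAbove)
      exact Finset.sum_congr rfl fun i _ => hβ₀inv _)
  refine ⟨b + β₀, ?_, fun s => ?_⟩
  · rw [map_add, hb, add_assoc, chain_add_self, add_zero]
  · rw [Pi.add_apply, Pi.add_apply, hbinv, hβ₀inv]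

end

/-! ### Lifting singular simplices to a double cover -/

section

variable (X : Type*) [TopologicalSpace X] [MulAction Z2 X]

/-- The projection to the orbit space. -/
def OrbitSpace.proj : C(X, OrbitSpace X) :=
  ⟨Quotient.mk _, continuous_quotient_mk'⟩

variable [ContinuousConstSMul Z2 X]

/-- The involution defined by the action of the group of order two. -/
def Z2.invol : C(X, X) :=
  ⟨fun x => (Multiplicative.ofAdd (1 : ZMod 2) : Z2) • x, continuous_const_smul _⟩

variable {X}

theorem Z2.eq_one_or_eq (g : Z2) : g = 1 ∨ g = Multiplicative.ofAdd (1 : ZMod 2) := by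
  revert g
  decide

theorem Z2.invol_invol (x : X) : Z2.invol X (Z2.invol X x) = x := by
  change (Multiplicative.ofAdd (1 : ZMod 2) : Z2) • (Multiplicative.ofAdd (1 : ZMod 2) : Z2) • x = x
  rw [smul_smul]
  have : (Multiplicative.ofAdd (1 : ZMod 2) : Z2) * Multiplicative.ofAdd (1 : ZMod 2) = 1 := by decide
  rw [this, one_smul]

theorem Z2.invol_ne [IsCancelSMul Z2 X] (x : X) : Z2.invol X x ≠ x := by
  intro h
  have h1 : (Multiplicative.ofAdd (1 : ZMod 2) : Z2) • x = (1 : Z2) • x := by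
    rw [one_smul]; exact h
  exact absurd (IsCancelSMul.right_cancel _ _ x h1) (by decide)

theorem OrbitSpace.proj_eq_iff {x y : X} :
    OrbitSpace.proj X x = OrbitSpace.proj X y ↔ x = y ∨ x = Z2.invol X y := by
  change Quotient.mk (MulAction.orbitRel Z2 X) x = Quotient.mk (MulAction.orbitRel Z2 X) y ↔ _
  rw [Quotient.eq, MulAction.orbitRel_apply]
  constructor
  · rintro ⟨g, rfl⟩
    rcases Z2.eq_one_or_eq g with rfl | rfl
    · left; exact one_smul _ _
    · right; rfl
  · rintro (rfl | rfl)
    · exact MulAction.mem_orbit_self _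
    · exact MulAction.mem_orbit _ _

theorem OrbitSpace.proj_invol (x : X) :
    OrbitSpace.proj X (Z2.invol X x) = OrbitSpace.proj X x :=
  OrbitSpace.proj_eq_iff.2 (Or.inr rfl)

variable [IsCancelSMul Z2 X] [T2Space X]

/-- In a Hausdorff space a point and its distinct image under the involution have disjoint
neighbourhoods, and this gives an evenly covered neighbourhood. -/
theorem OrbitSpace.isCoveringMap_proj : IsCoveringMap (OrbitSpace.proj X) := by
  have h : IsQuotientCoveringMap (OrbitSpace.proj X) Z2 :=
    { isQuotientMap_quotient_mk' with
      continuous_const_smul := continuous_const_smul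
      apply_eq_iff_mem_orbit := by
        intro x y
        exact Quotient.eq.trans (by rw [MulAction.orbitRel_apply])
      disjoint := by
        intro x
        obtain ⟨u, v, hu, hv, hxu, hxv, huv⟩ := t2_separation (Z2.invol_ne x).symm
        refine ⟨u ∩ Z2.invol X ⁻¹' v, Filter.inter_mem (hu.mem_nhds hxu)
          ((hv.preimage (Z2.invol X).continuous).mem_nhds hxv), fun g hg => ?_⟩
        rcases Z2.eq_one_or_eq g with rfl | rfl
        · rfl
        · obtain ⟨_, ⟨y, hy, rfl⟩, hy'⟩ := hg
          exact (Set.disjoint_left.1 huv hy'.1 hy.2).elim }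
  exact h.isCoveringMap

theorem OrbitSpace.exists_lift {n : ℕ} (s : SingularSimplex (OrbitSpace X) n) :
    ∃ t : SingularSimplex X n, (OrbitSpace.proj X).comp t = s := by
  set a₀ : stdSimplex ℝ (Fin (n + 1)) := stdSimplex.vertex 0
  obtain ⟨x₀, hx₀⟩ := Quotient.exists_rep (s a₀)
  -- The straight-line contraction to a vertex. Homotopy lifting from the constant map at a preimage
  -- of that vertex yields the lift of s at time 1.
  let L : C(unitInterval × stdSimplex ℝ (Fin (n + 1)), stdSimplex ℝ (Fin (n + 1))) :=
    { toFun := fun p => ⟨(1 - (p.1 : ℝ)) • a₀.1 + (p.1 : ℝ) • p.2.1,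
        convex_stdSimplex ℝ _ a₀.2 p.2.2 (by linarith [p.1.2.2]) p.1.2.1 (by ring)⟩
      continuous_toFun := by
        refine Continuous.subtype_mk ?_ _
        fun_prop }
  have hL0 : ∀ a, L (0, a) = a₀ := fun a => Subtype.ext (by simp [L])
  have hL1 : ∀ a, L (1, a) = a := fun a => Subtype.ext (by simp [L])
  have h0 : ∀ a, (s.comp L) (0, a) = OrbitSpace.proj X (ContinuousMap.const _ x₀ a) := fun a => by
    rw [ContinuousMap.comp_apply, hL0]
    exact hx₀.symm
  have hl := (OrbitSpace.isCoveringMap_proj (X := X)).liftHomotopy_lifts (s.comp L)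
    (ContinuousMap.const _ x₀) h0
  refine ⟨((OrbitSpace.isCoveringMap_proj (X := X)).liftHomotopy (s.comp L)
    (ContinuousMap.const _ x₀) h0).comp ⟨fun a => (1, a), by fun_prop⟩, ?_⟩
  ext a
  refine (congrFun hl (1, a)).trans ?_
  rw [ContinuousMap.comp_apply, hL1]

theorem OrbitSpace.lift_unique {n : ℕ} {s t : SingularSimplex X n}
    (h : (OrbitSpace.proj X).comp s = (OrbitSpace.proj X).comp t) :
    s = t ∨ s = (Z2.invol X).comp t := by
  set a₀ : stdSimplex ℝ (Fin (n + 1)) := stdSimplex.vertex 0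
  rcases OrbitSpace.proj_eq_iff.1 (DFunLike.congr_fun h a₀) with h0 | h0
  · left
    exact DFunLike.coe_injective (OrbitSpace.isCoveringMap_proj.eq_of_comp_eq s.continuous
      t.continuous (funext fun a => DFunLike.congr_fun h a) a₀ h0)
  · right
    refine DFunLike.coe_injective (OrbitSpace.isCoveringMap_proj.eq_of_comp_eq s.continuous
      ((Z2.invol X).comp t).continuous (funext fun a => ?_) a₀ h0)
    exact (DFunLike.congr_fun h a).trans (OrbitSpace.proj_invol (t a)).symm

/-- A cochain of the orbit space that becomes the coboundary of an invariant cochain is a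
coboundary. -/
theorem OrbitSpace.mem_coboundaries {d : ℕ} (c : SingularCochain (OrbitSpace X) (d + 1))
    (b : SingularCochain X d) (hb : coboundary X d b = cochainPullback (OrbitSpace.proj X) (d + 1) c)
    (hinv : ∀ s : SingularSimplex X d, b ((Z2.invol X).comp s) = b s) :
    c ∈ coboundaries (OrbitSpace X) (d + 1) := by
  choose l hl using fun s : SingularSimplex (OrbitSpace X) d => OrbitSpace.exists_lift s
  -- A chosen lift is either t or its image under the involution. Invariance of b makes the choice
  -- irrelevant, so b descends and commutes with taking faces.
  have hbl : ∀ t, b (l ((OrbitSpace.proj X).comp t)) = b t := fun t => by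
    rcases OrbitSpace.lift_unique (hl ((OrbitSpace.proj X).comp t)) with h | h <;> rw [h]
    exact hinv t
  refine ⟨fun s => b (l s), ?_⟩
  funext s
  obtain ⟨t, rfl⟩ := OrbitSpace.exists_lift s
  refine Eq.trans ?_ (congrFun hb t)
  change ∑ i : Fin (d + 2), b (l ((OrbitSpace.proj X).comp (t.restrict i.succAbove))) =
    ∑ i : Fin (d + 2), b (t.restrict i.succAbove)
  exact Finset.sum_congr rfl fun i _ => hbl (t.restrict i.succAbove)

end

section

open scoped unitInterval

/-! ### Maps to and from weak topologies -/

theorem weakTopology_le {X ι : Type*} (t : TopologicalSpace X) (A : ι → Set X) :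
    weakTopology t A ≤ t :=
  iSup_le fun _ => coinduced_le_iff_le_induced.2 le_rfl

/-- The weak topology is finer than t in general, but on a single piece the inclusion is continuous.
A map with image in one piece may therefore be tested against t. -/
theorem continuous_to_weakTopology {X ι Z : Type*} [TopologicalSpace Z] (t : TopologicalSpace X)
    (A : ι → Set X) (i : ι) (f : Z → X) (hf : Continuous[_, t] f) (h : ∀ z, f z ∈ A i) :
    Continuous[_, weakTopology t A] f := by
  have h1 : Continuous[_, TopologicalSpace.induced ((↑) : A i → X) t]
      (fun z => (⟨f z, h z⟩ : A i)) := continuous_induced_rng.2 hf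
  have h2 : Continuous[TopologicalSpace.induced ((↑) : A i → X) t, weakTopology t A]
      ((↑) : A i → X) := by
    rw [continuous_iff_coinduced_le]
    exact le_iSup (fun i => TopologicalSpace.coinduced ((↑) : A i → X)
      (TopologicalSpace.induced (↑) t)) i
  exact @Continuous.comp _ _ _ _ (TopologicalSpace.induced ((↑) : A i → X) t)
    (weakTopology t A) _ _ h2 h1

/-! ### Singular one-simplices and squares -/

/-- The singular simplex given by a path. -/
noncomputable def SingularSimplex.ofPath {Y : Type*} [TopologicalSpace Y] (f : C(I, Y)) :
    SingularSimplex Y 1 :=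
  f.comp ⟨fun t => ⟨t 1, t.2.1 1, stdSimplex.le_one t 1⟩,
    Continuous.subtype_mk ((continuous_apply 1).comp continuous_subtype_val) _⟩

/-- The path parametrizing a singular one-simplex. -/
noncomputable def SingularSimplex.toPath {Y : Type*} [TopologicalSpace Y]
    (s : SingularSimplex Y 1) : C(I, Y) :=
  s.comp ⟨fun u => ⟨![1 - u, u], by
    refine ⟨fun i => ?_, by simp⟩
    fin_cases i
    · simpa using u.2.2
    · simpa using u.2.1⟩, by
    refine Continuous.subtype_mk (continuous_pi fun i => ?_) _
    fin_cases i
    · simp only [Fin.zero_eta, Matrix.cons_val_zero]; fun_prop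
    · simp only [Fin.mk_one, Matrix.cons_val_one]; fun_prop⟩

theorem SingularSimplex.ofPath_toPath {Y : Type*} [TopologicalSpace Y] (s : SingularSimplex Y 1) :
    SingularSimplex.ofPath s.toPath = s := by
  ext t
  refine congrArg s (Subtype.ext (funext fun i => ?_))
  have h := t.2.2
  rw [Fin.sum_univ_two] at h
  fin_cases i
  · change 1 - t.1 1 = t.1 0
    linarith
  · rfl

theorem SingularSimplex.toPath_zero {Y : Type*} [TopologicalSpace Y] (s : SingularSimplex Y 1) :
    s.toPath 0 = s (stdSimplex.vertex 0) := by
  refine congrArg s (Subtype.ext (funext fun i => ?_))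
  fin_cases i <;> simp

theorem SingularSimplex.toPath_one {Y : Type*} [TopologicalSpace Y] (s : SingularSimplex Y 1) :
    s.toPath 1 = s (stdSimplex.vertex 1) := by
  refine congrArg s (Subtype.ext (funext fun i => ?_))
  fin_cases i <;> simp

theorem stdSimplex.map_apply {m n : ℕ} (θ : Fin (m + 1) → Fin (n + 1))
    (t : stdSimplex ℝ (Fin (m + 1))) (j : Fin (n + 1)) :
    stdSimplex.map θ t j = ∑ i, if θ i = j then t i else 0 := by
  rw [stdSimplex.map_coe, FunOnFinite.linearMap_apply_apply, Finset.sum_filter]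

/-- All three faces of a constant 2-simplex are the same constant edge, and three equals one modulo
2. -/
theorem cocycle_const {Y : Type*} [TopologicalSpace Y] {c : SingularCochain Y 1}
    (hc : coboundary Y 1 c = 0) (y : Y) : c (ContinuousMap.const _ y) = 0 := by
  have h := congrFun hc (ContinuousMap.const _ y)
  rw [coboundary_apply, Fin.sum_univ_three] at h
  change c (ContinuousMap.const _ y) + c (ContinuousMap.const _ y) +
    c (ContinuousMap.const _ y) = 0 at h
  rwa [chain_add_self, zero_add] at h

/-- The diagonal cuts the square into two singular triangles. Adding their cocycle relations cancels
the diagonal. -/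
theorem cocycle_square {Y : Type*} [TopologicalSpace Y] {c : SingularCochain Y 1}
    (hc : coboundary Y 1 c = 0) (Q : C(I × I, Y)) :
    c (.ofPath (Q.comp ⟨fun u => (u, 0), by fun_prop⟩)) +
      c (.ofPath (Q.comp ⟨fun u => (u, 1), by fun_prop⟩)) =
    c (.ofPath (Q.comp ⟨fun v => (0, v), by fun_prop⟩)) +
      c (.ofPath (Q.comp ⟨fun v => (1, v), by fun_prop⟩)) := by
  let p2 : C(stdSimplex ℝ (Fin 3), I) := ⟨fun t => ⟨t 2, t.2.1 2, stdSimplex.le_one t 2⟩,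
    Continuous.subtype_mk ((continuous_apply 2).comp continuous_subtype_val) _⟩
  let p12 : C(stdSimplex ℝ (Fin 3), I) := ⟨fun t => ⟨t 1 + t 2,
    add_nonneg (t.2.1 1) (t.2.1 2), by
      have h := t.2.2
      rw [Fin.sum_univ_three] at h
      have h0 := t.2.1 0
      change t.1 1 + t.1 2 ≤ 1
      linarith⟩,
    Continuous.subtype_mk (((continuous_apply 1).comp continuous_subtype_val).add
      ((continuous_apply 2).comp continuous_subtype_val)) _⟩
  have h1 := congrFun hc (Q.comp (p12.prodMk p2))
  have h2 := congrFun hc (Q.comp (p2.prodMk p12))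
  rw [coboundary_apply, Fin.sum_univ_three] at h1 h2
  have hone : ∀ t : stdSimplex ℝ (Fin 2), t 0 + t 1 = 1 := stdSimplex.add_eq_one
  have key : ∀ (i : Fin 3) (t : stdSimplex ℝ (Fin 2)),
      (stdSimplex.map i.succAbove t : stdSimplex ℝ (Fin 3)) 1 = ![t 0, 0, t 1] i ∧
      (stdSimplex.map i.succAbove t : stdSimplex ℝ (Fin 3)) 2 = ![t 1, t 1, 0] i := by
    intro i t
    rw [stdSimplex.map_apply, stdSimplex.map_apply, Fin.sum_univ_two, Fin.sum_univ_two]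
    fin_cases i <;> simp [Fin.succAbove, Fin.ext_iff]
  have e1 : SingularSimplex.restrict (Q.comp (p12.prodMk p2)) (Fin.succAbove 0) =
      .ofPath (Q.comp ⟨fun v => (1, v), by fun_prop⟩) := by
    ext t
    refine congrArg Q (Prod.ext (Subtype.ext ?_) (Subtype.ext ?_))
    · exact (congrArg₂ (· + ·) (key 0 t).1 (key 0 t).2).trans (hone t)
    · exact (key 0 t).2
  have e2 : SingularSimplex.restrict (Q.comp (p12.prodMk p2)) (Fin.succAbove 1) =
      SingularSimplex.restrict (Q.comp (p2.prodMk p12)) (Fin.succAbove 1) := by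
    ext t
    refine congrArg Q (Prod.ext (Subtype.ext ?_) (Subtype.ext ?_))
    · exact ((congrArg₂ (· + ·) (key 1 t).1 (key 1 t).2).trans (zero_add _)).trans (key 1 t).2.symm
    · exact (((congrArg₂ (· + ·) (key 1 t).1 (key 1 t).2).trans (zero_add _)).trans
        (key 1 t).2.symm).symm
  have e3 : SingularSimplex.restrict (Q.comp (p12.prodMk p2)) (Fin.succAbove 2) =
      .ofPath (Q.comp ⟨fun u => (u, 0), by fun_prop⟩) := by
    ext t
    refine congrArg Q (Prod.ext (Subtype.ext ?_) (Subtype.ext ?_))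
    · exact (congrArg₂ (· + ·) (key 2 t).1 (key 2 t).2).trans (add_zero _)
    · exact (key 2 t).2
  have e4 : SingularSimplex.restrict (Q.comp (p2.prodMk p12)) (Fin.succAbove 0) =
      .ofPath (Q.comp ⟨fun u => (u, 1), by fun_prop⟩) := by
    ext t
    refine congrArg Q (Prod.ext (Subtype.ext ?_) (Subtype.ext ?_))
    · exact (key 0 t).2
    · exact (congrArg₂ (· + ·) (key 0 t).1 (key 0 t).2).trans (hone t)
  have e5 : SingularSimplex.restrict (Q.comp (p2.prodMk p12)) (Fin.succAbove 2) =
      .ofPath (Q.comp ⟨fun v => (0, v), by fun_prop⟩) := by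
    ext t
    refine congrArg Q (Prod.ext (Subtype.ext ?_) (Subtype.ext ?_))
    · exact (key 2 t).2
    · exact (congrArg₂ (· + ·) (key 2 t).1 (key 2 t).2).trans (add_zero _)
  rw [e1, e2, e3] at h1
  rw [e4, e5] at h2
  generalize c (SingularSimplex.restrict (Q.comp (p2.prodMk p12)) (Fin.succAbove 1)) = x at h1 h2
  generalize c (.ofPath (Q.comp ⟨fun v => (1, v), _⟩)) = a at *
  generalize c (.ofPath (Q.comp ⟨fun v => (0, v), _⟩)) = b at *
  generalize c (.ofPath (Q.comp ⟨fun v => (v, 0), _⟩)) = a' at *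
  generalize c (.ofPath (Q.comp ⟨fun v => (v, 1), _⟩)) = b' at *
  change a + x + a' = 0 at h1
  change b' + x + b = 0 at h2
  revert a b a' b' x
  decide

/-! ### The first cohomology of the infinite sphere -/

namespace InfiniteSphere

theorem continuous_coe : Continuous (fun x : InfiniteSphere => (x.1 : ℕ → ℝ)) := by
  rw [continuous_iff_le_induced]
  exact weakTopology_le _ _

theorem continuous_coord (i : ℕ) : Continuous (fun x : InfiniteSphere => x.1 i) :=
  (continuous_apply i).comp continuous_coe

instance : T2Space InfiniteSphere :=
  T2Space.of_injective_continuous (f := fun x : InfiniteSphere => (x.1 : ℕ → ℝ))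
    (fun _ _ h => Subtype.ext (DFunLike.coe_injective h)) continuous_coe

theorem continuous_of_coord {Z : Type*} [TopologicalSpace Z] (f : Z → InfiniteSphere) (n : ℕ)
    (h : ∀ z, f z ∈ finiteSphere n) (hf : ∀ i, Continuous fun z => (f z).1 i) : Continuous f :=
  continuous_to_weakTopology _ _ n f (continuous_induced_rng.2 (continuous_pi hf)) h

theorem finiteSphere_mono {m n : ℕ} (h : m ≤ n) : finiteSphere m ⊆ finiteSphere n :=
  fun _ hx i hi => hx i (h.trans hi)

theorem exists_mem_finiteSphere (x : InfiniteSphere) : ∃ n, x ∈ finiteSphere n := by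
  refine ⟨x.1.support.sup id + 1, fun i hi => ?_⟩
  by_contra h
  have := Finset.le_sup (f := id) (Finsupp.mem_support_iff.2 h)
  simp only [id] at this
  omega

theorem isOpen_iff (U : Set InfiniteSphere) : IsOpen U ↔ ∀ n,
    IsOpen[TopologicalSpace.induced ((↑) : finiteSphere n → InfiniteSphere)
      (TopologicalSpace.induced (fun x : InfiniteSphere => (x.1 : ℕ → ℝ)) inferInstance)]
      ((↑) ⁻¹' U : Set (finiteSphere n)) :=
  isOpen_weakTopology _ _ _

/-- In the weak topology closedness is tested on each finite sphere, where finite sets are closed.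
-/
theorem isClosed_of_finite_inter (D : Set InfiniteSphere)
    (h : ∀ n, (D ∩ finiteSphere n).Finite) : IsClosed D := by
  rw [← isOpen_compl_iff, isOpen_iff]
  intro n
  have h1 : IsOpen[TopologicalSpace.induced (fun x : InfiniteSphere => (x.1 : ℕ → ℝ))
      inferInstance] ((D ∩ finiteSphere n)ᶜ) := by
    refine ⟨((fun x : InfiniteSphere => (x.1 : ℕ → ℝ)) '' (D ∩ finiteSphere n))ᶜ,
      ((h n).image _).isClosed.isOpen_compl, ?_⟩
    rw [Set.preimage_compl, Set.preimage_image_eq]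
    exact fun _ _ h => Subtype.ext (DFunLike.coe_injective h)
  refine ⟨_, h1, ?_⟩
  ext x
  simp

/-- A compact family of points of the infinite sphere lies in a finite-dimensional sphere. -/
theorem exists_forall_mem_finiteSphere {Z : Type*} [TopologicalSpace Z] [CompactSpace Z]
    (f : Z → InfiniteSphere) (hf : Continuous f) : ∃ n, ∀ z, f z ∈ finiteSphere n := by
  by_contra! hcon
  choose z hz using hcon
  -- The point f (z j) lies outside the j-th sphere, so each tail of the sequence meets a finite
  -- sphere in finitely many points. The complements of the tails form an increasing open cover,
  -- contradicting compactness.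
  have hO : ∀ k, IsClosed {x | ∃ j ≥ k, x = f (z j)} := by
    intro k
    classical
    refine isClosed_of_finite_inter _ fun n => ?_
    refine ((Finset.range n).image fun j => f (z j)).finite_toSet.subset ?_
    rintro _ ⟨⟨j, -, rfl⟩, hj⟩
    rw [Finset.mem_coe, Finset.mem_image]
    refine ⟨j, Finset.mem_range.2 ?_, rfl⟩
    by_contra h
    exact hz j (finiteSphere_mono (not_lt.1 h) hj)
  obtain ⟨k, hk⟩ := isCompact_univ.elim_directed_cover
    (fun k => f ⁻¹' {x | ∃ j ≥ k, x = f (z j)}ᶜ) (fun k => (hO k).isOpen_compl.preimage hf)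
    (by
      intro y _
      obtain ⟨n, hn⟩ := exists_mem_finiteSphere (f y)
      refine Set.mem_iUnion.2 ⟨n, ?_⟩
      rintro ⟨j, hj, hy⟩
      rw [hy] at hn
      exact hz j (finiteSphere_mono hj hn))
    (directed_of_isDirected_le fun a b hab y hy => by
      rintro ⟨j, hj, h⟩
      exact hy ⟨j, hab.trans hj, h⟩)
  exact hk (Set.mem_univ (z k)) ⟨k, le_rfl, rfl⟩

theorem sum_sq_eq (x : ℕ →₀ ℝ) (n : ℕ) (h : ∀ i, n ≤ i → x i = 0) :
    x.sum (fun _ t => t ^ 2) = ∑ i ∈ Finset.range n, x i ^ 2 := by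
  refine Finsupp.sum_of_support_subset x (fun i hi => ?_) _ (by simp)
  by_contra hn
  exact Finsupp.mem_support_iff.1 hi (h i (by simpa using hn))

theorem sum_sq_pos {x : ℕ →₀ ℝ} (hx : x ≠ 0) : 0 < x.sum (fun _ t => t ^ 2) := by
  obtain ⟨i, hi⟩ := Finsupp.ne_iff.1 hx
  refine Finset.sum_pos' (fun _ _ => sq_nonneg _) ⟨i, Finsupp.mem_support_iff.2 hi, ?_⟩
  exact pow_pos_of_ne_zero_sq hi
where
  pow_pos_of_ne_zero_sq {t : ℝ} (h : t ≠ 0) : 0 < t ^ 2 := by positivity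

theorem sum_sq_smul (r : ℝ) (x : ℕ →₀ ℝ) :
    (r • x).sum (fun _ t => t ^ 2) = r ^ 2 * x.sum (fun _ t => t ^ 2) := by
  rw [Finsupp.sum_smul_index (by simp), Finsupp.mul_sum]
  simp only [mul_pow]

/-- The radial projection of a nonzero vector to the infinite sphere. -/
noncomputable def normalize (x : ℕ →₀ ℝ) (hx : x ≠ 0) : InfiniteSphere :=
  ⟨(√(x.sum fun _ t => t ^ 2))⁻¹ • x, by
    rw [sum_sq_smul, inv_pow, Real.sq_sqrt (sum_sq_pos hx).le, inv_mul_cancel₀ (sum_sq_pos hx).ne']⟩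

theorem ne_zero (x : InfiniteSphere) : x.1 ≠ 0 := by
  intro h
  have := x.2
  rw [h] at this
  simp at this

theorem normalize_coe (x : InfiniteSphere) (h : x.1 ≠ 0) : normalize x.1 h = x := by
  apply Subtype.ext
  change (√(x.1.sum fun _ t => t ^ 2))⁻¹ • x.1 = x.1
  rw [x.2, Real.sqrt_one, inv_one, one_smul]

theorem normalize_congr {x y : ℕ →₀ ℝ} (h : x = y) (hx : x ≠ 0) (hy : y ≠ 0) :
    normalize x hx = normalize y hy := by
  subst h; rfl

theorem continuous_normalize {Z : Type*} [TopologicalSpace Z] (A : Z → ℕ →₀ ℝ)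
    (hA : ∀ z, A z ≠ 0) (n : ℕ) (hn : ∀ z, ∀ i, n ≤ i → A z i = 0)
    (hc : ∀ i, Continuous fun z => A z i) : Continuous fun z => normalize (A z) (hA z) := by
  refine continuous_of_coord _ n (fun z i hi => ?_) fun i => ?_
  · change (√((A z).sum fun _ t => t ^ 2))⁻¹ * A z i = 0
    rw [hn z i hi, mul_zero]
  · change Continuous fun z => (√((A z).sum fun _ t => t ^ 2))⁻¹ * A z i
    refine Continuous.mul (Continuous.inv₀ (Continuous.sqrt ?_) fun z => ?_) (hc i)
    · simp only [fun z => sum_sq_eq (A z) n (hn z)]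
      exact continuous_finsetSum _ fun i _ => (hc i).pow 2
    · exact (Real.sqrt_pos.2 (sum_sq_pos (hA z))).ne'

/-- Two maps to nonzero vectors that are joined by nowhere vanishing segments. -/
structure IsLinearHomotopy (P R : InfiniteSphere → ℕ →₀ ℝ) : Prop where
  continuous_left : ∀ i, Continuous fun x => P x i
  continuous_right : ∀ i, Continuous fun x => R x i
  left_eq_zero : ∀ n, ∀ x ∈ finiteSphere n, ∀ i ≥ n + 1, P x i = 0
  right_eq_zero : ∀ n, ∀ x ∈ finiteSphere n, ∀ i ≥ n + 1, R x i = 0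
  ne_zero : ∀ x, ∀ v : I, (1 - (v : ℝ)) • P x + (v : ℝ) • R x ≠ 0

namespace IsLinearHomotopy

variable {P R : InfiniteSphere → ℕ →₀ ℝ} (h : IsLinearHomotopy P R)
include h

/-- The homotopy along a path. -/
noncomputable def square (f : C(I, InfiniteSphere)) : C(I × I, InfiniteSphere) where
  toFun p := normalize ((1 - (p.2 : ℝ)) • P (f p.1) + (p.2 : ℝ) • R (f p.1)) (h.ne_zero _ _)
  continuous_toFun := by
    obtain ⟨n, hn⟩ := exists_forall_mem_finiteSphere f f.continuous
    refine continuous_normalize _ _ (n + 1) (fun p i hi => ?_) fun i => ?_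
    · simp [h.left_eq_zero n _ (hn p.1) i hi, h.right_eq_zero n _ (hn p.1) i hi]
    · simp only [Finsupp.add_apply, Finsupp.smul_apply, smul_eq_mul]
      have h1 := (h.continuous_left i).comp (f.continuous.comp (continuous_fst (X := I) (Y := I)))
      have h2 := (h.continuous_right i).comp (f.continuous.comp (continuous_fst (X := I) (Y := I)))
      refine Continuous.add (Continuous.mul (by fun_prop) h1) (Continuous.mul (by fun_prop) h2)

/-- The track of a point under the homotopy. -/
noncomputable def track (x : InfiniteSphere) : C(I, InfiniteSphere) :=
  (h.square (ContinuousMap.const _ x)).comp ⟨fun v => (0, v), by fun_prop⟩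

/-- The start of the homotopy along a path. -/
noncomputable def start (f : C(I, InfiniteSphere)) : C(I, InfiniteSphere) :=
  (h.square f).comp ⟨fun u => (u, 0), by fun_prop⟩

/-- The end of the homotopy along a path. -/
noncomputable def finish (f : C(I, InfiniteSphere)) : C(I, InfiniteSphere) :=
  (h.square f).comp ⟨fun u => (u, 1), by fun_prop⟩

/-- Along a homotopy the value of a cocycle on a path changes by its values on the tracks of the two
endpoints. -/
theorem cocycle_eq {c : SingularCochain InfiniteSphere 1} (hc : coboundary _ 1 c = 0)
    (f : C(I, InfiniteSphere)) : c (.ofPath (h.start f)) = c (.ofPath (h.finish f)) +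
      (c (.ofPath (h.track (f 0))) + c (.ofPath (h.track (f 1)))) := by
  have h1 := cocycle_square hc (h.square f)
  have h2 : ∀ u : I, (h.square f).comp ⟨fun v => (u, v), by fun_prop⟩ = h.track (f u) := fun u => rfl
  rw [h2, h2] at h1
  rw [← h1, add_comm]
  exact (chain_add_add_cancel_comm (c (.ofPath (h.finish f))) (c (.ofPath (h.start f)))).symm.trans
    (by rw [add_comm (c (.ofPath (h.finish f))) (c (.ofPath (h.start f)))]; rfl)

end IsLinearHomotopy

/-- The shift of coordinates. -/
noncomputable def shift (x : InfiniteSphere) : ℕ →₀ ℝ := x.1.mapDomain Nat.succ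

theorem shift_succ (x : InfiniteSphere) (i : ℕ) : shift x (i + 1) = x.1 i :=
  Finsupp.mapDomain_apply Nat.succ_injective _ _

theorem shift_zero (x : InfiniteSphere) : shift x 0 = 0 :=
  Finsupp.mapDomain_of_notMem_range _ _ (by simp)

theorem shift_ne_zero (x : InfiniteSphere) : shift x ≠ 0 := by
  obtain ⟨i, hi⟩ := Finsupp.ne_iff.1 x.ne_zero
  intro h
  exact hi (by rw [← shift_succ, h]; rfl)

theorem continuous_shift (i : ℕ) : Continuous fun x => shift x i := by
  cases i with
  | zero => simp only [shift_zero]; exact continuous_const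
  | succ i => simp only [shift_succ]; exact continuous_coord i

theorem shift_eq_zero (n : ℕ) (x : InfiniteSphere) (hx : x ∈ finiteSphere n) (i : ℕ)
    (hi : i ≥ n + 1) : shift x i = 0 := by
  obtain ⟨i, rfl⟩ : ∃ j, i = j + 1 := ⟨i - 1, by omega⟩
  rw [shift_succ]
  exact hx i (by omega)

theorem isLinearHomotopy_shift : IsLinearHomotopy (fun x => x.1) shift where
  continuous_left := continuous_coord
  continuous_right := continuous_shift
  left_eq_zero n x hx i hi := hx i (by omega)
  right_eq_zero := shift_eq_zero
  ne_zero x v h := by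
    have hz : ∀ i, x.1 i = 0 := by
      by_cases hv : (v : ℝ) = 1
      · rw [hv] at h
        simp only [sub_self, zero_smul, one_smul, zero_add] at h
        exact absurd h (shift_ne_zero x)
      -- If v is not 1, the relation at coordinate 0 gives x 0 = 0, and at i + 1 it deduces x (i +
      -- 1) = 0 from x i = 0. So x would be zero.
      · have hv' : 1 - (v : ℝ) ≠ 0 := fun h' => hv (by linarith)
        intro i
        induction i with
        | zero =>
          have := DFunLike.congr_fun h 0
          simpa [shift_zero, hv'] using this
        | succ i ih =>
          have := DFunLike.congr_fun h (i + 1)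
          simpa [shift_succ, hv', ih] using this
    exact x.ne_zero (Finsupp.ext hz)

/-- A shifted vector has zeroth coordinate 0, so it is linearly independent of the zeroth basis
vector and the segment avoids the origin. This is why the shift comes first. -/
theorem isLinearHomotopy_shift_const :
    IsLinearHomotopy shift (fun _ => Finsupp.single 0 1) where
  continuous_left := continuous_shift
  continuous_right _ := continuous_const
  left_eq_zero := shift_eq_zero
  right_eq_zero n x hx i hi := Finsupp.single_eq_of_ne (by omega)
  ne_zero x v h := by
    have h0 := DFunLike.congr_fun h 0
    have hv : (v : ℝ) = 0 := by simpa [shift_zero] using h0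
    rw [hv] at h
    exact shift_ne_zero x (by simpa using h)

/-- The function whose coboundary is a given one-cocycle of the infinite sphere. -/
noncomputable def potential (c : SingularCochain InfiniteSphere 1) (x : InfiniteSphere) : ZMod 2 :=
  c (.ofPath (isLinearHomotopy_shift.track x)) + c (.ofPath (isLinearHomotopy_shift_const.track x))

/-- Composing the two homotopies contracts the sphere. The path ends up constant, where c vanishes,
and only the tracks of its endpoints contribute. -/
theorem cocycle_ofPath {c : SingularCochain InfiniteSphere 1} (hc : coboundary _ 1 c = 0)
    (f : C(I, InfiniteSphere)) :
    c (.ofPath f) = potential c (f 0) + potential c (f 1) := by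
  have h1 := isLinearHomotopy_shift.cocycle_eq hc f
  have h2 := isLinearHomotopy_shift_const.cocycle_eq hc f
  have e1 : isLinearHomotopy_shift.start f = f := by
    ext u : 1
    refine Eq.trans (normalize_congr ?_ (isLinearHomotopy_shift.ne_zero (f u) 0) (ne_zero _))
      (normalize_coe (f u) (ne_zero _))
    simp
  have e2 : isLinearHomotopy_shift.finish f = isLinearHomotopy_shift_const.start f := by
    ext u : 1
    refine normalize_congr ?_ (isLinearHomotopy_shift.ne_zero (f u) 1) (isLinearHomotopy_shift_const.ne_zero (f u) 0)
    simp
  have e3 : c (.ofPath (isLinearHomotopy_shift_const.finish f)) = 0 := by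
    refine (congrArg c ?_).trans (cocycle_const hc (isLinearHomotopy_shift_const.finish f 0))
    ext t : 1
    refine normalize_congr ?_ (isLinearHomotopy_shift_const.ne_zero (f _) 1) (isLinearHomotopy_shift_const.ne_zero (f 0) 1)
    simp
  rw [e1, e2, h2, e3, zero_add] at h1
  rw [h1, potential, potential]
  abel

theorem coboundary_potential {c : SingularCochain InfiniteSphere 1} (hc : coboundary _ 1 c = 0) :
    coboundary _ 0 (fun s => potential c (s (stdSimplex.vertex 0))) = c := by
  funext s
  conv_rhs => rw [← s.ofPath_toPath, cocycle_ofPath hc, s.toPath_zero, s.toPath_one]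
  rw [coboundary_apply, Fin.sum_univ_two, add_comm]
  congr 2 <;> exact congrArg s (stdSimplex.map_vertex _ _)

/-- A zero-cocycle of the infinite sphere is constant. -/
theorem zero_cocycle_eq {h : SingularCochain InfiniteSphere 0} (hh : coboundary _ 0 h = 0)
    (s t : SingularSimplex InfiniteSphere 0) : h s = h t := by
  have hp : ∀ f : C(I, InfiniteSphere), h (.const _ (f 0)) = h (.const _ (f 1)) := by
    intro f
    have h1 := congrFun hh (.ofPath f)
    rw [coboundary_apply, Fin.sum_univ_two, add_comm] at h1
    refine chain_eq_of_add_eq_zero (Eq.trans ?_ h1)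
    congr 2
    all_goals
      ext t : 1
      refine congrArg f (Subtype.ext ?_)
      change _ = (stdSimplex.map _ t : stdSimplex ℝ (Fin 2)) 1
      have ht : t 0 = 1 := by
        have := t.2.2
        rwa [Fin.sum_univ_one] at this
      rw [stdSimplex.map_apply, Fin.sum_univ_one, ht]
      simp
  have hx : ∀ x, h (.const _ x) = h (.const _ (normalize (Finsupp.single 0 1) (by simp))) := by
    intro x
    have h1 := hp (isLinearHomotopy_shift.track x)
    have h2 := hp (isLinearHomotopy_shift_const.track x)
    have e1 : isLinearHomotopy_shift.track x 0 = x := by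
      refine Eq.trans (normalize_congr ?_ (isLinearHomotopy_shift.ne_zero x 0) (ne_zero _))
        (normalize_coe x (ne_zero _))
      simp
    have e2 : isLinearHomotopy_shift.track x 1 = isLinearHomotopy_shift_const.track x 0 := by
      refine normalize_congr ?_ (isLinearHomotopy_shift.ne_zero x 1) (isLinearHomotopy_shift_const.ne_zero x 0)
      simp
    have e3 : isLinearHomotopy_shift_const.track x 1 =
        normalize (Finsupp.single 0 1) (by simp) := by
      refine normalize_congr ?_ (isLinearHomotopy_shift_const.ne_zero x 1) (by simp)
      simp
    rw [e1, e2, h2, e3] at h1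
    exact h1
  have hs : ∀ s : SingularSimplex InfiniteSphere 0, s = .const _ (s (stdSimplex.vertex 0)) := by
    intro s
    ext t : 1
    exact congrArg s (Subsingleton.elim _ _)
  rw [hs s, hs t, hx, hx (t _)]

end InfiniteSphere

/-- The Stiefel-Whitney class is represented by a cocycle whose lift is the coboundary of a
function that changes under the involution. -/
theorem IsStiefelWhitneyClass.exists_representative {X : Type*} [TopologicalSpace X] [MulAction Z2 X]
    [ContinuousConstSMul Z2 X] [IsCancelSMul Z2 X] {w : SingularCohomology (OrbitSpace X) 1}
    (hw : IsStiefelWhitneyClass X w) :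
    ∃ (c : cocycles (OrbitSpace X) 1) (g : SingularCochain X 0),
      w = Submodule.Quotient.mk c ∧ (∀ s : SingularSimplex X 0, g ((Z2.invol X).comp s) = g s + 1) ∧
        coboundary X 0 g = cochainPullback (OrbitSpace.proj X) 1 c.1 := by
  obtain ⟨φ, hφ, a, ha, rfl⟩ := hw
  obtain ⟨c, rfl⟩ := Submodule.Quotient.mk_surjective _ a
  set π := OrbitSpace.proj InfiniteSphere
  set τ := Z2.invol InfiniteSphere
  have hc : coboundary _ 1 (cochainPullback π 1 c.1) = 0 :=
    cochainPullback_mem_cocycles π 1 c.1 c.2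
  set γ : SingularCochain InfiniteSphere 0 :=
    fun s => InfiniteSphere.potential (cochainPullback π 1 c.1) (s (stdSimplex.vertex 0)) with hγ
  have hδ : coboundary _ 0 γ = cochainPullback π 1 c.1 := InfiniteSphere.coboundary_potential hc
  -- The lifted cocycle is invariant, so γ and its translate have the same coboundary and differ by
  -- a constant.
  have hsum : coboundary _ 0 (γ + cochainPullback τ 0 γ) = 0 := by
    rw [map_add, ← cochainPullback_coboundary, hδ]
    have : cochainPullback τ (0 + 1) (cochainPullback π 1 c.1) = cochainPullback π 1 c.1 := by
      funext s
      refine congrArg c.1 ?_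
      ext t : 1
      exact OrbitSpace.proj_invol (s t)
    rw [this, chain_add_self]
  -- If the constant were 0, then γ would be invariant and would descend to the projective space,
  -- making a zero. So the constant is 1.
  have hτ : ∀ s : SingularSimplex InfiniteSphere 0, γ (τ.comp s) = γ s + 1 := by
    by_contra! hcon
    obtain ⟨s₀, hs₀⟩ := hcon
    refine ha ((Submodule.Quotient.mk_eq_zero _).2 ?_)
    refine OrbitSpace.mem_coboundaries c.1 γ hδ fun s => ?_
    have h1 := InfiniteSphere.zero_cocycle_eq hsum s s₀
    change γ s + γ (τ.comp s) = γ s₀ + γ (τ.comp s₀) at h1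
    change γ (τ.comp s) = γ s
    generalize γ s = x at *
    generalize γ (τ.comp s) = y at *
    generalize γ s₀ = x' at *
    generalize γ (τ.comp s₀) = y' at *
    revert x y x' y'
    decide
  refine ⟨⟨cochainPullback (OrbitSpace.map φ hφ) 1 c.1, cochainPullback_mem_cocycles _ _ _ c.2⟩,
    cochainPullback ⟨φ, hφ⟩ 0 γ, rfl, fun s => ?_, ?_⟩
  · refine Eq.trans (congrArg γ ?_) (hτ _)
    ext t : 1
    exact map_smul φ _ (s t)
  · rw [← cochainPullback_coboundary, hδ]
    rfl

end

/-! ### Ordered chains of products of simplices -/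

/-- Formal sums modulo 2 of pairs of vertex lists. -/
abbrev ListPairChain (V : Type*) : Type _ := (List V × List V) →₀ ZMod 2

namespace ListPairChain

variable {V : Type*}

/-- The boundary of a vertex list in the (unaugmented) ordered chain complex. -/
noncomputable def bdList : List V → (List V →₀ ZMod 2)
  | [] => 0
  | [_] => 0
  | x :: y :: l => Finsupp.single (y :: l) 1 +
      Finsupp.lmapDomain (ZMod 2) (ZMod 2) (List.cons x) (bdList (y :: l)) +
      (if (y :: l).length = 1 then Finsupp.single [x] 1 else 0)

/-- The last summand is the face opposite to a single remaining vertex. The recursion misses it,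
because the unaugmented boundary of a vertex is 0 and not the empty list. -/
theorem bdList_cons (x : V) {l : List V} (hl : l ≠ []) : bdList (x :: l) = Finsupp.single l 1 +
      Finsupp.lmapDomain (ZMod 2) (ZMod 2) (List.cons x) (bdList l) +
      (if l.length = 1 then Finsupp.single [x] 1 else 0) := by
  cases l with
  | nil => exact absurd rfl hl
  | cons y l => rfl

theorem bdList_mem (l : List V) :
    bdList l ∈ chainsOn {l' | l' ≠ [] ∧ l'.length + 1 = l.length ∧ l' ⊆ l} := by
  induction l with
  | nil => exact Submodule.zero_mem _
  | cons x l ih =>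
    by_cases hl : l = []
    · subst hl; exact Submodule.zero_mem _
    rw [bdList_cons x hl]
    refine Submodule.add_mem _ (Submodule.add_mem _ (single_mem_chainsOn ⟨hl, by simp, by simp⟩)
      (map_mem_of_chainsOn _ ?_ ih)) ?_
    · rintro l' ⟨h1, h2, h3⟩
      rw [Finsupp.lmapDomain_apply, Finsupp.mapDomain_single]
      refine single_mem_chainsOn ⟨by simp, by simp [h2], ?_⟩
      exact List.cons_subset_cons x h3
    · split_ifs with h
      · exact single_mem_chainsOn ⟨by simp, by simp [h], by simp⟩
      · exact Submodule.zero_mem _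

/-- The number modulo 2 of lists of length one. -/
noncomputable def countOne (V : Type*) : (List V →₀ ZMod 2) →ₗ[ZMod 2] ZMod 2 :=
  Finsupp.linearCombination (ZMod 2) fun l => if l.length = 1 then 1 else 0

theorem countOne_single (l : List V) :
    countOne V (Finsupp.single l 1) = if l.length = 1 then 1 else 0 := by
  simp [countOne]

theorem countOne_bdList (l : List V) : countOne V (bdList l) = 0 := by
  cases l with
  | nil => exact map_zero _
  | cons x l =>
    by_cases hl : l = []
    · subst hl; exact map_zero _
    have h : countOne V (Finsupp.lmapDomain (ZMod 2) (ZMod 2) (List.cons x) (bdList l)) = 0 := by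
      refine map_mem_of_chainsOn (N := ⊥) (countOne V ∘ₗ _) ?_ (bdList_mem l)
      rintro l' ⟨h1, -, -⟩
      rw [Submodule.mem_bot, LinearMap.comp_apply, Finsupp.lmapDomain_apply,
        Finsupp.mapDomain_single, countOne_single, if_neg]
      simpa using h1
    rw [bdList_cons x hl, map_add, map_add, h, countOne_single, add_zero]
    split_ifs with h1
    · rw [countOne_single, if_pos (by simp)]
      exact chain_add_self _
    · rw [map_zero, add_zero]

/-- The linear extension of `bdList`. -/
noncomputable def bdLists (V : Type*) : (List V →₀ ZMod 2) →ₗ[ZMod 2] (List V →₀ ZMod 2) :=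
  Finsupp.linearCombination (ZMod 2) bdList

theorem bdLists_single (l : List V) : bdLists V (Finsupp.single l 1) = bdList l := by
  simp [bdLists]

/-- The cone formula without augmentation: the count of vertices enters as a correction term at the
apex. -/
theorem bdLists_cons (x : V) {A : Set (List V)} (hA : ∀ l ∈ A, l ≠ []) {z : List V →₀ ZMod 2}
    (hz : z ∈ chainsOn A) :
    bdLists V (Finsupp.lmapDomain (ZMod 2) (ZMod 2) (List.cons x) z) =
      z + Finsupp.lmapDomain (ZMod 2) (ZMod 2) (List.cons x) (bdLists V z) +
        countOne V z • Finsupp.single [x] 1 := by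
  refine map_eq_of_chainsOn (bdLists V ∘ₗ Finsupp.lmapDomain (ZMod 2) (ZMod 2) (List.cons x))
    (LinearMap.id + Finsupp.lmapDomain (ZMod 2) (ZMod 2) (List.cons x) ∘ₗ bdLists V +
      (countOne V).smulRight (Finsupp.single [x] 1)) ?_ hz
  intro l hl
  simp only [LinearMap.comp_apply, LinearMap.add_apply, LinearMap.id_apply,
    LinearMap.smulRight_apply, Finsupp.lmapDomain_apply, Finsupp.mapDomain_single, bdLists_single,
    countOne_single, bdList_cons x (hA l hl), ite_smul, one_smul, zero_smul]

theorem bdLists_bdList (l : List V) : bdLists V (bdList l) = 0 := by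
  induction l with
  | nil => exact map_zero _
  | cons x l ih =>
    by_cases hl : l = []
    · subst hl; exact map_zero _
    have h : bdLists V (if l.length = 1 then Finsupp.single [x] 1 else 0) = 0 := by
      split_ifs
      · rw [bdLists_single]; rfl
      · exact map_zero _
    rw [bdList_cons x hl, map_add, map_add, h, bdLists_cons x (fun _ h => h.1) (bdList_mem l), ih,
      countOne_bdList, bdLists_single, map_zero, add_zero, zero_smul, add_zero, add_zero,
      chain_add_self]

/-- The product of a chain of lists with a list. -/
noncomputable def mulRight (b : List V) : (List V →₀ ZMod 2) →ₗ[ZMod 2] ListPairChain V :=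
  Finsupp.lmapDomain (ZMod 2) (ZMod 2) fun a => (a, b)

/-- The product of a list with a chain of lists. -/
noncomputable def mulLeft (a : List V) : (List V →₀ ZMod 2) →ₗ[ZMod 2] ListPairChain V :=
  Finsupp.lmapDomain (ZMod 2) (ZMod 2) fun b => (a, b)

@[simp]
theorem mulRight_single (a b : List V) :
    mulRight b (Finsupp.single a 1) = Finsupp.single (a, b) 1 := by simp [mulRight]

@[simp]
theorem mulLeft_single (a b : List V) :
    mulLeft a (Finsupp.single b 1) = Finsupp.single (a, b) 1 := by simp [mulLeft]

/-- The boundary of the tensor product. -/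
noncomputable def bd (V : Type*) : ListPairChain V →ₗ[ZMod 2] ListPairChain V :=
  Finsupp.linearCombination (ZMod 2) fun p => mulRight p.2 (bdList p.1) + mulLeft p.1 (bdList p.2)

theorem bd_single (p : List V × List V) :
    bd V (Finsupp.single p 1) = mulRight p.2 (bdList p.1) + mulLeft p.1 (bdList p.2) := by
  simp [bd]

/-- The pairs of nonempty lists that are faces of codimension one. -/
def faces (p : List V × List V) : Set (List V × List V) :=
  {q | q.1 ≠ [] ∧ q.2 ≠ [] ∧ q.1.length + q.2.length + 1 = p.1.length + p.2.length ∧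
    q.1 ⊆ p.1 ∧ q.2 ⊆ p.2}

theorem bd_single_mem {p : List V × List V} (h1 : p.1 ≠ []) (h2 : p.2 ≠ []) :
    bd V (Finsupp.single p 1) ∈ chainsOn (faces p) := by
  rw [bd_single]
  refine Submodule.add_mem _ (map_mem_of_chainsOn _ ?_ (bdList_mem p.1))
    (map_mem_of_chainsOn _ ?_ (bdList_mem p.2))
  · rintro a ⟨ha, hl, hs⟩
    rw [mulRight_single]
    exact single_mem_chainsOn ⟨ha, h2, by simp only; omega, hs, fun _ h => h⟩
  · rintro a ⟨ha, hl, hs⟩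
    rw [mulLeft_single]
    exact single_mem_chainsOn ⟨h1, ha, by simp only; omega, fun _ h => h, hs⟩

theorem bd_mulRight (b : List V) (z : List V →₀ ZMod 2) : bd V (mulRight b z) =
    mulRight b (bdLists V z) + Finsupp.linearCombination (ZMod 2)
      (fun a => mulLeft a (bdList b)) z := by
  refine DFunLike.congr_fun (f := bd V ∘ₗ mulRight b) (g := mulRight b ∘ₗ bdLists V +
    Finsupp.linearCombination (ZMod 2) (fun a => mulLeft a (bdList b))) ?_ z
  refine Finsupp.lhom_ext' fun v => LinearMap.ext_ring ?_
  simp [bd_single, bdLists_single]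

theorem bd_mulLeft (a : List V) (z : List V →₀ ZMod 2) : bd V (mulLeft a z) =
    Finsupp.linearCombination (ZMod 2) (fun b => mulRight b (bdList a)) z +
      mulLeft a (bdLists V z) := by
  refine DFunLike.congr_fun (f := bd V ∘ₗ mulLeft a) (g := Finsupp.linearCombination (ZMod 2)
    (fun b => mulRight b (bdList a)) + mulLeft a ∘ₗ bdLists V) ?_ z
  refine Finsupp.lhom_ext' fun v => LinearMap.ext_ring ?_
  simp [bd_single, bdLists_single]

theorem linearCombination_mul_comm (z w : List V →₀ ZMod 2) :
    Finsupp.linearCombination (ZMod 2) (fun a => mulLeft a w) z =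
      Finsupp.linearCombination (ZMod 2) (fun b => mulRight b z) w := by
  have h1 : ∀ a : List V, mulLeft a w =
      Finsupp.linearCombination (ZMod 2) (fun b => Finsupp.single (a, b) (1 : ZMod 2)) w := by
    intro a
    refine DFunLike.congr_fun (f := mulLeft a) ?_ w
    refine Finsupp.lhom_ext' fun v => LinearMap.ext_ring ?_
    simp
  have h2 : ∀ b : List V, mulRight b z =
      Finsupp.linearCombination (ZMod 2) (fun a => Finsupp.single (a, b) (1 : ZMod 2)) z := by
    intro b
    refine DFunLike.congr_fun (f := mulRight b) ?_ z
    refine Finsupp.lhom_ext' fun v => LinearMap.ext_ring ?_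
    simp
  simp only [h1, h2, Finsupp.linearCombination_apply, Finsupp.sum, Finset.smul_sum]
  rw [Finset.sum_comm]
  simp only [smul_smul, mul_comm]

theorem bd_bd_single (p : List V × List V) : bd V (bd V (Finsupp.single p 1)) = 0 := by
  rw [bd_single, map_add, bd_mulRight, bd_mulLeft, bdLists_bdList, bdLists_bdList, map_zero,
    map_zero, zero_add, add_zero, linearCombination_mul_comm, chain_add_self]

/-- The contraction of the product of two full simplices to the vertex `(x, y)`. -/
noncomputable def contract (x y : V) : ListPairChain V →ₗ[ZMod 2] ListPairChain V :=
  Finsupp.linearCombination (ZMod 2) fun p => Finsupp.single (x :: p.1, p.2) 1 +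
    (if p.1.length = 1 then Finsupp.single ([x], y :: p.2) 1 else 0)

theorem contract_single (x y : V) (p : List V × List V) :
    contract x y (Finsupp.single p 1) = Finsupp.single (x :: p.1, p.2) 1 +
    (if p.1.length = 1 then Finsupp.single ([x], y :: p.2) 1 else 0) := by
  simp [contract]

theorem contract_mulRight (x y : V) (b : List V) (z : List V →₀ ZMod 2) :
    contract x y (mulRight b z) =
      mulRight b (Finsupp.lmapDomain (ZMod 2) (ZMod 2) (List.cons x) z) +
        countOne V z • Finsupp.single ([x], y :: b) 1 := by
  refine DFunLike.congr_fun (f := contract x y ∘ₗ mulRight b) (g := mulRight b ∘ₗ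
    Finsupp.lmapDomain (ZMod 2) (ZMod 2) (List.cons x) +
    (countOne V).smulRight (Finsupp.single ([x], y :: b) 1)) ?_ z
  refine Finsupp.lhom_ext' fun v => LinearMap.ext_ring ?_
  simp [contract_single, countOne_single]

theorem contract_mulLeft (x y : V) (a : List V) (z : List V →₀ ZMod 2) :
    contract x y (mulLeft a z) = mulLeft (x :: a) z +
      (if a.length = 1 then mulLeft [x] (Finsupp.lmapDomain (ZMod 2) (ZMod 2) (List.cons y) z)
        else 0) := by
  split_ifs with h
  · refine DFunLike.congr_fun (f := contract x y ∘ₗ mulLeft a) (g := mulLeft (x :: a) +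
      mulLeft [x] ∘ₗ Finsupp.lmapDomain (ZMod 2) (ZMod 2) (List.cons y)) ?_ z
    refine Finsupp.lhom_ext' fun v => LinearMap.ext_ring ?_
    simp [contract_single, h]
  · rw [add_zero]
    refine DFunLike.congr_fun (f := contract x y ∘ₗ mulLeft a) (g := mulLeft (x :: a)) ?_ z
    refine Finsupp.lhom_ext' fun v => LinearMap.ext_ring ?_
    simp [contract_single, h]

/-- First the first factor is coned to x. This ends in the slice over x, which only cells whose
first factor is a vertex reach, and there the second factor is coned to y. The result is a chain
homotopy from the identity to the projection to (x, y). -/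
theorem bd_contract_single (x y : V) {p : List V × List V} (h1 : p.1 ≠ []) (h2 : p.2 ≠ []) :
    bd V (contract x y (Finsupp.single p 1)) + contract x y (bd V (Finsupp.single p 1)) =
      Finsupp.single p 1 + (if p.1.length = 1 ∧ p.2.length = 1 then Finsupp.single ([x], [y]) 1
        else 0) := by
  obtain ⟨a, b⟩ := p
  rw [contract_single, bd_single, map_add, map_add, contract_mulRight, contract_mulLeft,
    countOne_bdList, bd_single, bdList_cons x h1]
  simp only [map_add, mulRight_single]
  by_cases ha : a.length = 1
  · have hx : bdList [x] = (0 : List V →₀ ZMod 2) := rfl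
    simp only [ha, if_true, true_and, bd_single, bdList_cons y h2, map_add, mulLeft_single,
      mulRight_single, hx, map_zero]
    generalize mulRight b _ = u1
    generalize mulLeft (x :: a) _ = u2
    generalize mulLeft [x] (Finsupp.lmapDomain (ZMod 2) (ZMod 2) (List.cons y) (bdList b)) = u3
    generalize Finsupp.single (a, b) (1 : ZMod 2) = u4
    generalize Finsupp.single ([x], b) (1 : ZMod 2) = u5
    by_cases hb : b.length = 1
    · simp only [hb, if_true, mulLeft_single]
      generalize Finsupp.single ([x], [y]) (1 : ZMod 2) = u6
      calc _ = u4 + u6 + ((u1 + u1) + (u2 + u2) + (u3 + u3) + (u5 + u5)) := by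
            simp only [zero_smul]; abel
        _ = _ := by simp only [chain_add_self, add_zero]
    · simp only [hb, if_false, map_zero]
      calc _ = u4 + ((u1 + u1) + (u2 + u2) + (u3 + u3) + (u5 + u5)) := by
            simp only [zero_smul]; abel
        _ = _ := by simp only [chain_add_self, add_zero]
  · simp only [ha, if_false, false_and, map_zero]
    generalize mulRight b _ = u1
    generalize mulLeft (x :: a) _ = u2
    generalize Finsupp.single (a, b) (1 : ZMod 2) = u4
    calc _ = u4 + ((u1 + u1) + (u2 + u2)) := by simp only [zero_smul]; abel
      _ = _ := by simp only [chain_add_self, add_zero]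

/-- The exchange of the two factors. -/
noncomputable def swap (V : Type*) : ListPairChain V →ₗ[ZMod 2] ListPairChain V :=
  Finsupp.lmapDomain (ZMod 2) (ZMod 2) Prod.swap

@[simp]
theorem swap_single (p : List V × List V) :
    swap V (Finsupp.single p 1) = Finsupp.single p.swap 1 := by
  simp [swap]

theorem swap_swap (z : ListPairChain V) : swap V (swap V z) = z := by
  refine DFunLike.congr_fun (f := swap V ∘ₗ swap V) (g := LinearMap.id) ?_ z
  refine Finsupp.lhom_ext' fun v => LinearMap.ext_ring ?_
  simp

theorem swap_bd (z : ListPairChain V) : swap V (bd V z) = bd V (swap V z) := by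
  refine DFunLike.congr_fun (f := swap V ∘ₗ bd V) (g := bd V ∘ₗ swap V) ?_ z
  refine Finsupp.lhom_ext' fun p => LinearMap.ext_ring ?_
  have h1 : ∀ b : List V, swap V ∘ₗ mulRight b = mulLeft b := fun b =>
    Finsupp.lhom_ext' fun v => LinearMap.ext_ring (by simp)
  have h2 : ∀ b : List V, swap V ∘ₗ mulLeft b = mulRight b := fun b =>
    Finsupp.lhom_ext' fun v => LinearMap.ext_ring (by simp)
  simp only [LinearMap.comp_apply, Finsupp.lsingle_apply, bd_single, map_add, swap_single,
    Prod.fst_swap, Prod.snd_swap]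
  rw [← LinearMap.comp_apply, h1, ← LinearMap.comp_apply, h2, add_comm]

open Classical in
/-- The contraction to the vertex `p`, chosen compatibly with the exchange of the factors. -/
noncomputable def symmContract (p : V × V) : ListPairChain V →ₗ[ZMod 2] ListPairChain V :=
  if WellOrderingRel p.1 p.2 then contract p.1 p.2
  else swap V ∘ₗ contract p.2 p.1 ∘ₗ swap V

theorem wellOrderingRel_swap_iff {α : Type*} {a b : α} (h : a ≠ b) :
    WellOrderingRel b a ↔ ¬ WellOrderingRel a b := by
  constructor
  · exact fun h1 h2 => asymm h1 h2
  · intro h1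
    rcases trichotomous_of WellOrderingRel a b with h2 | h2 | h2
    · exact absurd h2 h1
    · exact absurd h2 h
    · exact h2

/-- Contracting the first factor before the second is not symmetric. Off the diagonal the well-order
singles out one pair in each orbit, and the other receives the conjugate contraction. -/
theorem symmContract_swap {p : V × V} (hp : p.1 ≠ p.2) (z : ListPairChain V) :
    symmContract p.swap (swap V z) = swap V (symmContract p z) := by
  have h := wellOrderingRel_swap_iff hp
  by_cases h1 : WellOrderingRel p.1 p.2
  · have h2 : ¬ WellOrderingRel p.swap.1 p.swap.2 := fun h2 => h.1 h2 h1
    rw [symmContract, if_neg h2, symmContract, if_pos h1]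
    simp [swap_swap]
  · have h2 : WellOrderingRel p.swap.1 p.swap.2 := h.2 h1
    rw [symmContract, if_pos h2, symmContract, if_neg h1]
    simp [swap_swap]

/-- The number modulo 2 of vertices. -/
noncomputable def countVertices (V : Type*) : ListPairChain V →ₗ[ZMod 2] ZMod 2 :=
  Finsupp.linearCombination (ZMod 2) fun p => if p.1.length = 1 ∧ p.2.length = 1 then 1 else 0

theorem countVertices_single (p : List V × List V) : countVertices V (Finsupp.single p 1) =
    if p.1.length = 1 ∧ p.2.length = 1 then 1 else 0 := by
  simp [countVertices]

theorem bd_symmContract (p : V × V) {A : Set (List V × List V)}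
    (hA : ∀ q ∈ A, q.1 ≠ [] ∧ q.2 ≠ []) {z : ListPairChain V} (hz : z ∈ chainsOn A) :
    bd V (symmContract p z) + symmContract p (bd V z) =
      z + countVertices V z • Finsupp.single ([p.1], [p.2]) 1 := by
  refine map_eq_of_chainsOn (bd V ∘ₗ symmContract p + symmContract p ∘ₗ bd V)
    (LinearMap.id + (countVertices V).smulRight (Finsupp.single ([p.1], [p.2]) 1)) ?_ hz
  intro q hq
  obtain ⟨h1, h2⟩ := hA q hq
  simp only [LinearMap.add_apply, LinearMap.comp_apply, LinearMap.id_apply,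
    LinearMap.smulRight_apply, countVertices_single, ite_smul, one_smul, zero_smul]
  by_cases hr : WellOrderingRel p.1 p.2
  · rw [symmContract, if_pos hr, bd_contract_single _ _ h1 h2]
  · rw [symmContract, if_neg hr]
    simp only [LinearMap.comp_apply]
    rw [← swap_bd, swap_bd (Finsupp.single q 1), ← map_add, swap_single,
      bd_contract_single _ _ (p := q.swap) h2 h1, map_add, swap_single, Prod.swap_swap]
    congr 1
    by_cases h : q.1.length = 1 ∧ q.2.length = 1
    · rw [if_pos h, if_pos ⟨h.2, h.1⟩, swap_single]; rfl
    · rw [if_neg h, if_neg fun h' => h ⟨h'.2, h'.1⟩, map_zero]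

/-- Pairs of nonempty lists of total length `n` with entries in two sets of vertices. -/
def within (S T : Set V) (n : ℕ) : Set (List V × List V) :=
  {p | p.1 ≠ [] ∧ p.2 ≠ [] ∧ p.1.length + p.2.length = n ∧ (∀ x ∈ p.1, x ∈ S) ∧ ∀ x ∈ p.2, x ∈ T}

theorem symmContract_mem {S T : Set V} {n : ℕ} {p : V × V} (h1 : p.1 ∈ S) (h2 : p.2 ∈ T)
    {z : ListPairChain V} (hz : z ∈ chainsOn (within S T n)) :
    symmContract p z ∈ chainsOn (within S T (n + 1)) := by
  refine map_mem_of_chainsOn _ ?_ hz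
  rintro ⟨a, b⟩ ⟨ha, hb, hl, haS, hbT⟩
  simp only at ha hb hl haS hbT
  unfold symmContract
  split_ifs with h
  · rw [contract_single]
    refine Submodule.add_mem _ (single_mem_chainsOn ?_) ?_
    · exact ⟨by simp, hb, by simp only [List.length_cons]; omega, by simpa using ⟨h1, haS⟩, hbT⟩
    · split_ifs with h3
      · simp only at h3
        exact single_mem_chainsOn ⟨by simp, by simp,
          by simp only [List.length_cons, List.length_nil]; omega, by simpa using h1,
          by simpa using ⟨h2, hbT⟩⟩
      · exact Submodule.zero_mem _
  · simp only [LinearMap.comp_apply, swap_single, contract_single, map_add,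
      Prod.swap_prod_mk]
    refine Submodule.add_mem _ (single_mem_chainsOn ?_) ?_
    · exact ⟨ha, by simp, by simp only [List.length_cons]; omega, haS, by simpa using ⟨h2, hbT⟩⟩
    · split_ifs with h3
      · rw [swap_single]
        exact single_mem_chainsOn ⟨by simp, by simp,
          by simp only [Prod.swap_prod_mk, List.length_cons, List.length_nil]; omega,
          by simpa using ⟨h1, haS⟩, by simpa using h2⟩
      · rw [map_zero]; exact Submodule.zero_mem _

/-- The equivariant chain map from ordered simplices with vertices in `V × V` to products of
simplices. -/
noncomputable def ofTuples (V : Type*) :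
    (n : ℕ) → TupleChain (V × V) (n + 1) →ₗ[ZMod 2] ListPairChain V
  | 0 => Finsupp.linearCombination (ZMod 2) fun t => Finsupp.single ([(t 0).1], [(t 0).2]) 1
  | n + 1 => Finsupp.linearCombination (ZMod 2) fun t =>
      symmContract (t 0) (ofTuples V n (TupleChain.bd _ (n + 1) (Finsupp.single t 1)))

theorem ofTuples_single_zero (t : Fin 1 → V × V) :
    ofTuples V 0 (Finsupp.single t 1) = Finsupp.single ([(t 0).1], [(t 0).2]) 1 := by
  simp [ofTuples]

theorem ofTuples_single_succ {n : ℕ} (t : Fin (n + 2) → V × V) :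
    ofTuples V (n + 1) (Finsupp.single t 1) =
      symmContract (t 0) (ofTuples V n (TupleChain.bd _ (n + 1) (Finsupp.single t 1))) := by
  simp [ofTuples]

theorem ofTuples_mem {S T : Set V} : ∀ (n : ℕ) (z : TupleChain (V × V) (n + 1)),
    z ∈ chainsOn (TupleChain.tuplesIn (S ×ˢ T) (n + 1)) →
      ofTuples V n z ∈ chainsOn (within S T (n + 2)) := by
  intro n
  induction n with
  | zero =>
    intro z hz
    refine map_mem_of_chainsOn _ (fun t ht => ?_) hz
    rw [ofTuples_single_zero]
    exact single_mem_chainsOn ⟨by simp, by simp, rfl, by simpa using (ht 0).1,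
      by simpa using (ht 0).2⟩
  | succ n ih =>
    intro z hz
    refine map_mem_of_chainsOn _ (fun t ht => ?_) hz
    rw [ofTuples_single_succ]
    refine symmContract_mem (ht 0).1 (ht 0).2 (ih _ (TupleChain.bd_mem_tuplesIn
      (single_mem_chainsOn ht)))

/-- Contracting the image of the boundary to the leading pair gives a chain with that boundary,
except for the vertex count in the homotopy formula, which has to be seen to vanish. -/
theorem bd_ofTuples : ∀ (n : ℕ) (z : TupleChain (V × V) (n + 2)),
    bd V (ofTuples V (n + 1) z) = ofTuples V n (TupleChain.bd _ (n + 1) z) := by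
  intro n
  have hA : ∀ n, ∀ q ∈ within (Set.univ : Set V) Set.univ n, q.1 ≠ [] ∧ q.2 ≠ [] :=
    fun n q hq => ⟨hq.1, hq.2.1⟩
  have hmem : ∀ (n : ℕ) (z : TupleChain (V × V) (n + 1)),
      ofTuples V n z ∈ chainsOn (within Set.univ Set.univ (n + 2)) := fun n z =>
    ofTuples_mem n z (Finsupp.supported_mono (s := Set.univ) (fun v _ i => ⟨trivial, trivial⟩)
      (by simp))
  have hbd0 : ∀ z : TupleChain (V × V) 1, bd V (ofTuples V 0 z) = 0 := by
    intro z
    refine DFunLike.congr_fun (f := bd V ∘ₗ ofTuples V 0) (g := 0) ?_ z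
    refine Finsupp.lhom_ext' fun t => LinearMap.ext_ring ?_
    simp [ofTuples_single_zero, bd_single, bdList]
  induction n with
  | zero =>
    intro z
    refine DFunLike.congr_fun (f := bd V ∘ₗ ofTuples V 1) (g := ofTuples V 0 ∘ₗ TupleChain.bd _ 1)
      ?_ z
    refine Finsupp.lhom_ext' fun t => LinearMap.ext_ring ?_
    simp only [LinearMap.comp_apply, Finsupp.lsingle_apply]
    rw [ofTuples_single_succ]
    have h := bd_symmContract (t 0) (hA 2)
      (hmem 0 (TupleChain.bd _ 1 (Finsupp.single t 1)))
    rw [hbd0, map_zero, add_zero] at h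
    rw [h]
    have : countVertices V (ofTuples V 0 (TupleChain.bd _ 1 (Finsupp.single t 1))) = 0 := by
      rw [TupleChain.bd_single, Fin.sum_univ_two, map_add, ofTuples_single_zero,
        ofTuples_single_zero, map_add, countVertices_single, countVertices_single, if_pos (by simp),
        if_pos (by simp)]
      exact chain_add_self _
    rw [this, zero_smul, add_zero]
  | succ n ih =>
    intro z
    refine DFunLike.congr_fun (f := bd V ∘ₗ ofTuples V (n + 2))
      (g := ofTuples V (n + 1) ∘ₗ TupleChain.bd _ (n + 2)) ?_ z
    refine Finsupp.lhom_ext' fun t => LinearMap.ext_ring ?_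
    simp only [LinearMap.comp_apply, Finsupp.lsingle_apply]
    rw [ofTuples_single_succ]
    have hm := hmem (n + 1) (TupleChain.bd _ (n + 2) (Finsupp.single t 1))
    have h := bd_symmContract (t 0) (hA (n + 3)) hm
    rw [ih, TupleChain.bd_bd, map_zero, map_zero, add_zero] at h
    rw [h]
    -- All pairs occurring here have total length n + 3, so none consists of two single vertices.
    have : countVertices V (ofTuples V (n + 1)
        (TupleChain.bd _ (n + 2) (Finsupp.single t 1))) = 0 := by
      refine map_mem_of_chainsOn (N := ⊥) (countVertices V) ?_ hm
      rintro q ⟨-, -, hl, -, -⟩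
      rw [Submodule.mem_bot, countVertices_single, if_neg]
      omega
    rw [this, zero_smul, add_zero]

theorem ofTuples_swap : ∀ (n : ℕ) (z : TupleChain (V × V) (n + 1)),
    z ∈ chainsOn (TupleChain.tuplesIn {p : V × V | p.1 ≠ p.2} (n + 1)) →
    ofTuples V n (TupleChain.map Prod.swap (n + 1) z) = swap V (ofTuples V n z) := by
  intro n
  induction n with
  | zero =>
    intro z hz
    refine map_eq_of_chainsOn (ofTuples V 0 ∘ₗ TupleChain.map Prod.swap 1)
      (swap V ∘ₗ ofTuples V 0) (fun t ht => ?_) hz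
    simp [ofTuples_single_zero]
  | succ n ih =>
    intro z hz
    refine map_eq_of_chainsOn (ofTuples V (n + 1) ∘ₗ TupleChain.map Prod.swap (n + 2))
      (swap V ∘ₗ ofTuples V (n + 1)) (fun t ht => ?_) hz
    simp only [LinearMap.comp_apply]
    rw [TupleChain.map_single, ofTuples_single_succ, ofTuples_single_succ,
      ← TupleChain.map_single, ← TupleChain.map_bd, ih, ← symmContract_swap (ht 0)]
    · rfl
    · exact TupleChain.bd_mem_tuplesIn (single_mem_chainsOn ht)

end ListPairChain

/-! ### Equivariant chain maps by acyclic carriers -/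

namespace ListPairChain

variable {V E : Type*}

open Classical in
/-- A chain in `C` with boundary `z`, if there is one. -/
noncomputable def filling {n : ℕ} (C : Set (Fin (n + 1) → E)) (z : TupleChain E n) :
    TupleChain E (n + 1) :=
  if h : ∃ y ∈ chainsOn C, TupleChain.bd E n y = z then h.choose else 0

theorem filling_spec {n : ℕ} {C : Set (Fin (n + 1) → E)} {z : TupleChain E n}
    (h : ∃ y ∈ chainsOn C, TupleChain.bd E n y = z) :
    filling C z ∈ chainsOn C ∧ TupleChain.bd E n (filling C z) = z := by
  rw [filling, dif_pos h]
  exact h.choose_spec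

open Classical in
/-- The equivariant chain map obtained by choosing fillings. -/
noncomputable def carrierMap (σ : E → E) (C : List V × List V → (n : ℕ) → Set (Fin n → E))
    (pt : List V × List V → E) : (n : ℕ) → ListPairChain V →ₗ[ZMod 2] TupleChain E (n + 1)
  | 0 => Finsupp.linearCombination (ZMod 2) fun p => Finsupp.single (fun _ => pt p) 1
  | n + 1 => Finsupp.linearCombination (ZMod 2) fun p =>
      if WellOrderingRel p.1 p.2 then
        filling (C p (n + 2)) (carrierMap σ C pt n (bd V (Finsupp.single p 1)))
      else TupleChain.map σ (n + 2)
        (filling (C p.swap (n + 2)) (carrierMap σ C pt n (bd V (Finsupp.single p.swap 1))))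

/-- The boundary of an edge has two ends. This lets the carrier construction start in dimension one,
where a filling exists only for cycles of augmentation zero. -/
theorem countVertices_bd {p : List V × List V} : countVertices V (bd V (Finsupp.single p 1)) = 0 := by
  have h1 : ∀ (b : List V) (z : List V →₀ ZMod 2), countOne V z = 0 →
      countVertices V (mulRight b z) = 0 := by
    intro b z hz
    by_cases hb : b.length = 1
    · rw [← hz]
      refine DFunLike.congr_fun (f := countVertices V ∘ₗ mulRight b) (g := countOne V) ?_ z
      refine Finsupp.lhom_ext' fun v => LinearMap.ext_ring ?_
      simp [countVertices_single, countOne_single, hb]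
    · refine DFunLike.congr_fun (f := countVertices V ∘ₗ mulRight b) (g := 0) ?_ z
      refine Finsupp.lhom_ext' fun v => LinearMap.ext_ring ?_
      simp [countVertices_single, hb]
  have h2 : ∀ (b : List V) (z : List V →₀ ZMod 2), countOne V z = 0 →
      countVertices V (mulLeft b z) = 0 := by
    intro b z hz
    by_cases hb : b.length = 1
    · rw [← hz]
      refine DFunLike.congr_fun (f := countVertices V ∘ₗ mulLeft b) (g := countOne V) ?_ z
      refine Finsupp.lhom_ext' fun v => LinearMap.ext_ring ?_
      simp [countVertices_single, countOne_single, hb]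
    · refine DFunLike.congr_fun (f := countVertices V ∘ₗ mulLeft b) (g := 0) ?_ z
      refine Finsupp.lhom_ext' fun v => LinearMap.ext_ring ?_
      simp [countVertices_single, hb]
  rw [bd_single, map_add, h1 _ _ (countOne_bdList _), h2 _ _ (countOne_bdList _), add_zero]

variable {σ : E → E} {C : List V × List V → (n : ℕ) → Set (Fin n → E)} {pt : List V × List V → E}

theorem carrierMap_zero (p : List V × List V) :
    carrierMap σ C pt 0 (Finsupp.single p 1) = Finsupp.single (fun _ => pt p) 1 := by
  simp [carrierMap]

theorem carrierMap_succ_of_rel (n : ℕ) {p : List V × List V} (h : WellOrderingRel p.1 p.2) :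
    carrierMap σ C pt (n + 1) (Finsupp.single p 1) =
      filling (C p (n + 2)) (carrierMap σ C pt n (bd V (Finsupp.single p 1))) := by
  simp [carrierMap, h]

theorem carrierMap_succ_of_not_rel (n : ℕ) {p : List V × List V} (h : ¬ WellOrderingRel p.1 p.2) :
    carrierMap σ C pt (n + 1) (Finsupp.single p 1) = TupleChain.map σ (n + 2)
      (filling (C p.swap (n + 2)) (carrierMap σ C pt n (bd V (Finsupp.single p.swap 1)))) := by
  simp [carrierMap, h]

theorem map_map_of_involutive (hσ : ∀ x, σ (σ x) = x) {n : ℕ} (z : TupleChain E n) :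
    TupleChain.map σ n (TupleChain.map σ n z) = z := by
  refine DFunLike.congr_fun (f := TupleChain.map σ n ∘ₗ TupleChain.map σ n)
    (g := LinearMap.id) ?_ z
  refine Finsupp.lhom_ext' fun v => LinearMap.ext_ring ?_
  simp only [LinearMap.comp_apply, Finsupp.lsingle_apply, TupleChain.map_single,
    LinearMap.id_apply]
  congr 1
  funext i
  exact hσ _

/-- An equivariant acyclic carrier, up to dimension `d`. -/
structure IsAcyclicCarrier (σ : E → E) (C : List V × List V → (n : ℕ) → Set (Fin n → E))
    (pt : List V × List V → E) (valid : Set (List V × List V)) (d : ℕ) : Prop where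
  involutive : ∀ x, σ (σ x) = x
  mem_faces : ∀ p ∈ valid, ∀ q ∈ faces p, q ∈ valid
  swap_mem : ∀ p ∈ valid, p.swap ∈ valid
  ne_nil : ∀ p ∈ valid, p.1 ≠ [] ∧ p.2 ≠ []
  ne : ∀ p ∈ valid, p.1 ≠ p.2
  mono : ∀ p ∈ valid, ∀ q ∈ faces p, ∀ n, C q n ⊆ C p n
  equivariant : ∀ p ∈ valid, ∀ n, ∀ v ∈ C p n, σ ∘ v ∈ C p.swap n
  pt_mem : ∀ p ∈ valid, p.1.length + p.2.length = 2 → (fun _ => pt p) ∈ C p 1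
  pt_swap : ∀ p ∈ valid, pt p.swap = σ (pt p)
  exists_filling : ∀ p ∈ valid, ∀ n < d, p.1.length + p.2.length = n + 3 →
    ∀ z ∈ chainsOn (C p (n + 1)), TupleChain.bd E n z = 0 →
      ∃ y ∈ chainsOn (C p (n + 2)), TupleChain.bd E (n + 1) y = z

/-! ### Existence of the equivariant chain map. -/

namespace IsAcyclicCarrier

variable {valid : Set (List V × List V)} {d : ℕ} (h : IsAcyclicCarrier σ C pt valid d)
include h

/-- One induction on dimension proves support and equivariance in dimension n, that the prescribed
boundary in dimension n + 1 is a cycle, and hence that the chosen filling does its job. Total length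
n + 2 means dimension n. -/
theorem carrierMap_aux : ∀ n ≤ d,
    (∀ p ∈ valid, p.1.length + p.2.length = n + 2 →
      carrierMap σ C pt n (Finsupp.single p 1) ∈ chainsOn (C p (n + 1)) ∧
      carrierMap σ C pt n (Finsupp.single p.swap 1) =
        TupleChain.map σ (n + 1) (carrierMap σ C pt n (Finsupp.single p 1))) ∧
    (∀ p ∈ valid, p.1.length + p.2.length = n + 3 →
      TupleChain.bd E n (carrierMap σ C pt n (bd V (Finsupp.single p 1))) = 0) ∧
    (n + 1 ≤ d → ∀ p ∈ valid, p.1.length + p.2.length = n + 3 →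
      carrierMap σ C pt (n + 1) (Finsupp.single p 1) ∈ chainsOn (C p (n + 2)) ∧
      TupleChain.bd E (n + 1) (carrierMap σ C pt (n + 1) (Finsupp.single p 1)) =
        carrierMap σ C pt n (bd V (Finsupp.single p 1))) := by
  intro n
  have hfaces : ∀ (n : ℕ) (p : List V × List V), p ∈ valid → p.1.length + p.2.length = n + 3 →
      ∀ q ∈ faces p, q ∈ valid ∧ q.1.length + q.2.length = n + 2 := fun n p hp hl q hq =>
    ⟨h.mem_faces p hp q hq, by have := hq.2.2.1; omega⟩
  have hbdm : ∀ p ∈ valid, bd V (Finsupp.single p 1) ∈ chainsOn (faces p) := fun p hp =>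
    bd_single_mem (h.ne_nil p hp).1 (h.ne_nil p hp).2
  have step : ∀ n,
      (∀ p ∈ valid, p.1.length + p.2.length = n + 2 →
        carrierMap σ C pt n (Finsupp.single p 1) ∈ chainsOn (C p (n + 1)) ∧
        carrierMap σ C pt n (Finsupp.single p.swap 1) =
          TupleChain.map σ (n + 1) (carrierMap σ C pt n (Finsupp.single p 1))) →
      (∀ p ∈ valid, p.1.length + p.2.length = n + 3 →
        TupleChain.bd E n (carrierMap σ C pt n (bd V (Finsupp.single p 1))) = 0) →
      (n + 1 ≤ d → ∀ p ∈ valid, p.1.length + p.2.length = n + 3 →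
        carrierMap σ C pt (n + 1) (Finsupp.single p 1) ∈ chainsOn (C p (n + 2)) ∧
        TupleChain.bd E (n + 1) (carrierMap σ C pt (n + 1) (Finsupp.single p 1)) =
          carrierMap σ C pt n (bd V (Finsupp.single p 1))) := by
    intro n h1 h2 hn p hp hl
    have hfill : ∀ p ∈ valid, p.1.length + p.2.length = n + 3 → _ := fun p hp hl =>
      filling_spec (h.exists_filling p hp n hn hl (carrierMap σ C pt n (bd V (Finsupp.single p 1)))
        (map_mem_of_chainsOn _ (fun q hq => Finsupp.supported_mono (h.mono p hp q hq _)
          (h1 q (hfaces n p hp hl q hq).1 (hfaces n p hp hl q hq).2).1) (hbdm p hp)) (h2 p hp hl))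
    by_cases hr : WellOrderingRel p.1 p.2
    · rw [carrierMap_succ_of_rel n hr]
      exact hfill p hp hl
    · rw [carrierMap_succ_of_not_rel n hr]
      have hp' := h.swap_mem p hp
      obtain ⟨h3, h4⟩ := hfill p.swap hp' (by rw [Prod.fst_swap, Prod.snd_swap]; omega)
      refine ⟨TupleChain.map_mem (fun v hv => h.equivariant _ hp' _ v hv) h3, ?_⟩
      rw [← TupleChain.map_bd, h4, ← swap_single, ← swap_bd]
      -- The filling was chosen for the swapped cell. Equivariance one dimension lower identifies
      -- the transported boundary with the required one.
      have h5 : carrierMap σ C pt n (swap V (bd V (Finsupp.single p 1))) =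
          TupleChain.map σ (n + 1) (carrierMap σ C pt n (bd V (Finsupp.single p 1))) := by
        refine map_eq_of_chainsOn (carrierMap σ C pt n ∘ₗ swap V)
          (TupleChain.map σ (n + 1) ∘ₗ carrierMap σ C pt n) (fun q hq => ?_) (hbdm p hp)
        rw [LinearMap.comp_apply, swap_single]
        exact (h1 q (hfaces n p hp hl q hq).1 (hfaces n p hp hl q hq).2).2
      rw [h5, map_map_of_involutive h.involutive]
  induction n with
  | zero =>
    intro _
    have h1 : ∀ p ∈ valid, p.1.length + p.2.length = 0 + 2 →
        carrierMap σ C pt 0 (Finsupp.single p 1) ∈ chainsOn (C p (0 + 1)) ∧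
        carrierMap σ C pt 0 (Finsupp.single p.swap 1) =
          TupleChain.map σ (0 + 1) (carrierMap σ C pt 0 (Finsupp.single p 1)) := by
      intro p hp hl
      rw [carrierMap_zero, carrierMap_zero, TupleChain.map_single, h.pt_swap p hp]
      exact ⟨single_mem_chainsOn (h.pt_mem p hp hl), rfl⟩
    have h2 : ∀ p ∈ valid, p.1.length + p.2.length = 0 + 3 →
        TupleChain.bd E 0 (carrierMap σ C pt 0 (bd V (Finsupp.single p 1))) = 0 := by
      intro p hp hl
      -- Each vertex goes to one point, so the augmentation of the image is the number of vertices
      -- in the boundary of an edge, which is even.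
      have : TupleChain.bd E 0 (carrierMap σ C pt 0 (bd V (Finsupp.single p 1))) =
          countVertices V (bd V (Finsupp.single p 1)) • Finsupp.single Fin.elim0 1 := by
        refine map_eq_of_chainsOn (TupleChain.bd E 0 ∘ₗ carrierMap σ C pt 0)
          ((countVertices V).smulRight (Finsupp.single Fin.elim0 1)) (fun q hq => ?_) (hbdm p hp)
        have hq1 := List.length_pos_of_ne_nil hq.1
        have hq2 := List.length_pos_of_ne_nil hq.2.1
        have hq3 := hq.2.2.1
        rw [LinearMap.comp_apply, carrierMap_zero, TupleChain.bd_single, LinearMap.smulRight_apply,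
          countVertices_single, if_pos (by omega), one_smul, Fin.sum_univ_one]
        congr 1
        exact Subsingleton.elim _ _
      rw [this, countVertices_bd, zero_smul]
    exact ⟨h1, h2, step 0 h1 h2⟩
  | succ n ih =>
    intro hn
    obtain ⟨-, -, h3⟩ := ih (by omega)
    have h3 := h3 hn
    have h1 : ∀ p ∈ valid, p.1.length + p.2.length = (n + 1) + 2 →
        carrierMap σ C pt (n + 1) (Finsupp.single p 1) ∈ chainsOn (C p (n + 2)) ∧
        carrierMap σ C pt (n + 1) (Finsupp.single p.swap 1) =
          TupleChain.map σ (n + 2) (carrierMap σ C pt (n + 1) (Finsupp.single p 1)) := by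
      intro p hp hl
      refine ⟨(h3 p hp (by omega)).1, ?_⟩
      have hr := wellOrderingRel_swap_iff (h.ne p hp)
      by_cases h4 : WellOrderingRel p.1 p.2
      · rw [carrierMap_succ_of_rel n h4,
          carrierMap_succ_of_not_rel n (p := p.swap) (fun h5 => hr.1 h5 h4), Prod.swap_swap]
      · rw [carrierMap_succ_of_not_rel n h4,
          carrierMap_succ_of_rel n (p := p.swap) (hr.2 h4), map_map_of_involutive h.involutive]
    have h2 : ∀ p ∈ valid, p.1.length + p.2.length = (n + 1) + 3 →
        TupleChain.bd E (n + 1) (carrierMap σ C pt (n + 1) (bd V (Finsupp.single p 1))) = 0 := by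
      intro p hp hl
      have : TupleChain.bd E (n + 1) (carrierMap σ C pt (n + 1) (bd V (Finsupp.single p 1))) =
          carrierMap σ C pt n (bd V (bd V (Finsupp.single p 1))) :=
        map_eq_of_chainsOn (TupleChain.bd E (n + 1) ∘ₗ carrierMap σ C pt (n + 1))
          (carrierMap σ C pt n ∘ₗ bd V) (fun q hq =>
            (h3 q (hfaces (n + 1) p hp hl q hq).1 (by
              have := (hfaces (n + 1) p hp hl q hq).2; omega)).2) (hbdm p hp)
      rw [this, bd_bd_single, map_zero]
    exact ⟨h1, h2, step (n + 1) h1 h2⟩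

theorem carrierMap_mem {n : ℕ} (hn : n ≤ d) {p : List V × List V} (hp : p ∈ valid)
    (hl : p.1.length + p.2.length = n + 2) :
    carrierMap σ C pt n (Finsupp.single p 1) ∈ chainsOn (C p (n + 1)) :=
  ((h.carrierMap_aux n hn).1 p hp hl).1

theorem carrierMap_swap {n : ℕ} (hn : n ≤ d) {p : List V × List V} (hp : p ∈ valid)
    (hl : p.1.length + p.2.length = n + 2) :
    carrierMap σ C pt n (Finsupp.single p.swap 1) =
      TupleChain.map σ (n + 1) (carrierMap σ C pt n (Finsupp.single p 1)) :=
  ((h.carrierMap_aux n hn).1 p hp hl).2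

theorem bd_carrierMap {n : ℕ} (hn : n + 1 ≤ d) {p : List V × List V} (hp : p ∈ valid)
    (hl : p.1.length + p.2.length = n + 3) :
    TupleChain.bd E (n + 1) (carrierMap σ C pt (n + 1) (Finsupp.single p 1)) =
      carrierMap σ C pt n (bd V (Finsupp.single p 1)) :=
  ((h.carrierMap_aux n (by omega)).2.2 hn p hp hl).2

end IsAcyclicCarrier

end ListPairChain

/-! ### The transfer cochains of a sequence of functions -/

section

variable {E : Type*}

/-- The product of the coboundaries of the functions `g 0, …, g (n - 1)`. -/
def coboundaryProduct : (n : ℕ) → (ℕ → E → ZMod 2) → (Fin (n + 1) → E) → ZMod 2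
  | 0, _, _ => 1
  | n + 1, g, p => (g 0 (p 0) + g 0 (p 1)) * coboundaryProduct n (fun j => g (j + 1)) (Fin.tail p)

/-- The product of the coboundaries of the functions `g 0, …, g (n - 1)` with `g n`. -/
def transferProduct : (n : ℕ) → (ℕ → E → ZMod 2) → (Fin (n + 1) → E) → ZMod 2
  | 0, g, p => g 0 (p 0)
  | n + 1, g, p => (g 0 (p 0) + g 0 (p 1)) * transferProduct n (fun j => g (j + 1)) (Fin.tail p)

/-- The coboundary of an odd function is invariant, so only the last factor changes, and it changes
by 1. -/
theorem transferProduct_add (σ : E → E) : ∀ (n : ℕ) (g : ℕ → E → ZMod 2) (p : Fin (n + 1) → E),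
    (∀ j i, g j (σ (p i)) = g j (p i) + 1) →
      transferProduct n g p + transferProduct n g (σ ∘ p) = coboundaryProduct n g p := by
  intro n
  induction n with
  | zero =>
    intro g p hg
    change g 0 (p 0) + g 0 (σ (p 0)) = 1
    rw [hg, chain_add_add_cancel]
  | succ n ih =>
    intro g p hg
    rw [transferProduct, transferProduct, coboundaryProduct,
      ← ih (fun j => g (j + 1)) (Fin.tail p) fun j i => hg (j + 1) i.succ, mul_add]
    congr 1
    change (g 0 (σ (p 0)) + g 0 (σ (p 1))) * transferProduct n _ (σ ∘ Fin.tail p) = _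
    rw [hg, hg]
    congr 1
    generalize g 0 (p 0) = a
    generalize g 0 (p 1) = b
    revert a b
    decide

/-- The Leibniz rule for δg_0 ⋯ δg_(n-1) g_n: only the last factor is not a cocycle. In the
induction the first two faces share a tail, and their leading differences (b + c) and (a + c) add up
to a + b. -/
theorem sum_transferProduct : ∀ (n : ℕ) (g : ℕ → E → ZMod 2) (p : Fin (n + 2) → E),
    ∑ i : Fin (n + 2), transferProduct n g (p ∘ i.succAbove) = coboundaryProduct (n + 1) g p := by
  intro n
  induction n with
  | zero =>
    intro g p
    rw [Fin.sum_univ_two]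
    change g 0 (p 1) + g 0 (p 0) = (g 0 (p 0) + g 0 (p 1)) * 1
    rw [mul_one, add_comm]
  | succ n ih =>
    intro g p
    have htail : ∀ i : Fin (n + 2), Fin.tail (p ∘ i.succ.succAbove) = Fin.tail p ∘ i.succAbove := by
      intro i
      funext k
      simp [Fin.tail]
    have h0 : transferProduct (n + 1) g (p ∘ (0 : Fin (n + 3)).succAbove) =
        (g 0 (p 1) + g 0 (p 2)) * transferProduct n (fun j => g (j + 1))
          (Fin.tail p ∘ (0 : Fin (n + 2)).succAbove) := rfl
    have h1 : transferProduct (n + 1) g (p ∘ (Fin.succ 0 : Fin (n + 3)).succAbove) =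
        (g 0 (p 0) + g 0 (p 2)) * transferProduct n (fun j => g (j + 1))
          (Fin.tail p ∘ (0 : Fin (n + 2)).succAbove) := by
      rw [transferProduct, htail]
      rfl
    have h2 : ∀ i : Fin (n + 1), transferProduct (n + 1) g (p ∘ i.succ.succ.succAbove) =
        (g 0 (p 0) + g 0 (p 1)) * transferProduct n (fun j => g (j + 1))
          (Fin.tail p ∘ i.succ.succAbove) := by
      intro i
      rw [transferProduct, htail]
      congr 2
    rw [coboundaryProduct, ← ih, Fin.sum_univ_succ, Fin.sum_univ_succ, h0, h1,
      Fin.sum_univ_succ (n := n + 1), mul_add, Finset.mul_sum]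
    simp only [h2]
    rw [← add_assoc]
    congr 1
    rw [← add_mul]
    congr 1
    generalize g 0 (p 0) = a
    generalize g 0 (p 1) = b
    generalize g 0 (p 2) = c
    revert a b c
    decide

theorem coboundaryProduct_eq_zero : ∀ (n : ℕ) (g : ℕ → E → ZMod 2) (p : Fin (n + 1) → E) (j : ℕ),
    j < n → ∀ a, (∀ i, g j (p i) = a) → coboundaryProduct n g p = 0 := by
  intro n
  induction n with
  | zero => intro g p j hj; omega
  | succ n ih =>
    intro g p j hj a ha
    cases j with
    | zero =>
      rw [coboundaryProduct, ha, ha, chain_add_self, zero_mul]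
    | succ j =>
      rw [coboundaryProduct, ih (fun j => g (j + 1)) (Fin.tail p) j (by omega) a
        fun i => ha i.succ, mul_zero]

end

/-! ### Small chains in the cells of the deleted product -/

noncomputable instance Module.hasBarycenter {E : Type*} [AddCommGroup E] [Module ℝ E] :
    HasBarycenter E where
  bary {n} v := ((n : ℝ) + 1)⁻¹ • ∑ i, v i

theorem Module.bary_eq {E : Type*} [AddCommGroup E] [Module ℝ E] {n : ℕ} (v : Fin (n + 1) → E) :
    bary v = ((n : ℝ) + 1)⁻¹ • ∑ i, v i := rfl

theorem TupleChain.baryClosed_singleton {E : Type*} [AddCommGroup E] [Module ℝ E] (x : E) :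
    TupleChain.BaryClosed {x} := by
  intro n v hv
  have : ∀ i, v i = x := hv
  rw [Set.mem_singleton_iff, Module.bary_eq]
  simp only [this, Finset.sum_const, Finset.card_univ, Fintype.card_fin]
  rw [← Nat.cast_smul_eq_nsmul ℝ, smul_smul]
  push_cast
  rw [inv_mul_cancel₀ (by positivity), one_smul]

/-- The affine map from the standard simplex to a vector space with prescribed vertices. -/
noncomputable def stdSimplex.combModule {E : Type*} [AddCommGroup E] [Module ℝ E] {m : ℕ}
    (v : Fin (m + 1) → E) (t : stdSimplex ℝ (Fin (m + 1))) : E := ∑ i, t.1 i • v i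

theorem stdSimplex.combModule_vertex {E : Type*} [AddCommGroup E] [Module ℝ E] {m : ℕ}
    (v : Fin (m + 1) → E) (i : Fin (m + 1)) :
    stdSimplex.combModule v (stdSimplex.vertex i) = v i := by
  simp [stdSimplex.combModule, Pi.single_apply]

/-- Affine maps preserve barycenters. This is the naturality hypothesis for moving subdivisions of
the standard simplex into cells. -/
theorem stdSimplex.combModule_bary {E : Type*} [AddCommGroup E] [Module ℝ E] {m : ℕ}
    (v : Fin (m + 1) → E) (k : ℕ) (w : Fin (k + 1) → stdSimplex ℝ (Fin (m + 1))) :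
    stdSimplex.combModule v (bary w) = bary (stdSimplex.combModule v ∘ w) := by
  rw [Module.bary_eq, stdSimplex.combModule, stdSimplex.bary_coe]
  simp only [Function.comp, stdSimplex.combModule, Pi.smul_apply, Finset.sum_apply, smul_eq_mul,
    mul_smul, Finset.sum_smul]
  rw [← Finset.smul_sum, Finset.sum_comm]

theorem stdSimplex.combModule_mem {E : Type*} [AddCommGroup E] [Module ℝ E] {C : Set E}
    (hC : Convex ℝ C) {m : ℕ} {v : Fin (m + 1) → E} (hv : ∀ i, v i ∈ C)
    (t : stdSimplex ℝ (Fin (m + 1))) : stdSimplex.combModule v t ∈ C :=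
  hC.sum_mem (fun i _ => t.2.1 i) t.2.2 fun i _ => hv i

theorem stdSimplex.combModule_fst {E F : Type*} [AddCommGroup E] [Module ℝ E] [AddCommGroup F]
    [Module ℝ F] {m : ℕ} (v : Fin (m + 1) → E × F) (t : stdSimplex ℝ (Fin (m + 1))) :
    (stdSimplex.combModule v t).1 = stdSimplex.combModule (fun i => (v i).1) t := by
  simp [stdSimplex.combModule, Prod.fst_sum]

theorem stdSimplex.combModule_snd {E F : Type*} [AddCommGroup E] [Module ℝ E] [AddCommGroup F]
    [Module ℝ F] {m : ℕ} (v : Fin (m + 1) → E × F) (t : stdSimplex ℝ (Fin (m + 1))) :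
    (stdSimplex.combModule v t).2 = stdSimplex.combModule (fun i => (v i).2) t := by
  simp [stdSimplex.combModule, Prod.snd_sum]

/-- A function that changes under the exchange of the factors and records the sign of `F`. -/
noncomputable def signFunction {A : Type*} (F : A × A → ℝ) (q : A × A) : ZMod 2 :=
  open Classical in if 0 < F q ∨ (F q = 0 ∧ WellOrderingRel q.1 q.2) then 1 else 0

/-- Where F is nonzero the swap reverses its sign. Where F is zero the well-order decides, and it
also reverses off the diagonal. No continuity is required of the sign function. -/
theorem signFunction_swap {A : Type*} {F : A × A → ℝ} (hF : ∀ q, F q.swap = -F q) {q : A × A}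
    (hq : q.1 ≠ q.2) : signFunction F q.swap = signFunction F q + 1 := by
  have hr := ListPairChain.wellOrderingRel_swap_iff hq
  rcases lt_trichotomy (F q) 0 with h | h | h
  · rw [signFunction, if_pos (Or.inl (by rw [hF]; linarith)), signFunction, if_neg, zero_add]
    rintro (h' | h')
    · linarith
    · linarith [h'.1]
  · by_cases h1 : WellOrderingRel q.1 q.2
    · rw [signFunction, if_neg, signFunction, if_pos (Or.inr ⟨h, h1⟩)]
      · rfl
      · rintro (h' | h')
        · rw [hF] at h'; linarith
        · exact hr.1 h'.2 h1
    · rw [signFunction, if_pos (Or.inr ⟨by rw [hF, h, neg_zero], hr.2 h1⟩), signFunction, if_neg,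
        zero_add]
      rintro (h' | h')
      · linarith
      · exact h1 h'.2
  · rw [signFunction, if_neg, signFunction, if_pos (Or.inl h)]
    · rfl
    · rw [hF]
      rintro (h' | h')
      · linarith
      · linarith [h'.1]

/-! ### The acyclic carrier of small chains in the cells. -/

namespace DeletedProduct

variable {V : Type*}

/-- The closed simplex with given vertices in the space of finitely supported functions. -/
def simplexSet (a : Finset V) : Set (V →₀ ℝ) :=
  {x | x.support ⊆ a ∧ (∀ v, 0 ≤ x v) ∧ x.sum (fun _ t => t) = 1}

theorem mem_simplexSet_iff {a : Finset V} {x : V →₀ ℝ} : x ∈ simplexSet a ↔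
    (∀ v ∉ a, x v = 0) ∧ (∀ v, 0 ≤ x v) ∧ ∑ v ∈ a, x v = 1 := by
  constructor
  · rintro ⟨h1, h2, h3⟩
    refine ⟨fun v hv => ?_, h2, ?_⟩
    · by_contra h
      exact hv (h1 (Finsupp.mem_support_iff.2 h))
    · rw [← h3, Finsupp.sum_of_support_subset x h1 _ (by simp)]
  · rintro ⟨h1, h2, h3⟩
    have hs : x.support ⊆ a := fun v hv => by
      by_contra h
      exact Finsupp.mem_support_iff.1 hv (h1 v h)
    exact ⟨hs, h2, by rw [← h3, Finsupp.sum_of_support_subset x hs _ (by simp)]⟩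

theorem convex_simplexSet (a : Finset V) : Convex ℝ (simplexSet a) := by
  intro x hx y hy r s hr hs hrs
  rw [mem_simplexSet_iff] at *
  refine ⟨fun v hv => ?_, fun v => ?_, ?_⟩
  · simp [hx.1 v hv, hy.1 v hv]
  · have h1 := mul_nonneg hr (hx.2.1 v)
    have h2 := mul_nonneg hs (hy.2.1 v)
    simpa using add_nonneg h1 h2
  · simp only [Finsupp.add_apply, Finsupp.smul_apply, smul_eq_mul, Finset.sum_add_distrib,
      ← Finset.mul_sum, hx.2.2, hy.2.2, mul_one, hrs]

theorem simplexSet_mono {a b : Finset V} (h : a ⊆ b) : simplexSet a ⊆ simplexSet b :=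
  fun _ hx => ⟨hx.1.trans h, hx.2⟩

theorem single_mem_simplexSet {a : Finset V} {v : V} (h : v ∈ a) :
    Finsupp.single v (1 : ℝ) ∈ simplexSet a := by
  classical
  rw [mem_simplexSet_iff]
  refine ⟨fun w hw => Finsupp.single_eq_of_ne (by rintro rfl; exact hw h), fun w => ?_, ?_⟩
  · rw [Finsupp.single_apply]; split_ifs <;> norm_num
  · simp [Finsupp.single_apply, h]

theorem support_nonempty_of_sum {x : V →₀ ℝ} (h : x.sum (fun _ t => t) = 1) :
    x.support.Nonempty := by
  rw [Finset.nonempty_iff_ne_empty]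
  intro h0
  rw [Finsupp.support_eq_empty.1 h0] at h
  simp at h

variable (K : PreAbstractSimplicialComplex V)

theorem face_of_subset {a b : Finset V} (hb : b ∈ K.faces) (h : a ⊆ b) (ha : a.Nonempty) :
    a ∈ K.faces := (K.isRelLowerSet_faces hb).2 h ha

/-- A point of a simplex as a point of the realization. -/
def toRealization {a : Finset V} (ha : a ∈ K.faces) (x : simplexSet a) : GeometricRealization K :=
  ⟨x.1, face_of_subset K ha x.2.1 (support_nonempty_of_sum x.2.2.2), x.2.2⟩

variable {K} {d : ℕ} (f : GeometricRealization K → EuclideanSpace ℝ (Fin d))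

open Classical in
/-- The extension by zero of a map on the realization. -/
noncomputable def extend (x : V →₀ ℝ) : EuclideanSpace ℝ (Fin d) :=
  if h : x.support ∈ K.faces ∧ (∀ v, 0 ≤ x v) ∧ x.sum (fun _ t => t) = 1 then f ⟨x, h⟩ else 0

theorem extend_eq (x : GeometricRealization K) : extend f x.1 = f x := by
  rw [extend, dif_pos x.2]
  rfl

theorem extend_mem_image {a : Finset V} (ha : a ∈ K.faces) {x : V →₀ ℝ} (hx : x ∈ simplexSet a) :
    extend f x ∈ f '' closedSimplex K a :=
  ⟨toRealization K ha ⟨x, hx⟩, hx.1, (extend_eq f (toRealization K ha ⟨x, hx⟩)).symm⟩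

/-- The affine simplex stays in one closed simplex of K, so coordinatewise continuity suffices for
the weak topology. The extension by zero itself need not be continuous. -/
theorem continuous_extend_combModule (hf : Continuous f) {a : Finset V} (ha : a ∈ K.faces) {m : ℕ}
    {v : Fin (m + 1) → V →₀ ℝ} (hv : ∀ i, v i ∈ simplexSet a) :
    Continuous fun t => extend f (stdSimplex.combModule v t) := by
  have hm := stdSimplex.combModule_mem (convex_simplexSet a) hv
  have h1 : Continuous fun t => toRealization K ha ⟨stdSimplex.combModule v t, hm t⟩ := by
    refine continuous_to_weakTopology _ (fun σ : K.faces => closedSimplex K σ) ⟨a, ha⟩ _ (continuous_induced_rng.2 ?_) fun t => (hm t).1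
    refine continuous_pi fun u => ?_
    change Continuous fun t : stdSimplex ℝ (Fin (m + 1)) => (∑ i, t.1 i • v i) u
    simp only [Finsupp.coe_finsetSum, Finset.sum_apply, Finsupp.smul_apply, smul_eq_mul]
    exact continuous_finsetSum _ fun i _ =>
      ((continuous_apply i).comp continuous_subtype_val).mul continuous_const
  have h2 := hf.comp h1
  refine h2.congr fun t => ?_
  exact (extend_eq f _).symm

/-- The `j`-th coordinate of `f x - f y`. -/
noncomputable def difference (j : Fin d) (q : (V →₀ ℝ) × (V →₀ ℝ)) : ℝ :=
  extend f q.1 j - extend f q.2 j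

theorem difference_swap (j : Fin d) (q : (V →₀ ℝ) × (V →₀ ℝ)) :
    difference f j q.swap = -difference f j q := by
  simp [difference]

variable [DecidableEq V]

variable (K) in
/-- The pairs of nonempty vertex lists of disjoint simplices. -/
def validPairs : Set (List V × List V) :=
  {p | p.1 ≠ [] ∧ p.2 ≠ [] ∧ p.1.toFinset ∈ K.faces ∧ p.2.toFinset ∈ K.faces ∧
    Disjoint p.1.toFinset p.2.toFinset}

/-- The cell spanned by two vertex lists. -/
def cell (p : List V × List V) : Set ((V →₀ ℝ) × (V →₀ ℝ)) :=
  simplexSet p.1.toFinset ×ˢ simplexSet p.2.toFinset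

theorem toFinset_mono {a b : List V} (h : a ⊆ b) : a.toFinset ⊆ b.toFinset :=
  fun _ hv => List.mem_toFinset.2 (h (List.mem_toFinset.1 hv))

theorem cell_mono {p q : List V × List V} (h1 : q.1 ⊆ p.1) (h2 : q.2 ⊆ p.2) : cell q ⊆ cell p :=
  Set.prod_mono (simplexSet_mono (toFinset_mono h1))
    (simplexSet_mono (toFinset_mono h2))

theorem combModule_mem_cell {p : List V × List V} {m : ℕ}
    {v : Fin (m + 1) → (V →₀ ℝ) × (V →₀ ℝ)} (hv : ∀ i, v i ∈ cell p)
    (t : stdSimplex ℝ (Fin (m + 1))) : stdSimplex.combModule v t ∈ cell p := by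
  constructor
  · rw [stdSimplex.combModule_fst]
    exact stdSimplex.combModule_mem (convex_simplexSet _) (fun i => (hv i).1) t
  · rw [stdSimplex.combModule_snd]
    exact stdSimplex.combModule_mem (convex_simplexSet _) (fun i => (hv i).2) t

theorem ne_of_mem_cell {p : List V × List V} (hp : p ∈ validPairs K)
    {q : (V →₀ ℝ) × (V →₀ ℝ)} (hq : q ∈ cell p) : q.1 ≠ q.2 := by
  intro h
  obtain ⟨v, hv⟩ := support_nonempty_of_sum hq.1.2.2
  refine Finset.disjoint_left.1 hp.2.2.2.2 (hq.1.1 hv) (hq.2.1 ?_)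
  rwa [← h]

/-- The sets in a cell that contain the barycenters of their tuples and on which a coordinate of
`f x - f y` has constant sign. -/
def signedSets (p : List V × List V) : Set (Set ((V →₀ ℝ) × (V →₀ ℝ))) :=
  {Q | TupleChain.BaryClosed Q ∧ Q ⊆ cell p ∧
    ∃ j, (∀ q ∈ Q, 0 < difference f j q) ∨ ∀ q ∈ Q, difference f j q < 0}

/-- A vertex of the cell spanned by two vertex lists. -/
noncomputable def cellVertex (p : List V × List V) : (V →₀ ℝ) × (V →₀ ℝ) :=
  (p.1.head?.elim 0 fun v => Finsupp.single v 1, p.2.head?.elim 0 fun v => Finsupp.single v 1)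

theorem cellVertex_mem {p : List V × List V} (h1 : p.1 ≠ []) (h2 : p.2 ≠ []) :
    cellVertex p ∈ cell p := by
  obtain ⟨a, b⟩ := p
  cases a with
  | nil => exact absurd rfl h1
  | cons x a =>
    cases b with
    | nil => exact absurd rfl h2
    | cons y b => exact ⟨single_mem_simplexSet (by simp), single_mem_simplexSet (by simp)⟩

variable {f}

/-- Lists may repeat vertices, so the two simplices have total dimension at most the total length
minus 2, that is, at most d. A common zero of all coordinates would be a forbidden coincidence. -/
theorem exists_difference_ne_zero
    (hno : ∀ σ ∈ K.faces, ∀ τ ∈ K.faces, Disjoint σ τ → simplexDim σ + simplexDim τ ≤ d →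
      ¬ (f '' closedSimplex K σ ∩ f '' closedSimplex K τ).Nonempty)
    {p : List V × List V} (hp : p ∈ validPairs K) (hl : p.1.length + p.2.length ≤ d + 2)
    {q : (V →₀ ℝ) × (V →₀ ℝ)} (hq : q ∈ cell p) : ∃ j, difference f j q ≠ 0 := by
  by_contra! h
  have he : extend f q.1 = extend f q.2 := by
    ext j
    exact sub_eq_zero.1 (h j)
  obtain ⟨h1, h2, h3, h4, h5⟩ := hp
  refine hno _ h3 _ h4 h5 ?_ ⟨_, extend_mem_image f h3 hq.1, he ▸ extend_mem_image f h4 hq.2⟩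
  have e1 := List.toFinset_card_le p.1
  have e2 := List.toFinset_card_le p.2
  have e3 := List.length_pos_of_ne_nil h1
  have e4 := List.length_pos_of_ne_nil h2
  simp only [simplexDim]
  omega

theorem continuous_difference_combModule (hf : Continuous f) {p : List V × List V}
    (hp : p ∈ validPairs K) {m : ℕ} {v : Fin (m + 1) → (V →₀ ℝ) × (V →₀ ℝ)}
    (hv : ∀ i, v i ∈ cell p) (j : Fin d) :
    Continuous fun t => difference f j (stdSimplex.combModule v t) := by
  have h1 := continuous_extend_combModule f hf hp.2.2.1 (fun i => (hv i).1)
  have h2 := continuous_extend_combModule f hf hp.2.2.2.1 (fun i => (hv i).2)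
  simp only [difference, stdSimplex.combModule_fst, stdSimplex.combModule_snd]
  exact ((EuclideanSpace.proj j).continuous.comp h1).sub
    ((EuclideanSpace.proj j).continuous.comp h2)

variable (f) in
/-- The pullback to a simplex of the set where a coordinate of `f x - f y` has a given sign. -/
def signRegion {m : ℕ} (v : Fin (m + 1) → (V →₀ ℝ) × (V →₀ ℝ)) (i : Fin d × Bool) :
    Set (stdSimplex ℝ (Fin (m + 1))) :=
  {t | i.2 = true ∧ 0 < difference f i.1 (stdSimplex.combModule v t)} ∪
    {t | i.2 = false ∧ difference f i.1 (stdSimplex.combModule v t) < 0}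

theorem image_mem_signedSets {p : List V × List V} {m : ℕ}
    {v : Fin (m + 1) → (V →₀ ℝ) × (V →₀ ℝ)} (hmem : ∀ t, stdSimplex.combModule v t ∈ cell p)
    {Q : Set (stdSimplex ℝ (Fin (m + 1)))} (hQ : TupleChain.BaryClosed Q) {i : Fin d × Bool}
    (hi : Q ⊆ signRegion f v i) : stdSimplex.combModule v '' Q ∈ signedSets f p := by
  obtain ⟨j, b⟩ := i
  refine ⟨?_, ?_, j, ?_⟩
  · intro n u hu
    choose u' hu' hu'' using hu
    refine ⟨bary u', hQ n u' hu', ?_⟩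
    rw [stdSimplex.combModule_bary]
    congr 1
    funext i
    exact hu'' i
  · rintro _ ⟨t, -, rfl⟩
    exact hmem t
  · cases b
    · right
      rintro _ ⟨t, ht, rfl⟩
      rcases hi ht with h | h
      · exact absurd h.1 Bool.false_ne_true
      · exact h.2
    · left
      rintro _ ⟨t, ht, rfl⟩
      rcases hi ht with h | h
      · exact h.2
      · exact absurd h.1 Bool.false_ne_true.symm

/-- The regions where some coordinate is positive or negative form an open cover of the
parametrizing simplex, because the difference has no zero on the cell. Fine subdivisions are
subordinate to it, and they are pushed forward to the cell. -/
theorem exists_sdIter_small (hf : Continuous f)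
    (hno : ∀ σ ∈ K.faces, ∀ τ ∈ K.faces, Disjoint σ τ → simplexDim σ + simplexDim τ ≤ d →
      ¬ (f '' closedSimplex K σ ∩ f '' closedSimplex K τ).Nonempty)
    {p : List V × List V} (hp : p ∈ validPairs K) (hl : p.1.length + p.2.length ≤ d + 2) {m : ℕ}
    {v : Fin (m + 1) → (V →₀ ℝ) × (V →₀ ℝ)} (hv : ∀ i, v i ∈ cell p) :
    ∃ m₀, ∀ k ≥ m₀, TupleChain.sdIter _ (m + 1) k (Finsupp.single v 1) ∈
      chainsOn (TupleChain.tuplesSmall (signedSets f p) (m + 1)) := by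
  have hmem : ∀ t, stdSimplex.combModule v t ∈ cell p :=
    combModule_mem_cell hv
  have hcont := continuous_difference_combModule hf hp hv
  have hU : ∀ i, IsOpen (signRegion f v i) := fun i => (isOpen_const.inter (isOpen_lt
    continuous_const (hcont i.1))).union (isOpen_const.inter (isOpen_lt (hcont i.1)
      continuous_const))
  have hcov : ∀ t, ∃ i, t ∈ signRegion f v i := by
    intro t
    obtain ⟨j, hj⟩ := exists_difference_ne_zero hno hp hl (hmem t)
    rcases lt_or_gt_of_ne hj with h | h
    · exact ⟨(j, false), Or.inr ⟨rfl, h⟩⟩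
    · exact ⟨(j, true), Or.inl ⟨rfl, h⟩⟩
  obtain ⟨m₀, hm₀⟩ := TupleChain.exists_sdIter_vertices_small (signRegion f v) hU hcov
  refine ⟨m₀, fun k hk => ?_⟩
  have h1 : Finsupp.single v 1 =
      TupleChain.map (stdSimplex.combModule v) (m + 1) (TupleChain.vertices m) := by
    rw [TupleChain.vertices, TupleChain.map_single]
    congr 1
    funext i
    exact (stdSimplex.combModule_vertex v i).symm
  have h2 := TupleChain.map_sdIter (stdSimplex.combModule_bary v) (m + 1) k (TupleChain.vertices m)
  rw [h1, ← h2]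
  refine TupleChain.map_mem ?_ (hm₀ k hk)
  rintro w ⟨Q, ⟨hQ, i, hi⟩, hw⟩
  exact ⟨_, image_mem_signedSets hmem hQ.baryClosed hi, fun i => ⟨w i, hw i, rfl⟩⟩

theorem isAcyclicCarrier (hf : Continuous f)
    (hno : ∀ σ ∈ K.faces, ∀ τ ∈ K.faces, Disjoint σ τ → simplexDim σ + simplexDim τ ≤ d →
      ¬ (f '' closedSimplex K σ ∩ f '' closedSimplex K τ).Nonempty) :
    ListPairChain.IsAcyclicCarrier Prod.swap (fun p n => TupleChain.tuplesSmall (signedSets f p) n)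
      cellVertex (validPairs K) d where
  involutive _ := rfl
  mem_faces := by
    rintro p ⟨h1, h2, h3, h4, h5⟩ q ⟨h6, h7, -, h8, h9⟩
    have s1 := toFinset_mono h8
    have s2 := toFinset_mono h9
    exact ⟨h6, h7, face_of_subset K h3 s1 (by simpa using h6),
      face_of_subset K h4 s2 (by simpa using h7), h5.mono s1 s2⟩
  swap_mem := fun p ⟨h1, h2, h3, h4, h5⟩ => ⟨h2, h1, h4, h3, h5.symm⟩
  ne_nil p hp := ⟨hp.1, hp.2.1⟩
  ne := by
    rintro p ⟨h1, h2, h3, h4, h5⟩ h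
    rw [h, disjoint_self] at h5
    exact h2 (by simpa using h5)
  mono := by
    rintro p hp q ⟨-, -, -, h8, h9⟩ n v ⟨Q, ⟨hQ1, hQ2, hQ3⟩, hv⟩
    exact ⟨Q, ⟨hQ1, hQ2.trans (cell_mono h8 h9), hQ3⟩, hv⟩
  equivariant := by
    rintro p hp n v ⟨Q, ⟨hQ1, hQ2, j, hQ3⟩, hv⟩
    -- The swapped set works with the same coordinate j and the opposite sign.
    refine ⟨Prod.swap ⁻¹' Q, ⟨?_, fun q hq => ?_, j, ?_⟩, hv⟩
    · intro k u hu
      have := hQ1 k (fun i => (u i).swap) hu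
      have e : (bary u).swap = bary (fun i => (u i).swap) := by
        rw [Module.bary_eq, Module.bary_eq]
        refine Prod.ext ?_ ?_ <;> simp [Prod.fst_sum, Prod.snd_sum]
      rw [Set.mem_preimage, e]
      exact this
    · exact ⟨(hQ2 hq).2, (hQ2 hq).1⟩
    · rcases hQ3 with h | h
      · right
        intro q hq
        have := h _ hq
        rw [difference_swap] at this
        linarith
      · left
        intro q hq
        have := h _ hq
        rw [difference_swap] at this
        linarith
  pt_mem := by
    intro p hp hl
    have hm := cellVertex_mem hp.1 hp.2.1
    obtain ⟨j, hj⟩ := exists_difference_ne_zero hno hp (by omega) hm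
    -- A single point is closed under barycenters, and some coordinate of the difference has a sign
    -- there.
    refine ⟨{cellVertex p}, ⟨TupleChain.baryClosed_singleton _, Set.singleton_subset_iff.2 hm, j, ?_⟩,
      fun _ => rfl⟩
    rcases lt_or_gt_of_ne hj with h | h
    · right; rintro _ rfl; exact h
    · left; rintro _ rfl; exact h
  pt_swap _ _ := rfl
  exists_filling := by
    intro p hp n hn hl z hz hz0
    refine TupleChain.exists_small_filling (C := cell p) (fun Q hQ => hQ.1)
      (cellVertex_mem hp.1 hp.2.1) (fun Q hQ => hQ.2.1) (fun v hv => ?_) hz hz0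
    exact exists_sdIter_small hf hno hp (by omega) hv

end DeletedProduct

/-! ### The transfer cochains on tuples of pairs of vertices -/

section

variable {E : Type*}

/-- The linear extension of `transferProduct` to chains. -/
noncomputable def transferChain (g : ℕ → E → ZMod 2) (n : ℕ) :
    TupleChain E (n + 1) →ₗ[ZMod 2] ZMod 2 :=
  Finsupp.linearCombination (ZMod 2) (transferProduct n g)

theorem transferChain_single (g : ℕ → E → ZMod 2) (n : ℕ) (v : Fin (n + 1) → E) :
    transferChain g n (Finsupp.single v 1) = transferProduct n g v := by
  simp [transferChain]

/-- The linear extension of `coboundaryProduct` to chains. -/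
noncomputable def coboundaryChain (g : ℕ → E → ZMod 2) (n : ℕ) :
    TupleChain E (n + 1) →ₗ[ZMod 2] ZMod 2 :=
  Finsupp.linearCombination (ZMod 2) (coboundaryProduct n g)

theorem coboundaryChain_single (g : ℕ → E → ZMod 2) (n : ℕ) (v : Fin (n + 1) → E) :
    coboundaryChain g n (Finsupp.single v 1) = coboundaryProduct n g v := by
  simp [coboundaryChain]

theorem transferChain_bd (g : ℕ → E → ZMod 2) (n : ℕ) (z : TupleChain E (n + 2)) :
    transferChain g n (TupleChain.bd E (n + 1) z) = coboundaryChain g (n + 1) z := by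
  refine DFunLike.congr_fun (f := transferChain g n ∘ₗ TupleChain.bd E (n + 1))
    (g := coboundaryChain g (n + 1)) ?_ z
  refine Finsupp.lhom_ext' fun v => LinearMap.ext_ring ?_
  simp only [LinearMap.comp_apply, Finsupp.lsingle_apply, TupleChain.bd_single, map_sum,
    transferChain_single, coboundaryChain_single]
  exact sum_transferProduct n g v

theorem transferChain_add {g : ℕ → E → ZMod 2} {σ : E → E} {n : ℕ} {A : Set (Fin (n + 1) → E)}
    (hA : ∀ v ∈ A, ∀ j i, g j (σ (v i)) = g j (v i) + 1) {z : TupleChain E (n + 1)}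
    (hz : z ∈ chainsOn A) :
    transferChain g n z + transferChain g n (TupleChain.map σ (n + 1) z) =
      coboundaryChain g n z := by
  refine map_eq_of_chainsOn
    (transferChain g n + transferChain g n ∘ₗ TupleChain.map σ (n + 1)) _ (fun v hv => ?_) hz
  simp only [LinearMap.add_apply, LinearMap.comp_apply, TupleChain.map_single,
    transferChain_single, coboundaryChain_single]
  exact transferProduct_add σ n g v (hA v hv)

end

/-! ### Transfer relations pulled back to tuples of pairs of vertices. -/

namespace ListPairChain

section

variable {V E : Type*} {σ : E → E} {C : List V × List V → (n : ℕ) → Set (Fin n → E)}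
  {pt : List V × List V → E} {valid : Set (List V × List V)} {d : ℕ} {g : ℕ → E → ZMod 2}

variable (σ C pt g) in
/-- The transfer cochain of a sequence of functions, evaluated on the image under the equivariant
chain map of a tuple of pairs of vertices. -/
noncomputable def vertexTransfer (n : ℕ) (t : Fin (n + 1) → V × V) : ZMod 2 :=
  transferChain g n (carrierMap σ C pt n (ofTuples V n (Finsupp.single t 1)))

theorem vertexTransfer_zero_add (hswap : ∀ p, pt (Prod.swap p) = σ (pt p)) (t : Fin 1 → V × V)
    (hg : g 0 (σ (pt ([(t 0).1], [(t 0).2]))) = g 0 (pt ([(t 0).1], [(t 0).2])) + 1) :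
    vertexTransfer σ C pt g 0 t + vertexTransfer σ C pt g 0 (Prod.swap ∘ t) = 1 := by
  rw [vertexTransfer, vertexTransfer, ofTuples_single_zero, ofTuples_single_zero, carrierMap_zero,
    carrierMap_zero, transferChain_single, transferChain_single]
  change g 0 (pt _) + g 0 (pt (Prod.swap ([(t 0).1], [(t 0).2]))) = 1
  rw [hswap, hg, ← add_assoc, chain_add_self, zero_add]

namespace IsAcyclicCarrier

variable (h : IsAcyclicCarrier σ C pt valid d) {S T : Set V}
include h

theorem carrierMap_ofTuples_mem (hST : ∀ n, within S T n ⊆ valid) {n : ℕ}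
    (hn : n ≤ d) {B : Set (Fin (n + 1) → E)} (hB : ∀ p ∈ valid, C p (n + 1) ⊆ B)
    {t : Fin (n + 1) → V × V} (ht : ∀ i, t i ∈ S ×ˢ T) :
    carrierMap σ C pt n (ofTuples V n (Finsupp.single t 1)) ∈ chainsOn B := by
  refine map_mem_of_chainsOn _ (fun p hp => ?_)
    (ofTuples_mem n _ (single_mem_chainsOn (A := TupleChain.tuplesIn (S ×ˢ T) (n + 1)) ht))
  exact Finsupp.supported_mono (hB p (hST _ hp)) (h.carrierMap_mem hn (hST _ hp) hp.2.2.1)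

theorem carrierMap_ofTuples_swap (hST : ∀ n, within S T n ⊆ valid) (hdisj : Disjoint S T) {n : ℕ}
    (hn : n ≤ d) {t : Fin (n + 1) → V × V} (ht : ∀ i, t i ∈ S ×ˢ T) :
    carrierMap σ C pt n (ofTuples V n (Finsupp.single (Prod.swap ∘ t) 1)) =
      TupleChain.map σ (n + 1) (carrierMap σ C pt n (ofTuples V n (Finsupp.single t 1))) := by
  rw [← TupleChain.map_single, ofTuples_swap n _ (single_mem_chainsOn fun i => ?_)]
  · refine map_eq_of_chainsOn (carrierMap σ C pt n ∘ₗ swap V)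
      (TupleChain.map σ (n + 1) ∘ₗ carrierMap σ C pt n) (fun p hp => ?_)
      (ofTuples_mem n _ (single_mem_chainsOn (A := TupleChain.tuplesIn (S ×ˢ T) (n + 1)) ht))
    rw [LinearMap.comp_apply, swap_single, h.carrierMap_swap hn (hST _ hp) hp.2.2.1]
    rfl
  · exact hdisj.ne_of_mem (ht i).1 (ht i).2

/-- The composite of the two chain maps is a chain map as long as the tuple stays in a product S × T
of which all cells are valid. -/
theorem bd_carrierMap_ofTuples (hST : ∀ n, within S T n ⊆ valid) {n : ℕ}
    (hn : n + 1 ≤ d) {t : Fin (n + 2) → V × V} (ht : ∀ i, t i ∈ S ×ˢ T) :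
    TupleChain.bd E (n + 1) (carrierMap σ C pt (n + 1) (ofTuples V (n + 1) (Finsupp.single t 1))) =
      ∑ i : Fin (n + 2), carrierMap σ C pt n (ofTuples V n (Finsupp.single (t ∘ i.succAbove) 1)) := by
  rw [← map_sum, ← map_sum, ← TupleChain.bd_single, ← bd_ofTuples]
  refine map_eq_of_chainsOn (TupleChain.bd E (n + 1) ∘ₗ carrierMap σ C pt (n + 1))
    (carrierMap σ C pt n ∘ₗ bd V) (fun p hp => ?_)
    (ofTuples_mem _ _ (single_mem_chainsOn (A := TupleChain.tuplesIn (S ×ˢ T) (n + 2)) ht))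
  exact h.bd_carrierMap hn (hST _ hp) hp.2.2.1

theorem coboundaryChain_carrierMap (hST : ∀ n, within S T n ⊆ valid) {n : ℕ}
    (hn : n + 1 ≤ d) {t : Fin (n + 2) → V × V} (ht : ∀ i, t i ∈ S ×ˢ T) :
    coboundaryChain g (n + 1)
        (carrierMap σ C pt (n + 1) (ofTuples V (n + 1) (Finsupp.single t 1))) =
      ∑ i : Fin (n + 2), vertexTransfer σ C pt g n (t ∘ i.succAbove) := by
  rw [← transferChain_bd, h.bd_carrierMap_ofTuples hST hn ht, map_sum]
  rfl

theorem vertexTransfer_succ_add (hST : ∀ n, within S T n ⊆ valid) (hdisj : Disjoint S T)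
    (hg : ∀ p ∈ valid, ∀ n, ∀ v ∈ C p n, ∀ j i, g j (σ (v i)) = g j (v i) + 1) {n : ℕ}
    (hn : n + 1 ≤ d) {t : Fin (n + 2) → V × V} (ht : ∀ i, t i ∈ S ×ˢ T) :
    vertexTransfer σ C pt g (n + 1) t + vertexTransfer σ C pt g (n + 1) (Prod.swap ∘ t) =
      ∑ i : Fin (n + 2), vertexTransfer σ C pt g n (t ∘ i.succAbove) := by
  rw [← h.coboundaryChain_carrierMap hST hn ht, vertexTransfer, vertexTransfer,
    h.carrierMap_ofTuples_swap hST hdisj hn ht]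
  refine transferChain_add (A := {v | ∀ j i, g j (σ (v i)) = g j (v i) + 1}) (fun v hv => hv) ?_
  exact h.carrierMap_ofTuples_mem hST hn (fun p hp v hv => hg p hp _ v hv) ht

/-- The sum equals the product of coboundaries on the image chain one dimension higher, and that
product vanishes on every tuple of the carrier. Here the carrier is used in its top dimension, n + 1
≤ d. -/
theorem sum_vertexTransfer_eq_zero (hST : ∀ n, within S T n ⊆ valid) {n : ℕ} (hn : n + 1 ≤ d)
    (hg : ∀ p ∈ valid, ∀ v ∈ C p (n + 2), coboundaryProduct (n + 1) g v = 0)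
    {t : Fin (n + 2) → V × V} (ht : ∀ i, t i ∈ S ×ˢ T) :
    ∑ i : Fin (n + 2), vertexTransfer σ C pt g n (t ∘ i.succAbove) = 0 := by
  rw [← h.coboundaryChain_carrierMap hST hn ht]
  refine map_eq_of_chainsOn (coboundaryChain g (n + 1)) 0
    (A := {v | coboundaryProduct (n + 1) g v = 0}) (fun v hv => ?_) ?_
  · rw [coboundaryChain_single]; exact hv
  · exact h.carrierMap_ofTuples_mem hST hn (fun p hp v hv => hg p hp v hv) ht

end IsAcyclicCarrier

end

end ListPairChain

/-! ### An open cover of the deleted product by regions with prescribed largest coordinates -/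

namespace GeometricRealization

variable {V : Type*} {K : PreAbstractSimplicialComplex V}

theorem continuous_coord (v : V) : Continuous fun x : GeometricRealization K => x.1 v :=
  continuous_le_dom (weakTopology_le _ _) (@Continuous.comp _ _ _ (TopologicalSpace.induced
    (fun x : GeometricRealization K => (x.1 : V → ℝ)) inferInstance) _ _ _ _ (continuous_apply v)
      continuous_induced_dom)

theorem exists_max_coord (x : GeometricRealization K) :
    ∃ v ∈ x.1.support, ∀ u, x.1 u ≤ x.1 v := by
  obtain ⟨v, hv, hmax⟩ := Finset.exists_max_image x.1.support x.1
    (DeletedProduct.support_nonempty_of_sum x.2.2.2)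
  refine ⟨v, hv, fun u => ?_⟩
  by_cases hu : u ∈ x.1.support
  · exact hmax u hu
  · rw [Finsupp.notMem_support_iff.1 hu]
    exact x.2.2.1 v

/-- A vertex at which a point has its largest coordinate. -/
noncomputable def maxVertex (x : GeometricRealization K) : V := x.exists_max_coord.choose

theorem maxVertex_mem (x : GeometricRealization K) : x.maxVertex ∈ x.1.support :=
  x.exists_max_coord.choose_spec.1

theorem le_maxVertex (x : GeometricRealization K) (u : V) : x.1 u ≤ x.1 x.maxVertex :=
  x.exists_max_coord.choose_spec.2 u

variable (K) in
/-- The points whose coordinates exceed `q` exactly on `S`, and are never equal to `q`. -/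
def levelRegion (S : Finset V) (q : ℝ) : Set (GeometricRealization K) :=
  {x | (∀ v ∈ S, q < x.1 v) ∧ ∀ u ∉ S, x.1 u < q}

/-- Infinitely many vertices may be constrained, but on a closed simplex the coordinates outside it
are 0 < q, so only finitely many conditions remain there. -/
theorem isOpen_levelRegion (S : Finset V) {q : ℝ} (hq : 0 < q) : IsOpen (levelRegion K S q) := by
  classical
  refine (isOpen_weakTopology _ _ _).2 fun a => ?_
  let O : Set (V → ℝ) := (⋂ v ∈ S, {y | q < y v}) ∩ ⋂ u ∈ a.1 \ S, {y | y u < q}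
  have hO : IsOpen O := (isOpen_biInter_finset fun v _ => isOpen_lt continuous_const
    (continuous_apply v)).inter (isOpen_biInter_finset fun u _ => isOpen_lt (continuous_apply u)
      continuous_const)
  refine (@isOpen_induced_iff _ _ (TopologicalSpace.induced
    (fun x : GeometricRealization K => (x.1 : V → ℝ)) inferInstance) _ _).2
      ⟨_, isOpen_induced_iff.2 ⟨O, hO, rfl⟩, ?_⟩
  ext x
  simp only [O, Set.mem_preimage, Set.mem_inter_iff, Set.mem_iInter, Set.mem_ofPred_eq, levelRegion]
  refine and_congr_right fun _ => ⟨fun h u hu => ?_, fun h u hu => h u (Finset.mem_sdiff.1 hu).2⟩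
  by_cases ha : u ∈ a.1
  · exact h u (Finset.mem_sdiff.2 ⟨ha, hu⟩)
  · rw [Finsupp.notMem_support_iff.1 fun h' => ha (x.2 h')]
    exact hq

theorem exists_mem_levelRegion (x : GeometricRealization K) :
    ∃ S : Finset V, ∃ q : ℝ, S.Nonempty ∧ 0 < q ∧ x ∈ levelRegion K S q := by
  classical
  have hpos : 0 < x.1 x.maxVertex :=
    lt_of_le_of_ne (x.2.2.1 _) (Finsupp.mem_support_iff.1 x.maxVertex_mem).symm
  -- The level is taken between the largest coordinate and the next one, or 0 if there is no other.
  -- The region then isolates the set of vertices where the maximum is attained.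
  let T : Finset ℝ := insert 0 ((x.1.support.filter fun u => x.1 u < x.1 x.maxVertex).image x.1)
  have hT : T.Nonempty := Finset.insert_nonempty _ _
  have hlt : T.max' hT < x.1 x.maxVertex := by
    rw [Finset.max'_lt_iff]
    intro y hy
    rcases Finset.mem_insert.1 hy with rfl | hy
    · exact hpos
    · obtain ⟨u, hu, rfl⟩ := Finset.mem_image.1 hy
      exact (Finset.mem_filter.1 hu).2
  obtain ⟨q, hq1, hq2⟩ := exists_between hlt
  have hq0 : 0 < q := (Finset.le_max' T 0 (Finset.mem_insert_self _ _)).trans_lt hq1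
  refine ⟨x.1.support.filter fun u => x.1 u = x.1 x.maxVertex, q,
    ⟨x.maxVertex, Finset.mem_filter.2 ⟨x.maxVertex_mem, rfl⟩⟩, hq0, fun v hv => ?_, fun u hu => ?_⟩
  · rw [(Finset.mem_filter.1 hv).2]
    exact hq2
  · by_cases hs : u ∈ x.1.support
    · have h1 : x.1 u < x.1 x.maxVertex :=
        lt_of_le_of_ne (x.le_maxVertex u) fun h => hu (Finset.mem_filter.2 ⟨hs, h⟩)
      exact (Finset.le_max' T _ (Finset.mem_insert_of_mem (Finset.mem_image_of_mem _
        (Finset.mem_filter.2 ⟨hs, h1⟩)))).trans_lt hq1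
    · rw [Finsupp.notMem_support_iff.1 hs]
      exact hq0

theorem maxVertex_mem_of_mem_levelRegion {x : GeometricRealization K} {S : Finset V} {q : ℝ}
    (hS : S.Nonempty) (hx : x ∈ levelRegion K S q) : x.maxVertex ∈ S := by
  by_contra h
  obtain ⟨v, hv⟩ := hS
  have h1 := hx.1 v hv
  have h2 := hx.2 _ h
  have h3 := x.le_maxVertex v
  linarith

theorem subset_support_of_mem_levelRegion {x : GeometricRealization K} {S : Finset V} {q : ℝ}
    (hq : 0 < q) (hx : x ∈ levelRegion K S q) : S ⊆ x.1.support :=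
  fun v hv => Finsupp.mem_support_iff.2 (hq.trans (hx.1 v hv)).ne'

end GeometricRealization

/-! ### The invariant cover of the deleted product. -/

namespace DeletedProduct

open GeometricRealization

variable {V : Type*} {K : PreAbstractSimplicialComplex V}

theorem continuous_val : Continuous fun p : DeletedProduct K => p.1 :=
  continuous_le_dom (weakTopology_le _ _) continuous_induced_dom

/-- Barycentric coordinates separate points and are continuous. Separation is needed for the orbit
projection to be a covering. -/
instance : T2Space (DeletedProduct K) := by
  have h : Continuous fun p : DeletedProduct K =>
      ((fun v => p.1.1.1 v, fun v => p.1.2.1 v) : (V → ℝ) × (V → ℝ)) :=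
    (continuous_pi fun v => (continuous_coord v).comp (continuous_fst.comp continuous_val)).prodMk
      (continuous_pi fun v => (continuous_coord v).comp (continuous_snd.comp continuous_val))
  refine T2Space.of_injective_continuous (fun p q hpq => ?_) h
  refine Subtype.ext (Prod.ext (Subtype.ext ?_) (Subtype.ext ?_))
  · exact DFunLike.coe_injective (congrArg Prod.fst hpq)
  · exact DFunLike.coe_injective (congrArg Prod.snd hpq)

theorem disjoint_support (p : DeletedProduct K) : Disjoint p.1.1.1.support p.1.2.1.support := by
  obtain ⟨c, h1, h2⟩ := p.2
  exact c.2.2.2.mono h1 h2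

/-- The vertices at which the two components have their largest coordinates. -/
noncomputable def maxVertices (p : DeletedProduct K) : V × V := (p.1.1.maxVertex, p.1.2.maxVertex)

theorem maxVertices_ne (p : DeletedProduct K) : p.maxVertices.1 ≠ p.maxVertices.2 :=
  fun h => Finset.disjoint_left.1 p.disjoint_support p.1.1.maxVertex_mem
    (by rw [show p.1.1.maxVertex = p.1.2.maxVertex from h]; exact p.1.2.maxVertex_mem)

theorem invol_eq (p : DeletedProduct K) : Z2.invol (DeletedProduct K) p = p.swap :=
  if_neg (t := p) (by decide : (Multiplicative.ofAdd (1 : ZMod 2) : Z2) ≠ 1)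

variable (V) in
/-- The index set of the level regions: nonempty vertex sets with positive levels. -/
abbrev Level : Type _ := {c : Finset V × ℝ // c.1.Nonempty ∧ 0 < c.2}

variable (K) in
/-- The product of two level regions. -/
def productRegion (i : Level V × Level V) : Set (DeletedProduct K) :=
  {p | p.1.1 ∈ levelRegion K i.1.1.1 i.1.1.2 ∧ p.1.2 ∈ levelRegion K i.2.1.1 i.2.1.2}

theorem isOpen_productRegion (i : Level V × Level V) : IsOpen (productRegion K i) :=
  ((isOpen_levelRegion _ i.1.2.2).preimage (continuous_fst.comp continuous_val)).inter
    ((isOpen_levelRegion _ i.2.2.2).preimage (continuous_snd.comp continuous_val))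

theorem exists_mem_productRegion (p : DeletedProduct K) : ∃ i, p ∈ productRegion K i := by
  obtain ⟨S, q, hS, hq, h1⟩ := p.1.1.exists_mem_levelRegion
  obtain ⟨T, r, hT, hr, h2⟩ := p.1.2.exists_mem_levelRegion
  exact ⟨(⟨(S, q), hS, hq⟩, ⟨(T, r), hT, hr⟩), h1, h2⟩

theorem invol_preimage_productRegion (i : Level V × Level V) :
    Z2.invol (DeletedProduct K) ⁻¹' productRegion K i =
      productRegion K (Equiv.prodComm (Level V) (Level V) i) := by
  ext p
  rw [Set.mem_preimage, invol_eq]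
  exact and_comm

/-- At a point of the region the two vertex sets lie in the supports of its components, which are
disjoint simplices. This one product of simplices contains all the dominating pairs of a small
singular simplex, even though the choice of dominating vertex is not continuous. -/
theorem within_subset_validPairs [DecidableEq V] {i : Level V × Level V} {p : DeletedProduct K}
    (hp : p ∈ productRegion K i) (n : ℕ) :
    ListPairChain.within (i.1.1.1 : Set V) (i.2.1.1 : Set V) n ⊆ validPairs K := by
  rintro ⟨a, b⟩ ⟨ha, hb, -, hS, hT⟩
  have h1 : a.toFinset ⊆ p.1.1.1.support := fun v hv =>
    subset_support_of_mem_levelRegion i.1.2.2 hp.1 (hS v (List.mem_toFinset.1 hv))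
  have h2 : b.toFinset ⊆ p.1.2.1.support := fun v hv =>
    subset_support_of_mem_levelRegion i.2.2.2 hp.2 (hT v (List.mem_toFinset.1 hv))
  exact ⟨ha, hb, face_of_subset K p.1.1.2.1 h1 (by simpa using ha),
    face_of_subset K p.1.2.2.1 h2 (by simpa using hb), p.disjoint_support.mono h1 h2⟩

theorem disjoint_of_mem_productRegion {i : Level V × Level V} {p : DeletedProduct K}
    (hp : p ∈ productRegion K i) : Disjoint (i.1.1.1 : Set V) (i.2.1.1 : Set V) :=
  Finset.disjoint_coe.2 (p.disjoint_support.mono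
    (subset_support_of_mem_levelRegion i.1.2.2 hp.1)
    (subset_support_of_mem_levelRegion i.2.2.2 hp.2))

theorem maxVertices_mem {i : Level V × Level V} {p : DeletedProduct K}
    (hp : p ∈ productRegion K i) : p.maxVertices ∈ (i.1.1.1 : Set V) ×ˢ (i.2.1.1 : Set V) :=
  ⟨maxVertex_mem_of_mem_levelRegion i.1.2.1 hp.1, maxVertex_mem_of_mem_levelRegion i.2.2.1 hp.2⟩

/-! ### The vanishing of the power of the Stiefel-Whitney class -/

variable [DecidableEq V] {d : ℕ} (f : GeometricRealization K → EuclideanSpace ℝ (Fin d))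

/-- The sign functions of the coordinates of `f x - f y`. -/
noncomputable def differenceSign (j : ℕ) : (V →₀ ℝ) × (V →₀ ℝ) → ZMod 2 :=
  signFunction fun q => if h : j < d then difference f ⟨j, h⟩ q else 0

omit [DecidableEq V] in
theorem differenceSign_swap (j : ℕ) {q : (V →₀ ℝ) × (V →₀ ℝ)} (hq : q.1 ≠ q.2) :
    differenceSign f j q.swap = differenceSign f j q + 1 := by
  refine signFunction_swap (fun q => ?_) hq
  split_ifs with h
  · exact difference_swap f _ q
  · exact neg_zero.symm

/-- The tuple lies in a set on which some coordinate j < d has constant sign, so the j-th factor is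
zero. -/
theorem coboundaryProduct_differenceSign {p : List V × List V}
    {v : Fin (d + 1) → (V →₀ ℝ) × (V →₀ ℝ)}
    (hv : v ∈ TupleChain.tuplesSmall (signedSets f p) (d + 1)) :
    coboundaryProduct d (differenceSign f) v = 0 := by
  obtain ⟨Q, ⟨-, -, j, hj⟩, hv⟩ := hv
  rcases hj with hj | hj
  · refine coboundaryProduct_eq_zero d _ v j j.2 1 fun i => if_pos (Or.inl ?_)
    simp only [dif_pos j.2]
    exact hj _ (hv i)
  · refine coboundaryProduct_eq_zero d _ v j j.2 0 fun i => if_neg ?_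
    simp only [dif_pos j.2]
    have := hj _ (hv i)
    rintro (h | h)
    · exact lt_asymm this h
    · exact this.ne h.1

/-- The transfer cochains of the sign functions of the coordinates of `f x - f y`. -/
noncomputable def transferCochain (n : ℕ) : SingularCochain (DeletedProduct K) n := fun s =>
  ListPairChain.vertexTransfer Prod.swap (fun p n => TupleChain.tuplesSmall (signedSets f p) n)
    cellVertex (differenceSign f) n fun i => (s (stdSimplex.vertex i)).maxVertices

theorem transferCochain_invol (n : ℕ) (s : SingularSimplex (DeletedProduct K) n) :
    transferCochain f n ((Z2.invol _).comp s) =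
      ListPairChain.vertexTransfer Prod.swap (fun p n => TupleChain.tuplesSmall (signedSets f p) n)
        cellVertex (differenceSign f) n
        (Prod.swap ∘ fun i => (s (stdSimplex.vertex i)).maxVertices) := by
  rw [transferCochain]
  refine congrArg _ (funext fun i => ?_)
  change (Z2.invol _ (s (stdSimplex.vertex i))).maxVertices = _
  rw [invol_eq]
  rfl

omit [DecidableEq V] in
theorem cellVertex_ne {a b : V} (h : a ≠ b) : (cellVertex ([a], [b])).1 ≠ (cellVertex ([a], [b])).2 :=
  fun h' => h (Finsupp.single_left_injective one_ne_zero h')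

theorem transferCochain_zero_add (s : SingularSimplex (DeletedProduct K) 0) :
    transferCochain f 0 s + transferCochain f 0 ((Z2.invol _).comp s) = 1 := by
  rw [transferCochain_invol, transferCochain]
  have hswap : ∀ p : List V × List V, cellVertex p.swap = (cellVertex p).swap := fun _ => rfl
  exact ListPairChain.vertexTransfer_zero_add hswap _ (differenceSign_swap f 0
    (cellVertex_ne (s (stdSimplex.vertex 0)).maxVertices_ne))

theorem coboundary_transferCochain (n : ℕ) (s : SingularSimplex (DeletedProduct K) (n + 1)) :
    coboundary _ n (transferCochain f n) s = ∑ i : Fin (n + 2),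
      ListPairChain.vertexTransfer Prod.swap (fun p n => TupleChain.tuplesSmall (signedSets f p) n)
        cellVertex (differenceSign f) n
        ((fun i => (s (stdSimplex.vertex i)).maxVertices) ∘ i.succAbove) := by
  rw [coboundary_apply]
  refine Finset.sum_congr rfl fun i _ => ?_
  rw [transferCochain]
  congr 1
  funext j
  exact congrArg (fun t => (s t).maxVertices) (stdSimplex.map_vertex _ _)

end DeletedProduct

theorem DeletedProduct.exists_invariant_coboundary {V : Type*} {K : PreAbstractSimplicialComplex V}
    {D : ℕ} {f : GeometricRealization K → EuclideanSpace ℝ (Fin (D + 1))} (hf : Continuous f)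
    (hno : ∀ σ ∈ K.faces, ∀ τ ∈ K.faces, Disjoint σ τ → simplexDim σ + simplexDim τ ≤ D + 1 →
      ¬ (f '' closedSimplex K σ ∩ f '' closedSimplex K τ).Nonempty)
    (g : SingularCochain (DeletedProduct K) 0)
    (hg : ∀ s : SingularSimplex (DeletedProduct K) 0, g ((Z2.invol _).comp s) = g s + 1) :
    ∃ b : SingularCochain (DeletedProduct K) D,
      coboundary _ D b = cochainPow (coboundary _ 0 g) (D + 1) ∧
        ∀ s : SingularSimplex (DeletedProduct K) D, b ((Z2.invol _).comp s) = b s := by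
  classical
  have hcar := isAcyclicCarrier hf hno
  -- Cells of disjoint simplices avoid the diagonal, so the sign functions are odd on them.
  have hsign : ∀ p ∈ validPairs K, ∀ n, ∀ v ∈ TupleChain.tuplesSmall (signedSets f p) n, ∀ j i,
      differenceSign f j (v i).swap = differenceSign f j (v i) + 1 := by
    rintro p hp n v ⟨Q, ⟨-, hQ, -⟩, hv⟩ j i
    exact differenceSign_swap f j (ne_of_mem_cell hp (hQ (hv i)))
  refine exists_invariant_coboundary_eq_cochainPow (productRegion K) isOpen_productRegion
    exists_mem_productRegion (Z2.invol _) Z2.invol_invol (Equiv.prodComm _ _)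
    invol_preimage_productRegion D g hg (transferCochain f)
    (transferCochain_zero_add f) (fun k hk s hs => ?_)
    (fun s hs => ?_)
  · obtain ⟨i, hi⟩ := hs
    rw [transferCochain_invol, coboundary_transferCochain]
    exact hcar.vertexTransfer_succ_add (within_subset_validPairs (hi (stdSimplex.vertex 0)))
      (disjoint_of_mem_productRegion (hi (stdSimplex.vertex 0))) hsign (by omega)
      fun j => maxVertices_mem (hi _)
  · obtain ⟨i, hi⟩ := hs
    rw [coboundary_transferCochain]
    exact hcar.sum_vertexTransfer_eq_zero (within_subset_validPairs (hi (stdSimplex.vertex 0)))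
      le_rfl (fun p _ v hv => coboundaryProduct_differenceSign f hv) fun j => maxVertices_mem (hi _)

/-! ### The height of the deleted product -/

theorem SingularCohomology.cup_zero_left {Y : Type*} [TopologicalSpace Y] {p q n : ℕ}
    (h : p + q = n) (y : SingularCohomology Y q) :
    SingularCohomology.cup h (0 : SingularCohomology Y p) y = 0 := by
  obtain ⟨b, rfl⟩ := Submodule.Quotient.mk_surjective _ y
  refine Eq.trans (b := Submodule.Quotient.mk 0) (congrArg Submodule.Quotient.mk
    (Subtype.ext (funext fun s => ?_))) rfl
  exact zero_mul _

theorem SingularCohomology.cupPow_eq_zero_of_le {Y : Type*} [TopologicalSpace Y]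
    {x : SingularCohomology Y 1} {m n : ℕ} (h : m ≤ n) (hm : x.cupPow m = 0) : x.cupPow n = 0 := by
  induction n, h using Nat.le_induction with
  | base => exact hm
  | succ n _ ih => rw [cupPow, ih, cup_zero_left]

theorem cochainPow_mem_cocycles {Y : Type*} [TopologicalSpace Y] (c : cocycles Y 1) (n : ℕ) :
    cochainPow c.1 n ∈ cocycles Y n := by
  induction n with
  | zero =>
    refine LinearMap.mem_ker.2 (funext fun s => ?_)
    change ∑ _i : Fin 2, (1 : ZMod 2) = 0
    decide
  | succ n ih => exact cochainCup_mem_cocycles rfl _ _ ih c.2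

theorem SingularCohomology.cupPow_mk {Y : Type*} [TopologicalSpace Y] (c : cocycles Y 1) (n : ℕ) :
    SingularCohomology.cupPow (Submodule.Quotient.mk c) n =
      Submodule.Quotient.mk ⟨cochainPow c.1 n, cochainPow_mem_cocycles c n⟩ := by
  induction n with
  | zero => rfl
  | succ n ih => rw [cupPow, ih]; rfl

theorem cochainPullback_cochainPow {X Y : Type*} [TopologicalSpace X] [TopologicalSpace Y]
    (φ : C(X, Y)) (c : SingularCochain Y 1) (n : ℕ) :
    cochainPullback φ n (cochainPow c n) = cochainPow (cochainPullback φ 1 c) n := by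
  induction n with
  | zero => rfl
  | succ n ih => rw [cochainPow, cochainPow, ← ih]; rfl

/-- A vanishing power forces all higher powers to vanish. If every d-th power vanished, all
exponents in the supremum would be below d, which bounds it by d - 1, or by `⊥` when d = 0. -/
theorem exists_cupPow_ne_zero {X : Type*} [TopologicalSpace X] [MulAction Z2 X]
    [ContinuousConstSMul Z2 X] [IsCancelSMul Z2 X] {d : ℕ}
    (h : (d : WithBot ℕ∞) ≤ stiefelWhitneyHeight X) :
    ∃ w : SingularCohomology (OrbitSpace X) 1, IsStiefelWhitneyClass X w ∧ w.cupPow d ≠ 0 := by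
  by_contra! hw
  have hlt : ∀ a ∈ {h : WithBot ℕ∞ | ∃ (n : ℕ) (w : SingularCohomology (OrbitSpace X) 1),
      IsStiefelWhitneyClass X w ∧ w.cupPow n ≠ 0 ∧ h = n}, a < (d : WithBot ℕ∞) := by
    rintro _ ⟨n, w, hw1, hw2, rfl⟩
    by_contra! hle
    exact hw2 (SingularCohomology.cupPow_eq_zero_of_le (by exact_mod_cast hle) (hw w hw1))
  cases d with
  | zero =>
    have hbot : stiefelWhitneyHeight X ≤ ⊥ := sSup_le fun a ha => by
      have h1 := hlt a ha
      obtain ⟨n, w, -, -, rfl⟩ := ha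
      exact absurd (by exact_mod_cast h1 : n < 0) (Nat.not_lt_zero n)
    exact absurd (h.trans hbot) (by simp)
  | succ d =>
    have hle : stiefelWhitneyHeight X ≤ (d : WithBot ℕ∞) := sSup_le fun a ha => by
      have h1 := hlt a ha
      obtain ⟨n, w, -, -, rfl⟩ := ha
      have h2 : n < d + 1 := by exact_mod_cast h1
      exact_mod_cast Nat.lt_succ_iff.1 h2
    have h3 : d + 1 ≤ d := by exact_mod_cast h.trans hle
    omega

theorem IsStiefelWhitneyClass.nonempty_of_cupPow_zero {X : Type*} [TopologicalSpace X]
    [MulAction Z2 X] {w : SingularCohomology (OrbitSpace X) 1} (h : w.cupPow 0 ≠ 0) :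
    Nonempty X := by
  by_contra hX
  rw [not_nonempty_iff] at hX
  refine h (congrArg Submodule.Quotient.mk (Subtype.ext (funext fun s => ?_)))
  obtain ⟨x, -⟩ := Quotient.exists_rep (s (stdSimplex.vertex 0))
  exact hX.elim x

theorem proposition3p2 {V : Type*} (K : PreAbstractSimplicialComplex V) (d : ℕ)
    (hK : (d : WithBot ℕ∞) ≤ stiefelWhitneyHeight (DeletedProduct K))
    (f : GeometricRealization K → EuclideanSpace ℝ (Fin d)) (hf : Continuous f) :
    ∃ σ ∈ K.faces, ∃ τ ∈ K.faces, Disjoint σ τ ∧ simplexDim σ + simplexDim τ ≤ d ∧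
      (f '' closedSimplex K σ ∩ f '' closedSimplex K τ).Nonempty := by
  classical
  obtain ⟨w, hw, hne⟩ := exists_cupPow_ne_zero hK
  cases d with
  | zero =>
    -- A point of the deleted product provides two distinct vertices of K, and any two points of ℝ^0
    -- coincide.
    obtain ⟨p⟩ := IsStiefelWhitneyClass.nonempty_of_cupPow_zero hne
    have hface : ∀ x : GeometricRealization K, {x.maxVertex} ∈ K.faces := fun x =>
      DeletedProduct.face_of_subset K x.2.1 (Finset.singleton_subset_iff.2 x.maxVertex_mem)
        (Finset.singleton_nonempty _)
    have hpt : ∀ v : V, {v} ∈ K.faces → (closedSimplex K {v}).Nonempty := fun v hv =>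
      ⟨DeletedProduct.toRealization K hv ⟨Finsupp.single v 1,
        DeletedProduct.single_mem_simplexSet (Finset.mem_singleton_self v)⟩,
        (DeletedProduct.single_mem_simplexSet (Finset.mem_singleton_self v)).1⟩
    refine ⟨_, hface p.1.1, _, hface p.1.2, ?_, by simp [simplexDim], ?_⟩
    · exact Finset.disjoint_singleton.2 p.maxVertices_ne
    · obtain ⟨x, hx⟩ := hpt _ (hface p.1.1)
      obtain ⟨y, hy⟩ := hpt _ (hface p.1.2)
      exact ⟨f x, ⟨x, hx, rfl⟩, ⟨y, hy, Subsingleton.elim _ _⟩⟩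
  | succ D =>
    by_contra! hno
    obtain ⟨c, g, rfl, hg, hgc⟩ := hw.exists_representative
    obtain ⟨b, hb, hinv⟩ := DeletedProduct.exists_invariant_coboundary hf
      (fun σ hσ τ hτ h1 h2 h3 => h3.ne_empty (hno σ hσ τ hτ h1 h2)) g hg
    -- The power of the representing cocycle lifts to the power of δg, which is the coboundary of an
    -- invariant cochain, so it is already a coboundary on the orbit space.
    refine hne ?_
    rw [SingularCohomology.cupPow_mk]
    refine (Submodule.Quotient.mk_eq_zero _).2 ?_
    refine OrbitSpace.mem_coboundaries _ b ?_ hinv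
    rw [hb, hgc]
    exact (cochainPullback_cochainPow _ _ _).symm
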